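/- Fix a strictness signature $\overline a=a_0a_1a_2\in\{0,1\}^3$ and a countably infinite set $\mathcal V$ of variables. **Lambda trees.** A position is a finite sequence over $\{0,1,2\}$. A lambda tree is a partial function $t$ from positions to labels $\lambda$, $@$, positions (bound variables) and elements of $\mathcal V$ (free variables), such that $p\cdot 0\in\mathrm{dom}\,t$ implies $t(p)=\lambda$; $p\cdot 1\in\mathrm{dom}\,t$ or $p\cdot 2\in\mathrm{dom}\,t$ implies $t(p)=@$; and if $t(p)$ is a position $q$ then $q\le p$ and $t(q)=\lambda$. The empty tree is $\bot$; $t$ is total if it has no hole (no $\bot$-position: the root, the child $0$ of a $\lambda$, or a child $1,2$ of an $@$, when it is not in $\mathrm{dom}\,t$). The $\overline a$-depth $|p|$ of $p$ is the number of its entries $i$ with $a_i=1$; $p$ is strict if it ends in some $i$ with $a_i=0$, and $\widehat p$ is the longest non-strict prefix of $p$. Let $\mathcal T$ be the set of lambda trees that are $\overline a$-guarded, i.e. without an infinite branch along which the $\overline a$-depth is bounded. On $\mathcal T$, let $d(s,t)=0$ if $s=t$ and otherwise $2^{-n}$ with $n$ the least $|p|$ such that $s$ and $t$ differ at $p$;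 and let $s\le t$ iff $t$ extends $s$ as a partial function and $p\in\mathrm{dom}\,s$, $p\cdot i\in\mathrm{dom}\,t$, $a_i=0$ imply $p\cdot i\in\mathrm{dom}\,s$. Abstraction, application, subtrees and capture-avoiding substitution are as usual; for the subtree at a position and for the body of an abstraction, variables bound above are represented by fresh free variables, which are always available. **Reductions.** For a set $R$ of rules (pairs $(l,r)$ of trees in $\mathcal T$ with $l\ne\bot$), $s\to_{R,p}t$ means that $t$ arises from $s$ by replacing the subtree $l$ at $p$ by $r$ for some $(l,r)\in R$. The reduction context of this step is the greatest $c\in\mathcal T$ with $c\le s$, $c\le t$, $p\notin\mathrm{dom}\,c$. An $R$-reduction is a sequence $S=(t_\iota\to_{R,p_\iota}t_{\iota+1})_{\iota<\alpha}$, $\alpha$ an ordinal, with reduction contexts $c_\iota$. * $S$ $p$-converges to $t_\alpha$ if $t_\gamma=\liminf_{\iota\to\gamma}c_\iota=\bigsqcup_{\beta<\gamma}\bigsqcap_{\beta\le\iota<\gamma}c_\iota$ in $(\mathcal T,\le)$ for all limit ordinals $\gamma\le\alpha$; it is $p$-continuous if this holds for all limit ordinals $\gamma<\alpha$. * $S$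 $m$-converges to $t_\alpha$ if, for all limit ordinals $\gamma\le\alpha$, $\lim_{\iota\to\gamma}t_\iota=t_\gamma$ in $(\mathcal T,d)$ and $(|p_\iota|)_{\iota<\gamma}$ tends to infinity. * $S$ is destructive if $\alpha$ is a limit ordinal, $S$ is $p$-continuous, and for each $\beta<\alpha$ there is $\beta\le\gamma<\alpha$ with $\widehat{p_\gamma}$ the empty position. **Rules.** Let $\beta=\{((\lambda x.t)\,s,\ t[x:=s])\}$, and let $\mathsf S$ consist of the rules $t_1\,t_2\to\bot$ for which $t_i=\bot$ and $a_i=0$ for some $i\in\{1,2\}$, and $\lambda x.\bot\to\bot$ if $a_0=0$. Let $\mathcal F$ be the set of total trees in $\mathcal T$ from which a destructive $\beta$-reduction starts. Let $\mathcal F_\bot$ be the set of trees $t$ such that some $s\in\mathcal F$ extends $t$ and has a subtree in $\mathcal F$ at each $\bot$-position of $t$. Let $\mathcal B=\beta\cup\{(t,\bot) : t\in\mathcal F_\bot,\ t\ne\bot\}$. **Theorem.** Let $s,t\in\mathcal T$. If some $(\beta\cup\mathsf S)$-reduction starting from $s$ $p$-converges to $t$, then some $\mathcal B$-reduction starting from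 $s$ $m$-converges to $t$. -/

import Mathlib

universe u

namespace LamCalc

/-! Positions, strictness signatures, `a`-depth -/

/-- Positions: finite sequences over `{0,1,2}`, read from the root; `p <+: q` is `p ≤ q`. -/
abbrev Pos := List (Fin 3)

/-- Strictness signatures `a₀a₁a₂`; `true` is `1` (non-strict), `false` is `0` (strict). -/
abbrev Sig := Fin 3 → Bool

/-- The `a`-depth of a position: the number of its entries `i` with `aᵢ = 1`. -/
def depth (a : Sig) (p : Pos) : ℕ := p.countP a

/-- The longest non-strict prefix of `p` (non-strict: empty, or ending in `i` with `aᵢ = 1`). -/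
def cut (a : Sig) (p : Pos) : Pos := p.rdropWhile (fun i => !(a i))

/-! Lambda trees -/

/-- Node labels: abstraction, application, a variable bound by the abstraction at position `q`,
a free variable `x`. -/
inductive Label (V : Type u) : Type u
  | lam : Label V
  | app : Label V
  | bvar (q : Pos) : Label V
  | fvar (x : V) : Label V

/-- Lambda trees with free variables in `V`; `t.lab p = none` says that `p` is not in the domain
of the partial function `t`. -/
@[ext] structure LamTree (V : Type u) : Type u where
  lab : Pos → Option (Label V)
  lam_of_zero : ∀ p, lab (p ++ [0]) ≠ none → lab p = some Label.lam
  app_of_one : ∀ p, lab (p ++ [1]) ≠ none → lab p = some Label.app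
  app_of_two : ∀ p, lab (p ++ [2]) ≠ none → lab p = some Label.app
  binder : ∀ p q, lab p = some (Label.bvar q) → q <+: p ∧ lab q = some Label.lam

namespace LamTree

variable {V : Type u}

/-- The domain of a lambda tree. -/
def dom (t : LamTree V) : Set Pos := {p | t.lab p ≠ none}

/-- The `⊥`-positions of a lambda tree. -/
inductive BotPos (t : LamTree V) : Pos → Prop
  | root : [] ∉ t.dom → BotPos t []
  | body (p : Pos) : t.lab p = some Label.lam → p ++ [0] ∉ t.dom → BotPos t (p ++ [0])
  | left (p : Pos) : t.lab p = some Label.app → p ++ [1] ∉ t.dom → BotPos t (p ++ [1])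
  | right (p : Pos) : t.lab p = some Label.app → p ++ [2] ∉ t.dom → BotPos t (p ++ [2])

/-- A lambda tree is total if it has no `⊥`-positions. -/
def Total (t : LamTree V) : Prop := ∀ p, ¬ t.BotPos p

/-- The prefix of length `n` of an infinite sequence. -/
def pref (S : ℕ → Fin 3) (n : ℕ) : Pos := (List.range n).map S

/-- `S` is an infinite branch of `t`. -/
def IsBranch (t : LamTree V) (S : ℕ → Fin 3) : Prop := ∀ n, pref S n ∈ t.dom

/-- No infinite branch of `t` has bounded `a`-depth. -/
def Guarded (a : Sig) (t : LamTree V) : Prop :=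
  ¬ ∃ S : ℕ → Fin 3, t.IsBranch S ∧ ∃ d, ∀ n, depth a (pref S n) < d

theorem mem_dom_of_append (t : LamTree V) (p q : Pos) (h : p ++ q ∈ t.dom) : p ∈ t.dom := by
  induction q using List.reverseRecOn with
  | nil => simpa using h
  | append_singleton q i ih =>
    apply ih
    rw [← List.append_assoc] at h
    have h' : t.lab ((p ++ q) ++ [i]) ≠ none := h
    change t.lab (p ++ q) ≠ none
    match i, h' with
    | 0, h' => simp [t.lam_of_zero _ h']
    | 1, h' => simp [t.app_of_one _ h']
    | 2, h' => simp [t.app_of_two _ h']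

/-- A position at or below a child of `p` shows that the node at `p` is not a variable. -/
theorem lab_of_proper (t : LamTree V) (p q : Pos) (hq : q ≠ []) (h : p ++ q ∈ t.dom) :
    t.lab p = some Label.lam ∨ t.lab p = some Label.app := by
  obtain ⟨i, q', rfl⟩ := List.exists_cons_of_ne_nil hq
  have h2 : p ++ [i] ∈ t.dom := t.mem_dom_of_append (p ++ [i]) q' (by simpa using h)
  have h' : t.lab (p ++ [i]) ≠ none := h2
  match i, h' with
  | 0, h' => exact Or.inl (t.lam_of_zero _ h')
  | 1, h' => exact Or.inr (t.app_of_one _ h')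
  | 2, h' => exact Or.inr (t.app_of_two _ h')

/-! Constructions of lambda trees -/

/-- The empty lambda tree `⊥`. -/
def bot : LamTree V where
  lab _ := none
  lam_of_zero := by simp
  app_of_one := by simp
  app_of_two := by simp
  binder := by simp

end LamTree

/-- Relabelling of the body of an abstraction: `none` is the variable to be bound. -/
def Label.abs {V : Type u} : Label (Option V) → Label V
  | .lam => .lam
  | .app => .app
  | .bvar q => .bvar (0 :: q)
  | .fvar none => .bvar []
  | .fvar (some x) => .fvar x

/-- Moving a label below the position `p`. -/
def Label.shift {V : Type u} (p : Pos) : Label V → Label V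
  | .lam => .lam
  | .app => .app
  | .bvar q => .bvar (p ++ q)
  | .fvar x => .fvar x

/-- Labels of the subtree at `p`: variables that are bound below `p` stay bound; a variable that is
bound by an abstraction at a position `q` above `p` becomes the free variable `Sum.inr q`. -/
def Label.sub {V : Type u} (p : Pos) : Label V → Label (V ⊕ Pos)
  | .lam => .lam
  | .app => .app
  | .bvar q => if p <+: q then .bvar (q.drop p.length) else .fvar (Sum.inr q)
  | .fvar x => .fvar (Sum.inl x)

/-- Labels of `b` that are kept by a substitution for the variable `none`. -/
def Label.keep {V : Type u} : Label (Option V) → Option (Label V)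
  | .lam => some .lam
  | .app => some .app
  | .bvar q => some (.bvar q)
  | .fvar none => none
  | .fvar (some x) => some (.fvar x)

namespace LamTree

variable {V : Type u}

/-- The abstraction over the variable `none` with body `b`. -/
def abs (b : LamTree (Option V)) : LamTree V where
  lab
    | [] => some .lam
    | 0 :: p => (b.lab p).map Label.abs
    | _ :: _ => none
  lam_of_zero := by
    rintro (_ | ⟨i, p⟩) h
    · rfl
    · fin_cases i <;> simp at h ⊢
      have := b.lam_of_zero p (by simpa using h)
      simp [this, Label.abs]
  app_of_one := by
    rintro (_ | ⟨i, p⟩) h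
    · simp at h
    · fin_cases i <;> simp at h ⊢
      have := b.app_of_one p (by simpa using h)
      simp [this, Label.abs]
  app_of_two := by
    rintro (_ | ⟨i, p⟩) h
    · simp at h
    · fin_cases i <;> simp at h ⊢
      have := b.app_of_two p (by simpa using h)
      simp [this, Label.abs]
  binder := by
    rintro (_ | ⟨i, p⟩) q h
    · simp at h
    · fin_cases i <;> simp at h ⊢
      obtain ⟨l, hl, h⟩ := h
      match l, hl, h with
      | .bvar q', hl, h =>
        simp only [Label.abs, Label.bvar.injEq] at h
        subst h
        have := b.binder p q' hl
        simp [this, Label.abs]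
      | .fvar none, hl, h =>
        simp only [Label.abs, Label.bvar.injEq] at h
        subst h
        simp

/-- The application of `t₁` to `t₂`. -/
def app (t₁ t₂ : LamTree V) : LamTree V where
  lab
    | [] => some .app
    | 0 :: _ => none
    | 1 :: p => (t₁.lab p).map (Label.shift [1])
    | 2 :: p => (t₂.lab p).map (Label.shift [2])
  lam_of_zero := by
    rintro (_ | ⟨i, p⟩) h
    · simp at h
    · fin_cases i <;> simp at h ⊢
      · simp [t₁.lam_of_zero p (by simpa using h), Label.shift]
      · simp [t₂.lam_of_zero p (by simpa using h), Label.shift]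
  app_of_one := by
    rintro (_ | ⟨i, p⟩) h
    · rfl
    · fin_cases i <;> simp at h ⊢
      · simp [t₁.app_of_one p (by simpa using h), Label.shift]
      · simp [t₂.app_of_one p (by simpa using h), Label.shift]
  app_of_two := by
    rintro (_ | ⟨i, p⟩) h
    · rfl
    · fin_cases i <;> simp at h ⊢
      · simp [t₁.app_of_two p (by simpa using h), Label.shift]
      · simp [t₂.app_of_two p (by simpa using h), Label.shift]
  binder := by
    rintro (_ | ⟨i, p⟩) q h
    · simp at h
    · fin_cases i <;> simp at h ⊢
      · obtain ⟨l, hl, h⟩ := h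
        match l, hl, h with
        | .bvar q', hl, h =>
          simp only [Label.shift, Label.bvar.injEq] at h
          subst h
          have := t₁.binder p q' hl
          simp [this, Label.shift]
      · obtain ⟨l, hl, h⟩ := h
        match l, hl, h with
        | .bvar q', hl, h =>
          simp only [Label.shift, Label.bvar.injEq] at h
          subst h
          have := t₂.binder p q' hl
          simp [this, Label.shift]

/-- The subtree of `t` at position `p`. -/
def subtree (t : LamTree V) (p : Pos) : LamTree (V ⊕ Pos) where
  lab r := (t.lab (p ++ r)).map (Label.sub p)
  lam_of_zero r h := by
    have := t.lam_of_zero (p ++ r) (by simpa using h)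
    simp [this, Label.sub]
  app_of_one r h := by
    have := t.app_of_one (p ++ r) (by simpa using h)
    simp [this, Label.sub]
  app_of_two r h := by
    have := t.app_of_two (p ++ r) (by simpa using h)
    simp [this, Label.sub]
  binder r q h := by
    rw [Option.map_eq_some_iff] at h
    obtain ⟨l, hl, h⟩ := h
    match l, hl, h with
    | .bvar q', hl, h =>
      have hb := t.binder _ _ hl
      simp only [Label.sub] at h
      split_ifs at h with hp
      obtain ⟨q'', rfl⟩ := hp
      simp only [List.drop_left, Label.bvar.injEq] at h
      subst h
      refine ⟨(List.prefix_append_right_inj p).1 hb.1, ?_⟩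
      simp [hb.2, Label.sub]

/-- The variable `none` of `b` occurs at the prefix of length `n` of `p`. -/
def HitAt (b : LamTree (Option V)) (p : Pos) (n : ℕ) : Prop :=
  n ≤ p.length ∧ b.lab (p.take n) = some (.fvar none)

theorem not_hit_of_mem_dom (b : LamTree (Option V)) (p : Pos) (l : Label (Option V))
    (h : b.lab p = some l) (hl : l ≠ .fvar none) (n : ℕ) : ¬ b.HitAt p n := by
  rintro ⟨hn, hb⟩
  rcases hn.eq_or_lt with rfl | hlt
  · rw [List.take_length, h] at hb
    exact hl (by simpa using hb)
  · have := b.lab_of_proper (p.take n) (p.drop n) (by simpa using hlt)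
      (by rw [List.take_append_drop]; simp [dom, h])
    simp [hb] at this

theorem hit_unique (b : LamTree (Option V)) (p : Pos) (m n : ℕ) (hm : b.HitAt p m)
    (hn : b.HitAt p n) : m = n := by
  have key : ∀ m n, b.HitAt p m → b.HitAt p n → ¬ m < n := by
    intro m n hm hn hlt
    have := b.lab_of_proper (p.take m) ((p.take n).drop m)
      (by
        have := hn.1
        apply List.ne_nil_of_length_pos
        simp only [List.length_drop, List.length_take]
        omega)
      (by
        have : (p.take n).take m = p.take m := by rw [List.take_take, min_eq_left hlt.le]
        rw [← this, List.take_append_drop]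
        simp [dom, hn.2])
    simp [hm.2] at this
  have h1 := key m n hm hn
  have h2 := key n m hn hm
  omega

open Classical in
/-- Labels of the substitution of `s` for the variable `none` in `b`: if `p = p₁ p₂` and `p₁` is an
occurrence of that variable in `b`, it is the label of `s` at `p₂`, moved below `p₁`; otherwise it is
the label of `b` at `p`. -/
noncomputable def substLab (b : LamTree (Option V)) (s : LamTree V) (p : Pos) :
    Option (Label V) :=
  if h : ∃ n, b.HitAt p n then
    (s.lab (p.drop h.choose)).map (Label.shift (p.take h.choose))
  else
    (b.lab p).bind Label.keep

theorem substLab_hit (b : LamTree (Option V)) (s : LamTree V) (p r : Pos)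
    (h : b.lab p = some (.fvar none)) :
    substLab b s (p ++ r) = (s.lab r).map (Label.shift p) := by
  have h0 : b.HitAt (p ++ r) p.length := ⟨by simp, by simpa using h⟩
  have hex : ∃ n, b.HitAt (p ++ r) n := ⟨_, h0⟩
  have e : hex.choose = p.length := b.hit_unique _ _ _ hex.choose_spec h0
  rw [substLab, dif_pos hex, e]
  simp

theorem substLab_miss (b : LamTree (Option V)) (s : LamTree V) (p : Pos)
    (h : ∀ n, ¬ b.HitAt p n) : substLab b s p = (b.lab p).bind Label.keep := by
  rw [substLab, dif_neg (by simpa using h)]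

theorem hit_cases (b : LamTree (Option V)) (p : Pos) :
    (∃ p₁ p₂, p = p₁ ++ p₂ ∧ b.lab p₁ = some (.fvar none)) ∨ ∀ n, ¬ b.HitAt p n := by
  by_cases h : ∃ n, b.HitAt p n
  · obtain ⟨n, hn⟩ := h
    exact Or.inl ⟨p.take n, p.drop n, (List.take_append_drop n p).symm, hn.2⟩
  · exact Or.inr (by simpa using h)

theorem substLab_child (b : LamTree (Option V)) (s : LamTree V) (i : Fin 3)
    (l : ∀ {W : Type u}, Label W) (hk : (l (W := Option V)).keep = some l)
    (hs : ∀ p, Label.shift p (l (W := V)) = l)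
    (hnv : (l (W := Option V)) ≠ .fvar none)
    (hb : ∀ p, b.lab (p ++ [i]) ≠ none → b.lab p = some l)
    (hs' : ∀ p, s.lab (p ++ [i]) ≠ none → s.lab p = some l) (p : Pos)
    (h : substLab b s (p ++ [i]) ≠ none) : substLab b s p = some l := by
  have miss : b.lab (p ++ [i]) ≠ none → substLab b s p = some l := fun h' => by
    have := hb p h'
    rw [substLab_miss b s p (b.not_hit_of_mem_dom p _ this hnv), this]
    simpa using hk
  rcases b.hit_cases (p ++ [i]) with ⟨p₁, p₂, e, h1⟩ | hm
  · rcases List.eq_nil_or_concat p₂ with rfl | ⟨r, j, rfl⟩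
    · apply miss
      rw [e, List.append_nil, h1]
      simp
    · rw [List.concat_eq_append, ← List.append_assoc] at e
      obtain ⟨rfl, hj⟩ := List.append_inj' e rfl
      obtain rfl : i = j := by simpa using hj
      rw [List.append_assoc, substLab_hit b s p₁ _ h1] at h
      rw [substLab_hit b s p₁ _ h1, hs' r (by simpa using h)]
      simp [hs]
  · apply miss
    rw [substLab_miss b s _ hm] at h
    intro h0
    simp [h0] at h

/-- The substitution of `s` for the variable `none` in `b`. -/
noncomputable def subst (b : LamTree (Option V)) (s : LamTree V) : LamTree V where
  lab := substLab b s
  lam_of_zero := substLab_child b s 0 .lam rfl (fun _ => rfl) (by simp) b.lam_of_zero s.lam_of_zero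
  app_of_one := substLab_child b s 1 .app rfl (fun _ => rfl) (by simp) b.app_of_one s.app_of_one
  app_of_two := substLab_child b s 2 .app rfl (fun _ => rfl) (by simp) b.app_of_two s.app_of_two
  binder p q h := by
    rcases b.hit_cases p with ⟨p₁, p₂, rfl, h1⟩ | hm
    · rw [substLab_hit b s p₁ _ h1, Option.map_eq_some_iff] at h
      obtain ⟨l, hl, h⟩ := h
      match l, hl, h with
      | .bvar q', hl, h =>
        simp only [Label.shift, Label.bvar.injEq] at h
        subst h
        have := s.binder _ _ hl
        refine ⟨(List.prefix_append_right_inj p₁).2 this.1, ?_⟩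
        rw [substLab_hit b s p₁ _ h1, this.2]
        rfl
    · rw [substLab_miss b s p hm, Option.bind_eq_some_iff] at h
      obtain ⟨l, hl, h⟩ := h
      match l, hl, h with
      | .bvar q', hl, h =>
        simp only [Label.keep, Option.some.injEq, Label.bvar.injEq] at h
        subst h
        have := b.binder _ _ hl
        refine ⟨this.1, ?_⟩
        rw [substLab_miss b s _ (b.not_hit_of_mem_dom _ _ this.2 (by simp)), this.2]
        rfl
      | .fvar (some x), hl, h => simp [Label.keep] at h

theorem subtree_guarded (a : Sig) (t : LamTree V) (p : Pos) (h : t.Guarded a) :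
    (t.subtree p).Guarded a := by
  rintro ⟨S, hS, d, hd⟩
  let S' : ℕ → Fin 3 := fun k => if hk : k < p.length then p[k] else S (k - p.length)
  have e : ∀ n, pref S' (p.length + n) = p ++ pref S n := by
    intro n
    apply List.ext_getElem
    · simp [pref]
    · intro k h1 h2
      by_cases hk : k < p.length
      · simp [pref, S', hk]
      · simp [pref, S', hk, List.getElem_append_right (not_lt.1 hk)]
  have hpre : ∀ m n, pref S' (m + n) = pref S' m ++ (pref S' (m + n)).drop m := by
    intro m n
    conv_lhs => rw [← List.take_append_drop m (pref S' (m + n))]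
    congr 1
    simp [pref, ← List.map_take, List.take_range]
  have hdom : ∀ n, pref S' (p.length + n) ∈ t.dom := by
    intro n
    rw [e]
    have : (t.subtree p).lab (pref S n) ≠ none := hS n
    simpa [subtree, dom] using this
  refine h ⟨S', fun n => ?_, depth a p + d, fun n => ?_⟩
  · have h2 := hdom n
    rw [add_comm, hpre] at h2
    exact t.mem_dom_of_append _ _ h2
  · have h1 : depth a (pref S' (p.length + n)) < depth a p + d := by
      rw [e]
      have := hd n
      simp only [depth, List.countP_append] at this ⊢
      omega
    rw [add_comm, hpre] at h1
    simp only [depth, List.countP_append] at h1 ⊢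
    omega

end LamTree

/-! The universe of `a`-guarded lambda trees, its partial order and its metric -/

/-- The `a`-guarded lambda trees. -/
@[ext] structure GTree (a : Sig) (V : Type u) : Type u extends LamTree V where
  guarded : toLamTree.Guarded a

namespace GTree

variable {a : Sig} {V : Type u}

/-- The order `s ≤ t` of signature `a`: `t` extends `s`, and no hole of `s` at an `a`-strict position
is filled. -/
instance : PartialOrder (GTree a V) where
  le s t := s.dom ⊆ t.dom ∧ (∀ p ∈ s.dom, s.lab p = t.lab p) ∧
    ∀ p i, a i = false → p ++ [i] ∈ t.dom → p ∈ s.dom → p ++ [i] ∈ s.dom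
  le_refl s := ⟨subset_rfl, fun _ _ => rfl, fun _ _ _ h _ => h⟩
  le_trans s t r h1 h2 := ⟨h1.1.trans h2.1,
    fun p hp => (h1.2.1 p hp).trans (h2.2.1 p (h1.1 hp)),
    fun p i hi hr hp => h1.2.2 p i hi (h2.2.2 p i hi hr (h1.1 hp)) hp⟩
  le_antisymm s t h1 h2 := by
    apply GTree.ext
    funext p
    by_cases hp : p ∈ s.dom
    · exact h1.2.1 p hp
    · have hq : p ∉ t.dom := fun h => hp (h2.1 h)
      simp only [LamTree.dom, Set.mem_ofPred_eq, not_not] at hp hq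
      rw [hp, hq]

/-- The empty lambda tree `⊥`. -/
def bot : GTree a V where
  toLamTree := LamTree.bot
  guarded := fun ⟨_, hS, _⟩ => hS 0 rfl

/-- The subtree at position `p`. -/
def subtree (t : GTree a V) (p : Pos) : GTree a (V ⊕ Pos) where
  toLamTree := t.toLamTree.subtree p
  guarded := t.toLamTree.subtree_guarded a p t.guarded

open Classical in
/-- The metric of signature `a`: `0` if `s = t`, otherwise `2⁻ᵈ` for the least `a`-depth `d` of a
position at which `s` and `t` differ. -/
noncomputable def mdist (s t : GTree a V) : ℝ :=
  if s = t then 0 else (1 / 2 : ℝ) ^ sInf {d | ∃ p, s.lab p ≠ t.lab p ∧ d = depth a p}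

end GTree

/-! Rewrite systems and reductions -/

/-- A rewrite system, given uniformly in the set of free variables. -/
abbrev RewriteSystem (a : Sig) := ∀ V : Type u, GTree a V → GTree a V → Prop

/-- A reduction step at position `p`: the subtree at `p` is rewritten by `R`, and all the rest is
unchanged. -/
def Step {a : Sig} (R : RewriteSystem.{u} a) {V : Type u} (p : Pos) (s t : GTree a V) : Prop :=
  R (V ⊕ Pos) (s.subtree p) (t.subtree p) ∧ ∀ q, ¬ p <+: q → s.lab q = t.lab q

/-- The union of two rewrite systems. -/
def RewriteSystem.union {a : Sig} (R R' : RewriteSystem.{u} a) : RewriteSystem.{u} a :=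
  fun V s t => R V s t ∨ R' V s t

/-- The `β`-rule. -/
def betaRed (a : Sig) : RewriteSystem.{u} a := fun V l r =>
  ∃ (b : GTree a (Option V)) (s : GTree a V),
    l.toLamTree = LamTree.app (LamTree.abs b.toLamTree) s.toLamTree ∧
    r.toLamTree = LamTree.subst b.toLamTree s.toLamTree

/-- The strictness rules `t₁ t₂ → ⊥` if `tᵢ = ⊥` and `aᵢ = 0`, and `λx.⊥ → ⊥` if `a₀ = 0`. -/
def strictRed (a : Sig) : RewriteSystem.{u} a := fun V l r =>
  r = GTree.bot ∧
    ((∃ t₁ t₂ : GTree a V, l.toLamTree = LamTree.app t₁.toLamTree t₂.toLamTree ∧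
        ((t₁ = GTree.bot ∧ a 1 = false) ∨ (t₂ = GTree.bot ∧ a 2 = false))) ∨
      (l.toLamTree = LamTree.abs LamTree.bot ∧ a 0 = false))

/-- The system of the `β`-rule and the strictness rules. -/
def betaStrictRed (a : Sig) : RewriteSystem.{u} a := (betaRed a).union (strictRed a)

/-- An `R`-reduction `(t_ι → t_{ι+1} at p_ι)_{ι < len}`. Only `tree ι` for `ι ≤ len` and `pos ι` for
`ι < len` matter; if `len` is a limit ordinal, `tree len` is the candidate for the limit, on which a
reduction as such imposes nothing. -/
structure Reduction {a : Sig} (R : RewriteSystem.{u} a) (V : Type u) where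
  len : Ordinal.{0}
  tree : Ordinal.{0} → GTree a V
  pos : Ordinal.{0} → Pos
  step : ∀ ι < len, Step R (pos ι) (tree ι) (tree (ι + 1))

/-- `c` is the reduction context of a step from `s` to `t` at `p`. -/
def IsContext {a : Sig} {V : Type u} (s t : GTree a V) (p : Pos) (c : GTree a V) : Prop :=
  IsGreatest {c : GTree a V | c ≤ s ∧ c ≤ t ∧ p ∉ c.dom} c

/-- `t` is the limit inferior of `(f ι)_{ι < γ}`, the least upper bound over `β < γ` of the
greatest lower bounds of `(f ι)_{β ≤ ι < γ}`. -/
def IsLiminf {a : Sig} {V : Type u} (γ : Ordinal.{0}) (f : Ordinal.{0} → GTree a V)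
    (t : GTree a V) : Prop :=
  ∃ g : Ordinal.{0} → GTree a V,
    (∀ β < γ, IsGLB (f '' Set.Ico β γ) (g β)) ∧ IsLUB (g '' Set.Iio γ) t

namespace Reduction

variable {a : Sig} {R : RewriteSystem.{u} a} {V : Type u}

/-- The condition of `p`-convergence at `γ`: `tree γ` is the limit inferior of the reduction contexts
of the steps before `γ`. -/
def PLimitAt (S : Reduction R V) (γ : Ordinal.{0}) : Prop :=
  ∃ c : Ordinal.{0} → GTree a V,
    (∀ ι < γ, IsContext (S.tree ι) (S.tree (ι + 1)) (S.pos ι) (c ι)) ∧ IsLiminf γ c (S.tree γ)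

/-- The condition of `m`-convergence at `γ`: the trees before `γ` converge to `tree γ` in the metric,
and the `a`-depth of the contracted positions tends to infinity. -/
def MLimitAt (S : Reduction R V) (γ : Ordinal.{0}) : Prop :=
  (∀ ε : ℝ, 0 < ε → ∃ β < γ, ∀ ι, β ≤ ι → ι < γ → (S.tree ι).mdist (S.tree γ) < ε) ∧
  ∀ d : ℕ, ∃ β < γ, ∀ ι, β ≤ ι → ι < γ → d ≤ depth a (S.pos ι)

/-- `S` `p`-converges (to `S.tree S.len`). -/
def PConvergent (S : Reduction R V) : Prop :=
  ∀ γ ≤ S.len, Order.IsSuccLimit γ → S.PLimitAt γ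

/-- `S` is `p`-continuous. -/
def PContinuous (S : Reduction R V) : Prop :=
  ∀ γ < S.len, Order.IsSuccLimit γ → S.PLimitAt γ

/-- `S` `m`-converges (to `S.tree S.len`). -/
def MConvergent (S : Reduction R V) : Prop :=
  ∀ γ ≤ S.len, Order.IsSuccLimit γ → S.MLimitAt γ

/-- The position `p` is volatile in the open reduction `S`. -/
def Volatile (S : Reduction R V) (p : Pos) : Prop :=
  Order.IsSuccLimit S.len ∧
    ∀ β < S.len, ∃ γ, β ≤ γ ∧ γ < S.len ∧ cut a (S.pos γ) <+: p ∧ p <+: S.pos γ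

/-- `S` is destructive. -/
def Destructive (S : Reduction R V) : Prop := S.PContinuous ∧ S.Volatile []

end Reduction

/-- `s` `p`-converges to `t` by an `R`-reduction. -/
def PConvergesTo {a : Sig} (R : RewriteSystem.{u} a) {V : Type u} (s t : GTree a V) : Prop :=
  ∃ S : Reduction R V, S.tree 0 = s ∧ S.tree S.len = t ∧ S.PConvergent

/-- `s` `m`-converges to `t` by an `R`-reduction. -/
def MConvergesTo {a : Sig} (R : RewriteSystem.{u} a) {V : Type u} (s t : GTree a V) : Prop :=
  ∃ S : Reduction R V, S.tree 0 = s ∧ S.tree S.len = t ∧ S.MConvergent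

/-! Fragile trees and Böhm rewrite systems -/

/-- `t` is fragile: a destructive `β`-reduction starts from `t`. -/
def Fragile {a : Sig} {V : Type u} (t : GTree a V) : Prop :=
  ∃ S : Reduction (betaRed.{u} a) V, S.tree 0 = t ∧ S.Destructive

/-- The set of fragile total trees. -/
def fragileTotal (a : Sig) (V : Type u) : Set (GTree a V) := {t | Fragile t ∧ t.Total}

/-- `s` is a `⊥`-instance of `t` with respect to `U`. -/
def IsBotInstance {a : Sig} (U : ∀ V : Type u, Set (GTree a V)) {V : Type u} (t s : GTree a V) :
    Prop :=
  s.Total ∧ (∀ p ∈ t.dom, s.lab p = t.lab p) ∧ ∀ p, t.BotPos p → s.subtree p ∈ U (V ⊕ Pos)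

/-- The set `U_⊥` of all trees that have a `⊥`-instance with respect to `U` that is in `U`. -/
def botClosure {a : Sig} (U : ∀ V : Type u, Set (GTree a V)) (V : Type u) : Set (GTree a V) :=
  {t | ∃ s ∈ U V, IsBotInstance U t s}

/-- The rules `t → ⊥` for `t ∈ U_⊥ \ {⊥}`. -/
def botRed {a : Sig} (U : ∀ V : Type u, Set (GTree a V)) : RewriteSystem.{u} a := fun V l r =>
  l ∈ botClosure U V \ {GTree.bot} ∧ r = GTree.bot

/-- The Böhm rewrite system with respect to `U`. -/
def bohmRed {a : Sig} (U : ∀ V : Type u, Set (GTree a V)) : RewriteSystem.{u} a :=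
  (betaRed a).union (botRed U)

end LamCalc

/-! ### Positions, domains and guardedness. -/

namespace LamCalc

/-! Positions -/

/-! The starting point is a pointwise description of `p`-convergence. The order on trees forbids
filling a strict hole, so removing `p` from a context forces the removal of everything at or below
`cut a p`. The reduction context of a step at `p` is therefore the tree cut off at `cut a p`, and a
limit inferior has label `l` at `x` exactly if from some index on the label is `l` and no step
satisfies `cut a p <+: x` (`IsPLim`). This makes it possible to pass to subtrees, to truncations and
to selected steps of a reduction. The structure `Lazy` permits idle steps, so that none of these
operations changes the ordinal indices.

A strictness rule is a special rule to `⊥`. Fill all holes of its left-hand side by `Ω`: the copy at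
the strict hole can be contracted forever, which is a destructive reduction of a total tree. So it
is enough to treat `p`-convergent reductions in the Böhm system.

These become `m`-convergent by induction on the length (`Lazy.mRed`). Only a limit `γ` is difficult.
By guardedness, finitely many positions matter below depth `n`, so beyond some index `B n`
everything below depth `n` is settled, except for volatile positions: minimal holes `q` of the limit
at which steps with `cut a p = q` occur cofinally. Erase the subtrees at volatile positions of depth
less than `n`. From `B n` on, all remaining steps have depth at least `n`, so the part from `B n` to
`B (n + 1)` is `m`-convergent by the induction hypothesis. The new volatile subtrees, which have
depth at least `n`, are then erased, and the truncated trees tend to the limit (`MRed.sequence`).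

Each such erasure must be a legal step to `⊥` (`Lazy.subtree_mem_botClosure`). The subtree at a
volatile position performs root-active steps cofinally. Fill its holes by `Ω` and repeat only its
`β`-steps, skipping the erasures; the simulating tree always extends the original one, so all
redexes remain available (`Lazy.simulate`). Root-active `β`-steps are still cofinal, because
root-active erasures alone would keep shrinking the finite strict part of the tree
(`Lazy.exists_betaPos`). With the idle steps removed (`Lazy.exists_reduction`), this is a
destructive `β`-reduction from the filled tree. -/

theorem cut_prefix (a : Sig) (p : Pos) : cut a p <+: p := List.rdropWhile_prefix _ _

@[simp] theorem cut_nil (a : Sig) : cut a [] = [] := rfl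

theorem cut_concat_strict {a : Sig} {i : Fin 3} (h : a i = false) (p : Pos) :
    cut a (p ++ [i]) = cut a p := List.rdropWhile_concat_pos _ _ _ (by simp [h])

theorem cut_concat_nonstrict {a : Sig} {i : Fin 3} (h : a i = true) (p : Pos) :
    cut a (p ++ [i]) = p ++ [i] := List.rdropWhile_concat_neg _ _ _ (by simp [h])

@[simp] theorem cut_cut (a : Sig) (p : Pos) : cut a (cut a p) = cut a p :=
  List.rdropWhile_idempotent _ _

/-- A cut never ends in a strict entry, so it cannot be all of `x ++ [i]`. This is what makes
contexts closed under strict children. -/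
theorem cut_prefix_concat_strict {a : Sig} {i : Fin 3} (h : a i = false) {p x : Pos}
    (hp : cut a p <+: x ++ [i]) : cut a p <+: x := by
  rcases List.prefix_concat_iff.1 hp with e | h'
  · have h1 := cut_cut a p
    rw [e, cut_concat_strict h] at h1
    have := (cut_prefix a x).length_le
    rw [h1] at this
    simp at this
  · exact h'

/-- `cut a p` is itself non-strict, and `cut a x` is the longest non-strict prefix of `x`. -/
theorem cut_prefix_cut {a : Sig} {p x : Pos} (h : cut a p <+: x) : cut a p <+: cut a x := by
  induction x using List.reverseRecOn with
  | nil => simpa using h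
  | append_singleton y i ih =>
    cases hi : a i with
    | false =>
      rw [cut_concat_strict hi]
      exact ih (cut_prefix_concat_strict hi h)
    | true => rwa [cut_concat_nonstrict hi]

theorem cut_append {a : Sig} {q : Pos} (hq : cut a q = q) (r : Pos) :
    cut a (q ++ r) = q ++ cut a r := by
  induction r using List.reverseRecOn with
  | nil => simpa using hq
  | append_singleton y i ih =>
    rw [← List.append_assoc]
    cases hi : a i with
    | false => rw [cut_concat_strict hi, cut_concat_strict hi, ih]
    | true => rw [cut_concat_nonstrict hi, cut_concat_nonstrict hi, List.append_assoc]

theorem depth_append (a : Sig) (p q : Pos) : depth a (p ++ q) = depth a p + depth a q :=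
  List.countP_append

theorem depth_mono (a : Sig) {p q : Pos} (h : p <+: q) : depth a p ≤ depth a q := by
  obtain ⟨r, rfl⟩ := h
  rw [depth_append]
  omega

theorem depth_cut (a : Sig) (p : Pos) : depth a (cut a p) = depth a p := by
  induction p using List.reverseRecOn with
  | nil => rfl
  | append_singleton y i ih =>
    cases hi : a i with
    | false => rw [cut_concat_strict hi, depth_append, ih]; simp [depth, hi]
    | true => rw [cut_concat_nonstrict hi]

theorem prefix_total {p q x : Pos} (hp : p <+: x) (hq : q <+: x) : p <+: q ∨ q <+: p :=
  List.prefix_or_prefix_of_prefix hp hq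

namespace LamTree

variable {V W : Type u}

theorem mem_dom {t : LamTree V} {p : Pos} : p ∈ t.dom ↔ t.lab p ≠ none := Iff.rfl

theorem mem_dom_of_eq_some {t : LamTree V} {p : Pos} {l : Label V} (h : t.lab p = some l) :
    p ∈ t.dom := by simp [mem_dom, h]

theorem exists_lab {t : LamTree V} {p : Pos} (h : p ∈ t.dom) : ∃ l, t.lab p = some l :=
  Option.ne_none_iff_exists'.1 h

theorem mem_dom_of_prefix {t : LamTree V} {p q : Pos} (h : p <+: q) (hq : q ∈ t.dom) :
    p ∈ t.dom := by
  obtain ⟨r, rfl⟩ := h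
  exact t.mem_dom_of_append p r hq

theorem mem_dom_congr {s t : LamTree V} {p : Pos} (h : s.lab p = t.lab p) :
    p ∈ s.dom ↔ p ∈ t.dom := by rw [mem_dom, mem_dom, h]

/-- A position outside the domain extends a least position outside the domain. -/
theorem exists_minimal_not_mem_dom (t : LamTree V) {x : Pos} (hx : x ∉ t.dom) :
    ∃ q, q <+: x ∧ q ∉ t.dom ∧ (q = [] ∨ ∃ y i, q = y ++ [i] ∧ y ∈ t.dom) := by
  induction x using List.reverseRecOn with
  | nil => exact ⟨[], List.nil_prefix, hx, Or.inl rfl⟩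
  | append_singleton y i ih =>
    by_cases hy : y ∈ t.dom
    · exact ⟨y ++ [i], List.prefix_rfl, hx, Or.inr ⟨y, i, rfl, hy⟩⟩
    · obtain ⟨q, hq, h⟩ := ih hy
      exact ⟨q, hq.trans (List.prefix_append _ _), h⟩

theorem BotPos.not_mem {t : LamTree V} {p : Pos} (h : t.BotPos p) : p ∉ t.dom := by
  cases h <;> assumption

/-- The restriction of a tree to the positions satisfying a prefix-closed predicate. -/
noncomputable def restrict (t : LamTree V) (A : Set Pos) (hA : ∀ p q, p <+: q → q ∈ A → p ∈ A) : LamTree V where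
  lab p := open Classical in if p ∈ A then t.lab p else none
  lam_of_zero p h := by
    have h1 : p ++ [0] ∈ A := by by_contra h1; simp [h1] at h
    rw [if_pos h1] at h
    rw [if_pos (hA _ _ (List.prefix_append _ _) h1), t.lam_of_zero p h]
  app_of_one p h := by
    have h1 : p ++ [1] ∈ A := by by_contra h1; simp [h1] at h
    rw [if_pos h1] at h
    rw [if_pos (hA _ _ (List.prefix_append _ _) h1), t.app_of_one p h]
  app_of_two p h := by
    have h1 : p ++ [2] ∈ A := by by_contra h1; simp [h1] at h
    rw [if_pos h1] at h
    rw [if_pos (hA _ _ (List.prefix_append _ _) h1), t.app_of_two p h]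
  binder p q h := by
    have h1 : p ∈ A := by by_contra h1; simp [h1] at h
    rw [if_pos h1] at h
    have := t.binder p q h
    rw [if_pos (hA _ _ this.1 h1)]
    exact this

/-! Guardedness -/

theorem pref_succ (S : ℕ → Fin 3) (n : ℕ) : pref S (n + 1) = pref S n ++ [S n] := by
  simp [pref, List.range_succ]

@[simp] theorem length_pref (S : ℕ → Fin 3) (n : ℕ) : (pref S n).length = n := by simp [pref]

theorem pref_add (S : ℕ → Fin 3) (m n : ℕ) :
    pref S (m + n) = pref S m ++ pref (fun k => S (m + k)) n := by
  induction n with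
  | zero => simp [pref]
  | succ n ih => rw [← add_assoc, pref_succ, ih, pref_succ, List.append_assoc]

theorem pref_prefix (S : ℕ → Fin 3) {m n : ℕ} (h : m ≤ n) : pref S m <+: pref S n := by
  obtain ⟨k, rfl⟩ := Nat.exists_eq_add_of_le h
  rw [pref_add]
  exact List.prefix_append _ _

theorem eq_pref_of_prefix {S : ℕ → Fin 3} {p : Pos} {n : ℕ} (h : p <+: pref S n) :
    p = pref S p.length := by
  have h1 : p.length ≤ n := by simpa using h.length_le
  have h2 := prefix_total h (pref_prefix S h1)
  rcases h2 with h2 | h2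
  · exact h2.eq_of_length (by simp)
  · exact (h2.eq_of_length (by simp)).symm

/-- Dropping a finite initial piece of a branch lowers the depth by a constant, so boundedness can
be refuted on a tail, in any guarded tree that contains it. -/
theorem guarded_of_tails {a : Sig} {t : LamTree V}
    (h : ∀ S, t.IsBranch S → ∃ (n : ℕ) (W : Type u) (s : LamTree W), s.Guarded a ∧
      s.IsBranch fun k => S (n + k)) : t.Guarded a := by
  rintro ⟨S, hS, d, hd⟩
  obtain ⟨n, W, s, hs, hb⟩ := h S hS
  refine hs ⟨_, hb, d, fun k => ?_⟩
  have := hd (n + k)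
  rw [pref_add, depth_append] at this
  omega

theorem Guarded.mono {a : Sig} {t : LamTree V} {s : LamTree W} (hs : s.Guarded a)
    (h : ∀ p ∈ t.dom, p ∈ s.dom) : t.Guarded a :=
  fun ⟨S, hS, hd⟩ => hs ⟨S, fun n => h _ (hS n), hd⟩

theorem mem_dom_subtree {t : LamTree V} {p q : Pos} : q ∈ (t.subtree p).dom ↔ p ++ q ∈ t.dom := by
  simp [subtree, mem_dom]

theorem guarded_of_length {a : Sig} {t : LamTree V} (n : ℕ) (h : ∀ p ∈ t.dom, p.length ≤ n) :
    t.Guarded a := by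
  rintro ⟨S, hS, -⟩
  have := h _ (hS (n + 1))
  simp at this

theorem restrict_lab (t : LamTree V) (A : Set Pos) (hA) (p : Pos) :
    (t.restrict A hA).lab p = open Classical in if p ∈ A then t.lab p else none := rfl

theorem mem_dom_restrict {t : LamTree V} {A : Set Pos} {hA} {p : Pos} :
    p ∈ (t.restrict A hA).dom ↔ p ∈ A ∧ p ∈ t.dom := by
  simp [mem_dom, restrict_lab]

/-- A guarded tree has finitely many positions of bounded depth. -/
theorem finite_depth_lt {a : Sig} {t : LamTree V} (ht : t.Guarded a) (d : ℕ) :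
    {p | p ∈ t.dom ∧ depth a p < d}.Finite := by
  by_contra hinf
  let X : Set Pos := {p | p ∈ t.dom ∧ depth a p < d}
  let Inf : Pos → Prop := fun p => {q | q ∈ X ∧ p <+: q}.Infinite
  -- König's lemma: infinitely many positions below `p` leave infinitely many below one of its three
  -- children. Iterating yields an infinite branch of bounded depth.
  have step : ∀ p, Inf p → ∃ i, Inf (p ++ [i]) := by
    intro p hp
    by_contra hc
    push Not at hc
    have hf : ({p} ∪ ⋃ i : Fin 3, {q | q ∈ X ∧ p ++ [i] <+: q}).Finite :=
      (Set.finite_singleton p).union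
        (Set.finite_iUnion fun i => Set.not_infinite.1 (hc i))
    refine hp (hf.subset ?_)
    rintro q ⟨hq, r, rfl⟩
    rcases r with _ | ⟨i, r⟩
    · simp
    · exact Or.inr (Set.mem_iUnion.2 ⟨i, hq, r, by simp⟩)
  have h0 : Inf [] := by
    intro hf
    exact hinf (hf.subset fun q hq => ⟨hq, List.nil_prefix⟩)
  choose! f hf using step
  let P : ℕ → Pos := fun n => Nat.rec [] (fun _ p => p ++ [f p]) n
  have hP : ∀ n, Inf (P n) := fun n => by
    induction n with
    | zero => exact h0
    | succ n ih => exact hf _ ih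
  have e : ∀ n, pref (fun k => f (P k)) n = P n := fun n => by
    induction n with
    | zero => rfl
    | succ n ih => rw [pref_succ, ih]
  refine ht ⟨fun k => f (P k), fun n => ?_, d, fun n => ?_⟩
  · obtain ⟨q, hq, hp⟩ := (hP n).nonempty
    rw [e]
    exact mem_dom_of_prefix hp hq.1
  · obtain ⟨q, hq, hp⟩ := (hP n).nonempty
    rw [e]
    exact (depth_mono a hp).trans_lt hq.2

end LamTree

/-- The restriction of a guarded tree to a prefix-closed set of positions. -/
noncomputable def GTree.restrict {a : Sig} {V : Type u} (t : GTree a V) (A : Set Pos)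
    (hA : ∀ p q, p <+: q → q ∈ A → p ∈ A) : GTree a V where
  toLamTree := t.toLamTree.restrict A hA
  guarded := t.guarded.mono fun _ h => (LamTree.mem_dom_restrict.1 h).2

theorem GTree.ext_lab {a : Sig} {V : Type u} {s t : GTree a V} (h : ∀ p, s.lab p = t.lab p) :
    s = t := GTree.ext (funext h)

theorem GTree.toLamTree_injective {a : Sig} {V : Type u} {s t : GTree a V}
    (h : s.toLamTree = t.toLamTree) : s = t := by
  cases s; cases t; cases h; rfl

end LamCalc

/-! ### Renaming, extension, decomposition and replacement of trees; contraction of redexes. -/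

namespace LamCalc

/-! Renaming of free variables -/

/-- Renaming of the free variables of a label. -/
def Label.map {V W : Type u} (f : V → W) : Label V → Label W
  | .lam => .lam
  | .app => .app
  | .bvar q => .bvar q
  | .fvar x => .fvar (f x)

/-- Variables bound above `p` become `Sum.inr` variables and the original free ones `Sum.inl`, so
nothing is confused and labels can be read back from a subtree. -/
theorem Label.sub_injective {V : Type u} (p : Pos) :
    Function.Injective (Label.sub (V := V) p) := by
  intro l m h
  cases l with
  | bvar q =>
    cases m with
    | bvar q' =>
      simp only [Label.sub] at h
      split_ifs at h with h1 h2 h2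
      · obtain ⟨r, rfl⟩ := h1
        obtain ⟨r', rfl⟩ := h2
        simpa using h
      · simpa using h
    | _ => simp only [Label.sub] at h; split_ifs at h; try simp at h
  | _ =>
    cases m with
    | bvar q' => simp only [Label.sub] at h; split_ifs at h; try simp at h
    | _ => simp_all [Label.sub]

theorem Label.shift_injective {V : Type u} (p : Pos) :
    Function.Injective (Label.shift (V := V) p) := by
  intro l m h
  cases l <;> cases m <;> simp_all [Label.shift]

theorem Label.abs_injective {V : Type u} : Function.Injective (Label.abs (V := V)) := by
  intro l m h
  rcases l with _ | _ | q | (_ | x) <;> rcases m with _ | _ | q' | (_ | x') <;>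
    simp_all [Label.abs]

/-- The renaming that relates the subtree at `r` of the subtree at `q` to the subtree at `q ++ r`. -/
def subRename {V : Type u} (q : Pos) : V ⊕ Pos → (V ⊕ Pos) ⊕ Pos
  | .inl x => .inl (.inl x)
  | .inr z => if q <+: z then .inr (z.drop q.length) else .inl (.inr z)

theorem Label.sub_sub {V : Type u} (q r : Pos) (l : Label V) :
    Label.sub r (Label.sub q l) = Label.map (subRename q) (Label.sub (q ++ r) l) := by
  cases l with
  | bvar z =>
    by_cases hq : q <+: z
    · obtain ⟨y, rfl⟩ := hq
      by_cases hr : r <+: y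
      · obtain ⟨w, rfl⟩ := hr
        have : q ++ r <+: q ++ (r ++ w) := ⟨w, by simp⟩
        simp only [Label.sub, List.prefix_append, if_true, List.drop_left, this, Label.map]
        simp [List.drop_append]
      · simp [Label.sub, hr, Label.map, subRename, List.prefix_append_right_inj]
    · have : ¬ q ++ r <+: z := fun h => hq ((List.prefix_append _ _).trans h)
      simp [Label.sub, hq, this, Label.map, subRename]
  | _ => rfl

namespace LamTree

variable {V W : Type u}

/-- Renaming of the free variables of a tree. -/
def map (f : V → W) (t : LamTree V) : LamTree W where
  lab p := (t.lab p).map (Label.map f)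
  lam_of_zero p h := by simp [t.lam_of_zero p (by simpa using h), Label.map]
  app_of_one p h := by simp [t.app_of_one p (by simpa using h), Label.map]
  app_of_two p h := by simp [t.app_of_two p (by simpa using h), Label.map]
  binder p q h := by
    rw [Option.map_eq_some_iff] at h
    obtain ⟨l, hl, h⟩ := h
    match l, hl, h with
    | .bvar q', hl, h =>
      simp only [Label.map, Label.bvar.injEq] at h
      subst h
      have := t.binder p q' hl
      simp [this, Label.map]

theorem ext_lab {s t : LamTree V} (h : ∀ p, s.lab p = t.lab p) : s = t :=
  LamTree.ext (funext h)

theorem map_lab (f : V → W) (t : LamTree V) (p : Pos) :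
    (t.map f).lab p = (t.lab p).map (Label.map f) := rfl

theorem mem_dom_map {f : V → W} {t : LamTree V} {p : Pos} : p ∈ (t.map f).dom ↔ p ∈ t.dom := by
  simp [mem_dom, map_lab]

theorem subtree_lab (t : LamTree V) (p r : Pos) :
    (t.subtree p).lab r = (t.lab (p ++ r)).map (Label.sub p) := rfl

/-- Since each passage to a subtree introduces its own free variables, iterated subtrees agree with
direct ones only up to renaming. Hence rewrite systems have to be stable under renaming for steps to
restrict to subtrees. -/
theorem subtree_subtree (t : LamTree V) (q r : Pos) :
    (t.subtree q).subtree r = (t.subtree (q ++ r)).map (subRename q) := by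
  apply ext_lab
  intro p
  simp only [subtree_lab, map_lab, Option.map_map, List.append_assoc]
  congr 1
  exact funext fun l => Label.sub_sub q r l

@[simp] theorem app_lab_nil (s t : LamTree V) : (app s t).lab [] = some .app := rfl
@[simp] theorem app_lab_zero (s t : LamTree V) (p : Pos) : (app s t).lab (0 :: p) = none := rfl
@[simp] theorem app_lab_one (s t : LamTree V) (p : Pos) :
    (app s t).lab (1 :: p) = (s.lab p).map (Label.shift [1]) := rfl
@[simp] theorem app_lab_two (s t : LamTree V) (p : Pos) :
    (app s t).lab (2 :: p) = (t.lab p).map (Label.shift [2]) := rfl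
@[simp] theorem abs_lab_nil (b : LamTree (Option V)) : (abs b).lab [] = some .lam := rfl
@[simp] theorem abs_lab_zero (b : LamTree (Option V)) (p : Pos) :
    (abs b).lab (0 :: p) = (b.lab p).map Label.abs := rfl
@[simp] theorem abs_lab_one (b : LamTree (Option V)) (p : Pos) : (abs b).lab (1 :: p) = none := rfl
@[simp] theorem abs_lab_two (b : LamTree (Option V)) (p : Pos) : (abs b).lab (2 :: p) = none := rfl

theorem map_app (f : V → W) (s t : LamTree V) : (app s t).map f = app (s.map f) (t.map f) := by
  apply ext_lab
  rintro (_ | ⟨i, p⟩)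
  · rfl
  · have h : ∀ k : Pos, Label.map f ∘ Label.shift k = Label.shift k ∘ Label.map f := fun k =>
      funext fun l => by cases l <;> rfl
    match i with
    | 0 => rfl
    | 1 => simp [map_lab, h]
    | 2 => simp [map_lab, h]

theorem map_abs (f : V → W) (b : LamTree (Option V)) :
    (abs b).map f = abs (b.map (Option.map f)) := by
  apply ext_lab
  rintro (_ | ⟨i, p⟩)
  · rfl
  · have h : Label.map f ∘ Label.abs = Label.abs ∘ Label.map (Option.map f) :=
      funext fun l => by rcases l with _ | _ | q | (_ | x) <;> rfl
    match i with
    | 0 => simp [map_lab, h]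
    | 1 => rfl
    | 2 => rfl

theorem map_subst (f : V → W) (b : LamTree (Option V)) (s : LamTree V) :
    (subst b s).map f = subst (b.map (Option.map f)) (s.map f) := by
  have key : ∀ p, (b.map (Option.map f)).lab p = some (.fvar none) ↔
      b.lab p = some (.fvar none) := by
    intro p
    rw [map_lab]
    rcases b.lab p with _ | _ | _ | q | (_ | x) <;> simp [Label.map]
  apply ext_lab
  intro p
  change (substLab b s p).map _ = substLab _ _ p
  rcases b.hit_cases p with ⟨p₁, p₂, rfl, h1⟩ | hm
  · rw [substLab_hit b s p₁ p₂ h1, substLab_hit _ _ p₁ p₂ ((key p₁).2 h1), map_lab]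
    simp only [Option.map_map]
    congr 1
    exact funext fun l => by cases l <;> rfl
  · rw [substLab_miss b s p hm, substLab_miss _ _ p fun n hn => hm n ⟨hn.1, (key _).1 hn.2⟩,
      map_lab]
    rcases b.lab p with _ | _ | _ | q | (_ | x) <;> rfl

/-! Extension of trees as partial functions -/

/-- `t` extends `s` as a partial function. -/
def Extends (s t : LamTree V) : Prop := ∀ p l, s.lab p = some l → t.lab p = some l

theorem Extends.mem {s t : LamTree V} (h : s.Extends t) {p : Pos} (hp : p ∈ s.dom) : p ∈ t.dom := by
  obtain ⟨l, hl⟩ := exists_lab hp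
  exact mem_dom_of_eq_some (h p l hl)

/-- An occurrence of `none` in `b` is also one in `b'`. Where `b` has another label, `b'` has the
same one, so no occurrence of `none` lies above in `b'` either. -/
theorem Extends.subst {b b' : LamTree (Option V)} {s s' : LamTree V} (hb : b.Extends b')
    (hs : s.Extends s') : (subst b s).Extends (subst b' s') := by
  intro p l h
  change substLab b s p = _ at h
  change substLab b' s' p = _
  rcases b.hit_cases p with ⟨p₁, p₂, rfl, h1⟩ | hm
  · rw [substLab_hit b s p₁ p₂ h1, Option.map_eq_some_iff] at h
    obtain ⟨m, hm, rfl⟩ := h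
    rw [substLab_hit b' s' p₁ p₂ (hb _ _ h1), hs _ _ hm]
    rfl
  · rw [substLab_miss b s p hm, Option.bind_eq_some_iff] at h
    obtain ⟨m, hm', h⟩ := h
    have h2 := hb _ _ hm'
    rw [substLab_miss b' s' p (b'.not_hit_of_mem_dom p m h2 _), h2]
    · exact h
    · rintro rfl
      simp [Label.keep] at h

theorem Extends.of_subtree {s t : LamTree V} {p : Pos} (h : (s.subtree p).Extends (t.subtree p))
    {r : Pos} {l : Label V} (hl : s.lab (p ++ r) = some l) : t.lab (p ++ r) = some l := by
  have := h r (Label.sub p l) (by rw [subtree_lab, hl]; rfl)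
  rw [subtree_lab, Option.map_eq_some_iff] at this
  obtain ⟨m, hm, e⟩ := this
  rw [hm, Label.sub_injective p e]

theorem Extends.subtree {s t : LamTree V} (h : s.Extends t) (p : Pos) :
    (s.subtree p).Extends (t.subtree p) := by
  intro r l hl
  rw [subtree_lab, Option.map_eq_some_iff] at hl
  obtain ⟨m, hm, rfl⟩ := hl
  rw [subtree_lab, h _ _ hm]
  rfl

theorem Extends.of_app {s t s' t' : LamTree V} (h : (app s t).Extends (app s' t')) :
    s.Extends s' ∧ t.Extends t' := by
  constructor
  · intro p l hl
    have := h (1 :: p) (Label.shift [1] l) (by simp [hl])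
    simp only [app_lab_one, Option.map_eq_some_iff] at this
    obtain ⟨m, hm, e⟩ := this
    rw [hm, Label.shift_injective _ e]
  · intro p l hl
    have := h (2 :: p) (Label.shift [2] l) (by simp [hl])
    simp only [app_lab_two, Option.map_eq_some_iff] at this
    obtain ⟨m, hm, e⟩ := this
    rw [hm, Label.shift_injective _ e]

theorem Extends.of_abs {b b' : LamTree (Option V)} (h : (abs b).Extends (abs b')) :
    b.Extends b' := by
  intro p l hl
  have := h (0 :: p) (Label.abs l) (by simp [hl])
  simp only [abs_lab_zero, Option.map_eq_some_iff] at this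
  obtain ⟨m, hm, e⟩ := this
  rw [hm, Label.abs_injective e]

/-! Decomposition of trees -/

/-- Moving a label of a direct subtree of an application to that subtree. -/
def _root_.LamCalc.Label.unshift : Label V → Label V
  | .lam => .lam
  | .app => .app
  | .bvar q => .bvar q.tail
  | .fvar x => .fvar x

/-- The root is not an abstraction, so every binder used inside a direct subtree lies in that same
subtree. -/
theorem exists_eq_app {t : LamTree V} (h : t.lab [] = some .app) :
    ∃ t₁ t₂ : LamTree V, t = app t₁ t₂ := by
  have hb : ∀ {i p q}, t.lab (i :: p) = some (.bvar q) → ∃ q', q = i :: q' := by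
    intro i p q hq
    have := t.binder _ _ hq
    rcases q with _ | ⟨j, q⟩
    · rw [h] at this; simp at this
    · exact ⟨q, by rw [(List.cons_prefix_cons.1 this.1).1]⟩
  let part : Fin 3 → LamTree V := fun i =>
    { lab := fun p => (t.lab (i :: p)).map Label.unshift
      lam_of_zero := fun p hp => by
        simp [t.lam_of_zero (i :: p) (by simpa using hp), Label.unshift]
      app_of_one := fun p hp => by
        simp [t.app_of_one (i :: p) (by simpa using hp), Label.unshift]
      app_of_two := fun p hp => by
        simp [t.app_of_two (i :: p) (by simpa using hp), Label.unshift]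
      binder := fun p q hp => by
        rw [Option.map_eq_some_iff] at hp
        obtain ⟨l, hl, e⟩ := hp
        match l, hl, e with
        | .bvar z, hl, e =>
          obtain ⟨q', rfl⟩ := hb hl
          simp only [Label.unshift, List.tail_cons, Label.bvar.injEq] at e
          subst e
          have := t.binder _ _ hl
          simp [this.2, List.cons_prefix_cons.1 this.1, Label.unshift] }
  have hp : ∀ i p, t.lab (i :: p) = ((part i).lab p).map (Label.shift [i]) := by
    intro i p
    change _ = ((t.lab (i :: p)).map Label.unshift).map _
    rcases hl : t.lab (i :: p) with _ | l
    · rfl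
    · rcases l with _ | _ | q | x
      · rfl
      · rfl
      · obtain ⟨q', rfl⟩ := hb hl
        rfl
      · rfl
  refine ⟨part 1, part 2, ext_lab ?_⟩
  rintro (_ | ⟨i, p⟩)
  · exact h
  · match i with
    | 0 =>
      rw [app_lab_zero]
      by_contra h0
      have := t.mem_dom_of_append [0] p h0
      have := t.lam_of_zero [] this
      simp [h] at this
    | 1 => rw [app_lab_one, hp]
    | 2 => rw [app_lab_two, hp]

/-- Moving a label of the body of an abstraction to that body. -/
def _root_.LamCalc.Label.unabs : Label V → Label (Option V)
  | .lam => .lam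
  | .app => .app
  | .bvar [] => .fvar none
  | .bvar (_ :: q) => .bvar q
  | .fvar x => .fvar (some x)

/-- The only binder outside the body is the root; the variables bound there turn into `none`. -/
theorem exists_eq_abs {t : LamTree V} (h : t.lab [] = some .lam) :
    ∃ b : LamTree (Option V), t = abs b := by
  have hb : ∀ {p q}, t.lab (0 :: p) = some (.bvar q) → q = [] ∨ ∃ q', q = 0 :: q' := by
    intro p q hq
    have := t.binder _ _ hq
    rcases q with _ | ⟨j, q⟩
    · exact Or.inl rfl
    · exact Or.inr ⟨q, by rw [(List.cons_prefix_cons.1 this.1).1]⟩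
  let b : LamTree (Option V) :=
    { lab := fun p => (t.lab (0 :: p)).map Label.unabs
      lam_of_zero := fun p hp => by
        simp [t.lam_of_zero (0 :: p) (by simpa using hp), Label.unabs]
      app_of_one := fun p hp => by
        simp [t.app_of_one (0 :: p) (by simpa using hp), Label.unabs]
      app_of_two := fun p hp => by
        simp [t.app_of_two (0 :: p) (by simpa using hp), Label.unabs]
      binder := fun p q hp => by
        rw [Option.map_eq_some_iff] at hp
        obtain ⟨l, hl, e⟩ := hp
        match l, hl, e with
        | .bvar z, hl, e =>
          rcases hb hl with rfl | ⟨q', rfl⟩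
          · simp [Label.unabs] at e
          · simp only [Label.unabs, Label.bvar.injEq] at e
            subst e
            have := t.binder _ _ hl
            simp [this.2, List.cons_prefix_cons.1 this.1, Label.unabs] }
  refine ⟨b, ext_lab ?_⟩
  rintro (_ | ⟨i, p⟩)
  · exact h
  · match i with
    | 0 =>
      change _ = ((t.lab (0 :: p)).map Label.unabs).map _
      rcases hl : t.lab (0 :: p) with _ | l
      · rfl
      · rcases l with _ | _ | q | x
        · rfl
        · rfl
        · rcases hb hl with rfl | ⟨q', rfl⟩ <;> rfl
        · rfl
    | 1 =>
      rw [abs_lab_one]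
      by_contra h0
      have := t.app_of_one [] (t.mem_dom_of_append [1] p h0)
      simp [h] at this
    | 2 =>
      rw [abs_lab_two]
      by_contra h0
      have := t.app_of_two [] (t.mem_dom_of_append [2] p h0)
      simp [h] at this

/-! Guardedness of the constructions -/

/-- A branch of the substitution either runs through an occurrence of the variable, and then its
tail is a branch of `s`, or avoids all occurrences and is a branch of `b`. -/
theorem subst_guarded {a : Sig} {b : LamTree (Option V)} {s : LamTree V} (hb : b.Guarded a)
    (hs : s.Guarded a) : (subst b s).Guarded a := by
  apply guarded_of_tails
  intro S hS
  by_cases h : ∃ n, b.lab (pref S n) = some (.fvar none)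
  · obtain ⟨n, hn⟩ := h
    refine ⟨n, _, s, hs, fun k => ?_⟩
    have h1 : substLab b s (pref S (n + k)) ≠ none := hS (n + k)
    rw [pref_add, substLab_hit b s _ _ hn] at h1
    simpa [mem_dom] using h1
  · refine ⟨0, _, b, hb, fun k => ?_⟩
    simp only [Nat.zero_add]
    have h1 : substLab b s (pref S k) ≠ none := hS k
    rw [substLab_miss] at h1
    · intro h0
      simp [h0] at h1
    · rintro n ⟨-, hn⟩
      exact h ⟨_, (eq_pref_of_prefix (List.take_prefix n (pref S k))) ▸ hn⟩

theorem guarded_of_redex {a : Sig} {b : LamTree (Option V)} {s : LamTree V}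
    (h : (app (abs b) s).Guarded a) : b.Guarded a ∧ s.Guarded a := by
  constructor
  · refine (subtree_guarded a _ [1, 0] h).mono fun p hp => ?_
    rw [mem_dom_subtree]
    simpa [mem_dom] using hp
  · refine (subtree_guarded a _ [2] h).mono fun p hp => ?_
    rw [mem_dom_subtree]
    simpa [mem_dom] using hp

/-! Replacement of a subtree -/

/-- Moving a label of the subtree at `p` back to the whole tree. -/
def _root_.LamCalc.Label.unsub (p : Pos) : Label (V ⊕ Pos) → Label V
  | .lam => .lam
  | .app => .app
  | .bvar q => .bvar (p ++ q)
  | .fvar (.inl x) => .fvar x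
  | .fvar (.inr z) => .bvar z

open Classical in
/-- The replacement of the subtree of `t` at `p` by `r`. -/
noncomputable def replace (t : LamTree V) (p : Pos) (r : LamTree (V ⊕ Pos)) (hp : p ∈ t.dom)
    (hr : ∀ y z, r.lab y = some (.fvar (.inr z)) →
      z <+: p ∧ z ≠ p ∧ t.lab z = some .lam) : LamTree V :=
  have child : ∀ (i : Fin 3) (l : ∀ {W : Type u}, Label W),
      (∀ q, t.lab (q ++ [i]) ≠ none → t.lab q = some l) →
      (∀ q, r.lab (q ++ [i]) ≠ none → r.lab q = some l) →
      Label.unsub p (l (W := V ⊕ Pos)) = l → ∀ q,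
      (if p <+: q ++ [i] then (r.lab ((q ++ [i]).drop p.length)).map (Label.unsub p)
        else t.lab (q ++ [i])) ≠ none →
      (if p <+: q then (r.lab (q.drop p.length)).map (Label.unsub p) else t.lab q) = some l := by
    intro i l ht hr' hl q h
    by_cases h1 : p <+: q
    · obtain ⟨y, rfl⟩ := h1
      have h2 : p <+: p ++ y ++ [i] := ⟨y ++ [i], by simp⟩
      rw [if_pos h2, List.append_assoc, List.drop_left] at h
      rw [if_pos (List.prefix_append _ _), List.drop_left, hr' y (by simpa using h)]
      simp [hl]
    · rw [if_neg h1]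
      apply ht
      split_ifs at h with h2
      · rcases List.prefix_concat_iff.1 h2 with e | h2
        · rw [← e]; exact hp
        · exact absurd h2 h1
      · exact h
  { lab := fun q => if p <+: q then (r.lab (q.drop p.length)).map (Label.unsub p) else t.lab q
    lam_of_zero := child 0 .lam t.lam_of_zero r.lam_of_zero rfl
    app_of_one := child 1 .app t.app_of_one r.app_of_one rfl
    app_of_two := child 2 .app t.app_of_two r.app_of_two rfl
    binder := fun q z h => by
      split_ifs at h with h1
      · obtain ⟨y, rfl⟩ := h1
        rw [List.drop_left, Option.map_eq_some_iff] at h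
        obtain ⟨l, hl, h⟩ := h
        match l, hl, h with
        | .bvar w, hl, h =>
          simp only [Label.unsub, Label.bvar.injEq] at h
          subst h
          have := r.binder _ _ hl
          refine ⟨(List.prefix_append_right_inj p).2 this.1, ?_⟩
          simp [this.2, Label.unsub]
        | .fvar (.inr w), hl, h =>
          simp only [Label.unsub, Label.bvar.injEq] at h
          subst h
          obtain ⟨h2, h3, h4⟩ := hr _ _ hl
          refine ⟨h2.trans (List.prefix_append _ _), ?_⟩
          rw [if_neg, h4]
          intro h5
          exact h3 (h2.eq_of_length (le_antisymm h2.length_le h5.length_le))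
        | .fvar (.inl w), hl, h => simp [Label.unsub] at h
      · have := t.binder _ _ h
        refine ⟨this.1, ?_⟩
        rw [if_neg fun h2 => h1 (h2.trans this.1)]
        exact this.2 }

theorem replace_lab_below (t : LamTree V) (p : Pos) (r : LamTree (V ⊕ Pos)) (hp) (hr) (y : Pos) :
    (t.replace p r hp hr).lab (p ++ y) = (r.lab y).map (Label.unsub p) := by
  simp [replace]

theorem replace_lab_other (t : LamTree V) (p : Pos) (r : LamTree (V ⊕ Pos)) (hp) (hr) {q : Pos}
    (h : ¬ p <+: q) : (t.replace p r hp hr).lab q = t.lab q := by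
  simp [replace, h]

theorem subtree_replace (t : LamTree V) (p : Pos) (r : LamTree (V ⊕ Pos)) (hp) (hr) :
    (t.replace p r hp hr).subtree p = r := by
  apply ext_lab
  intro y
  rw [subtree_lab, replace_lab_below, Option.map_map]
  rcases hl : r.lab y with _ | l
  · rfl
  · rcases l with _ | _ | q | (x | z)
    · rfl
    · rfl
    · simp [Label.unsub, Label.sub]
    · rfl
    · obtain ⟨h2, h3, -⟩ := hr _ _ hl
      have : ¬ p <+: z := fun h5 => h3 (h2.eq_of_length (le_antisymm h2.length_le h5.length_le))
      simp [Label.unsub, Label.sub, this]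

theorem replace_guarded {a : Sig} (t : LamTree V) (p : Pos) (r : LamTree (V ⊕ Pos)) (hp) (hr)
    (h1 : t.Guarded a) (h2 : r.Guarded a) : (t.replace p r hp hr).Guarded a := by
  apply guarded_of_tails
  intro S hS
  by_cases h : ∃ n, p <+: pref S n
  · obtain ⟨n, hn⟩ := h
    refine ⟨p.length, _, r, h2, fun k => ?_⟩
    have := hS (p.length + k)
    rw [pref_add, ← eq_pref_of_prefix hn, mem_dom, replace_lab_below] at this
    simpa [mem_dom] using this
  · push Not at h
    refine ⟨0, _, t, h1, fun k => ?_⟩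
    have := hS k
    rw [mem_dom, replace_lab_other _ _ _ _ _ (h k)] at this
    simpa [mem_dom] using this

/-- A free variable of `subst b s` is one of `b` or `s`. -/
theorem fvar_of_subst {b : LamTree (Option V)} {s : LamTree V} {p : Pos} {x : V}
    (h : (subst b s).lab p = some (.fvar x)) :
    (∃ q, b.lab q = some (.fvar (some x))) ∨ ∃ q, s.lab q = some (.fvar x) := by
  change substLab b s p = _ at h
  rcases b.hit_cases p with ⟨p₁, p₂, rfl, h1⟩ | hm
  · rw [substLab_hit b s p₁ p₂ h1, Option.map_eq_some_iff] at h
    obtain ⟨l, hl, e⟩ := h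
    right
    refine ⟨p₂, ?_⟩
    rw [hl]
    cases l <;> simp_all [Label.shift]
  · rw [substLab_miss b s p hm, Option.bind_eq_some_iff] at h
    obtain ⟨l, hl, e⟩ := h
    left
    refine ⟨p, ?_⟩
    rw [hl]
    rcases l with _ | _ | q | (_ | y) <;> simp_all [Label.keep]

end LamTree

open LamTree

variable {a : Sig} {V W : Type u}

/-- Renaming of the free variables of a guarded tree. -/
def GTree.map (f : V → W) (t : GTree a V) : GTree a W where
  toLamTree := t.toLamTree.map f
  guarded := t.guarded.mono fun _ h => mem_dom_map.1 h

theorem betaRed_map (f : V → W) {l r : GTree a V} (h : betaRed a V l r) :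
    betaRed a W (l.map f) (r.map f) := by
  obtain ⟨b, s, h1, h2⟩ := h
  refine ⟨b.map (Option.map f), s.map f, ?_, ?_⟩
  · change l.toLamTree.map f = _
    rw [h1, map_app, map_abs]
    rfl
  · change r.toLamTree.map f = _
    rw [h2, map_subst]
    rfl

theorem GTree.subtree_subtree (t : GTree a V) (q r : Pos) :
    (t.subtree q).subtree r = (t.subtree (q ++ r)).map (subRename q) :=
  GTree.toLamTree_injective (LamTree.subtree_subtree _ q r)

theorem GTree.subtree_toLamTree (t : GTree a V) (q : Pos) :
    (t.subtree q).toLamTree = t.toLamTree.subtree q := rfl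

/-- The position of a `β`-step and the positions of its abstraction carry the expected labels. -/
theorem step_betaRed_lab {p : Pos} {s t : GTree a V} (h : Step (betaRed a) p s t) :
    s.lab p = some .app ∧ s.lab (p ++ [1]) = some .lam := by
  obtain ⟨⟨b, u, h1, -⟩, -⟩ := h
  have e : ∀ y (l : ∀ {W : Type u}, Label W),
      (∀ m : Label V, Label.sub p m = l → m = l) →
      (app (abs b.toLamTree) u.toLamTree).lab y = some l → s.lab (p ++ y) = some l := by
    intro y l hl hy
    rw [← h1, GTree.subtree_toLamTree, subtree_lab, Option.map_eq_some_iff] at hy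
    obtain ⟨m, hm, e⟩ := hy
    rw [hm, hl m e]
  have h2 := e [] .app (fun m hm => Label.sub_injective p (hm.trans rfl)) rfl
  have h3 := e [1] .lam (fun m hm => Label.sub_injective p (hm.trans rfl)) rfl
  rw [List.append_nil] at h2
  exact ⟨h2, h3⟩

/-- Every `β`-redex can be contracted. -/
theorem exists_step_betaRed {p : Pos} {w : GTree a V} (h1 : w.lab p = some .app)
    (h2 : w.lab (p ++ [1]) = some .lam) : ∃ w', Step (betaRed a) p w w' := by
  obtain ⟨t₁, s, e⟩ := exists_eq_app (t := w.toLamTree.subtree p)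
    (by rw [subtree_lab, List.append_nil, h1]; rfl)
  have h3 : t₁.lab [] = some .lam := by
    have : (w.toLamTree.subtree p).lab [1] = some .lam := by rw [subtree_lab, h2]; rfl
    rw [e, app_lab_one, Option.map_eq_some_iff] at this
    obtain ⟨l, hl, h⟩ := this
    rw [hl]
    cases l <;> simp_all [Label.shift]
  obtain ⟨b, rfl⟩ := exists_eq_abs h3
  have hg := w.toLamTree.subtree_guarded a p w.guarded
  rw [e] at hg
  obtain ⟨hb, hs⟩ := guarded_of_redex hg
  -- A variable `.inr z` of the subtree stands for a variable whose binder `z` is strictly above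
  -- `p`.
  have hfv : ∀ y z, (w.toLamTree.subtree p).lab y = some (.fvar (.inr z)) →
      z <+: p ∧ z ≠ p ∧ w.lab z = some .lam := by
    intro y z hy
    rw [subtree_lab, Option.map_eq_some_iff] at hy
    obtain ⟨l, hl, h⟩ := hy
    rcases l with _ | _ | q | x
    · simp [Label.sub] at h
    · simp [Label.sub] at h
    · simp only [Label.sub] at h
      split_ifs at h with hq
      obtain rfl : q = z := by simpa using h
      have := w.binder _ _ hl
      have hqp := (prefix_total this.1 (List.prefix_append p y)).resolve_right hq
      refine ⟨hqp, ?_, this.2⟩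
      rintro rfl
      exact hq hqp
    · simp [Label.sub] at h
  -- Contraction creates no free variables, so the contractum can be put back at `p` with the
  -- binders of the redex.
  have hr : ∀ y z, (subst b s).lab y = some (.fvar (.inr z)) →
      z <+: p ∧ z ≠ p ∧ w.lab z = some .lam := by
    intro y z hy
    rcases fvar_of_subst hy with ⟨q, hq⟩ | ⟨q, hq⟩
    · apply hfv (1 :: 0 :: q)
      rw [e]
      simp [hq, Label.abs, Label.shift]
    · apply hfv (2 :: q)
      rw [e]
      simp [hq, Label.shift]
  have hp : p ∈ w.dom := mem_dom_of_eq_some h1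
  refine ⟨⟨w.toLamTree.replace p (subst b s) hp hr,
    replace_guarded _ _ _ _ _ w.guarded (subst_guarded hb hs)⟩, ⟨⟨b, hb⟩, ⟨s, hs⟩, e, ?_⟩, ?_⟩
  · exact subtree_replace _ _ _ hp hr
  · intro q hq
    exact (replace_lab_other _ _ _ hp hr hq).symm

/-- `β`-contraction at a fixed position is monotone with respect to extension. -/
theorem Step.extends {p : Pos} {u u' w w' : GTree a V} (hu : Step (betaRed a) p u u')
    (hw : Step (betaRed a) p w w') (h : u.toLamTree.Extends w.toLamTree) :
    u'.toLamTree.Extends w'.toLamTree := by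
  obtain ⟨⟨b, s, h1, h2⟩, h3⟩ := hu
  obtain ⟨⟨b', s', h1', h2'⟩, h3'⟩ := hw
  intro q l hl
  by_cases hq : p <+: q
  · obtain ⟨y, rfl⟩ := hq
    refine Extends.of_subtree ?_ hl
    have h4 := h.subtree p
    rw [← GTree.subtree_toLamTree, ← GTree.subtree_toLamTree, h1, h1'] at h4
    rw [← GTree.subtree_toLamTree, ← GTree.subtree_toLamTree, h2, h2']
    exact h4.of_app.1.of_abs.subst h4.of_app.2
  · rw [← h3 q hq] at hl
    rw [← h3' q hq]
    exact h q l hl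

end LamCalc

/-! ### The looping tree `Ω`, totality, and filling the holes of a tree by `Ω`. -/

namespace LamCalc
namespace LamTree

variable {V W : Type u}

/-! The tree `Ω = (λx. x x) (λx. x x)` -/

/-- The tree that consists of a single variable. -/
def var (x : V) : LamTree V where
  lab p := if p = [] then some (.fvar x) else none
  lam_of_zero := by simp
  app_of_one := by simp
  app_of_two := by simp
  binder p q h := by split_ifs at h; simp at h

theorem map_var (f : V → W) (x : V) : (var x).map f = var (f x) := by
  apply ext_lab
  intro p
  by_cases hp : p = [] <;> simp [map_lab, var, hp, Label.map]

/-- The body `x x` of the self-application. -/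
def selfBody (V : Type u) : LamTree (Option V) := app (var none) (var none)

/-- The tree `Ω`. -/
def omega (V : Type u) : LamTree V := app (abs (selfBody V)) (abs (selfBody V))

theorem map_selfBody (f : V → W) : (selfBody V).map (Option.map f) = selfBody W := by
  simp [selfBody, map_app, map_var]

theorem map_omega (f : V → W) : (omega V).map f = omega W := by
  simp [omega, map_app, map_abs, map_selfBody]

/-- With `s` the self-application this is the contraction of `Ω` to itself. -/
theorem subst_selfBody (s : LamTree V) : subst (selfBody V) s = app s s := by
  apply ext_lab
  intro p
  change substLab _ s p = _
  have miss : ∀ p : Pos, (∀ n, (selfBody V).lab (p.take n) ≠ some (.fvar none)) →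
      ∀ n, ¬ (selfBody V).HitAt p n := fun p h n hn => h n hn.2
  match p with
  | [] =>
    rw [substLab_miss _ _ _ (miss _ (by simp [selfBody]))]
    rfl
  | 0 :: p =>
    rw [substLab_miss _ _ _ (miss _ (by rintro (_ | n) <;> simp [selfBody]))]
    rfl
  | 1 :: p => exact substLab_hit _ s [1] p rfl
  | 2 :: p => exact substLab_hit _ s [2] p rfl

theorem length_le_of_mem_selfBody {p : Pos} (h : p ∈ (selfBody V).dom) : p.length ≤ 1 := by
  match p with
  | [] => simp
  | 0 :: p => simp [mem_dom, selfBody] at h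
  | 1 :: p => simp [mem_dom, selfBody, var] at h; simp [h]
  | 2 :: p => simp [mem_dom, selfBody, var] at h; simp [h]

theorem length_le_of_mem_abs_selfBody {p : Pos} (h : p ∈ (abs (selfBody V)).dom) :
    p.length ≤ 2 := by
  match p with
  | [] => simp
  | 0 :: p =>
    have := length_le_of_mem_selfBody (V := V) (p := p) (by simpa [mem_dom] using h)
    simpa using this
  | 1 :: p => simp [mem_dom] at h
  | 2 :: p => simp [mem_dom] at h

theorem length_le_of_mem_omega {p : Pos} (h : p ∈ (omega V).dom) : p.length ≤ 3 := by
  match p with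
  | [] => simp
  | 0 :: p => simp [mem_dom, omega] at h
  | 1 :: p =>
    have := length_le_of_mem_abs_selfBody (V := V) (p := p) (by simpa [mem_dom, omega] using h)
    simp only [List.length_cons]
    omega
  | 2 :: p =>
    have := length_le_of_mem_abs_selfBody (V := V) (p := p) (by simpa [mem_dom, omega] using h)
    simp only [List.length_cons]
    omega

/-! Totality -/

theorem total_iff {t : LamTree V} : t.Total ↔ [] ∈ t.dom ∧
    (∀ p, t.lab p = some .lam → p ++ [0] ∈ t.dom) ∧
    ∀ p, t.lab p = some .app → p ++ [1] ∈ t.dom ∧ p ++ [2] ∈ t.dom := by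
  constructor
  · intro h
    refine ⟨by_contra fun h' => h _ (.root h'), fun p hp => by_contra fun h' => h _ (.body p hp h'),
      fun p hp => ⟨by_contra fun h' => h _ (.left p hp h'),
        by_contra fun h' => h _ (.right p hp h')⟩⟩
  · rintro ⟨h1, h2, h3⟩ p hp
    cases hp with
    | root h => exact h h1
    | body p hp h => exact h (h2 p hp)
    | left p hp h => exact h (h3 p hp).1
    | right p hp h => exact h (h3 p hp).2

theorem Total.app {s t : LamTree V} (hs : s.Total) (ht : t.Total) : (app s t).Total := by
  rw [total_iff] at *
  refine ⟨by simp [mem_dom], fun p hp => ?_, fun p hp => ?_⟩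
  · match p with
    | [] => simp at hp
    | 0 :: p => simp at hp
    | 1 :: p =>
      obtain ⟨l, hl, e⟩ := Option.map_eq_some_iff.1 hp
      have := hs.2.1 p (by rw [hl]; cases l <;> simp_all [Label.shift])
      simpa [mem_dom] using this
    | 2 :: p =>
      obtain ⟨l, hl, e⟩ := Option.map_eq_some_iff.1 hp
      have := ht.2.1 p (by rw [hl]; cases l <;> simp_all [Label.shift])
      simpa [mem_dom] using this
  · match p with
    | [] => simp [mem_dom, mem_dom.1 hs.1, mem_dom.1 ht.1]
    | 0 :: p => simp at hp
    | 1 :: p =>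
      obtain ⟨l, hl, e⟩ := Option.map_eq_some_iff.1 hp
      have := hs.2.2 p (by rw [hl]; cases l <;> simp_all [Label.shift])
      simpa [mem_dom] using this
    | 2 :: p =>
      obtain ⟨l, hl, e⟩ := Option.map_eq_some_iff.1 hp
      have := ht.2.2 p (by rw [hl]; cases l <;> simp_all [Label.shift])
      simpa [mem_dom] using this

theorem Total.abs {b : LamTree (Option V)} (hb : b.Total) : (abs b).Total := by
  rw [total_iff] at *
  refine ⟨by simp [mem_dom], fun p hp => ?_, fun p hp => ?_⟩
  · match p with
    | [] => simp [mem_dom, mem_dom.1 hb.1]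
    | 0 :: p =>
      obtain ⟨l, hl, e⟩ := Option.map_eq_some_iff.1 hp
      have := hb.2.1 p (by rw [hl]; rcases l with _ | _ | _ | (_ | _) <;> simp_all [Label.abs])
      simpa [mem_dom] using this
    | 1 :: p => simp at hp
    | 2 :: p => simp at hp
  · match p with
    | [] => simp at hp
    | 0 :: p =>
      obtain ⟨l, hl, e⟩ := Option.map_eq_some_iff.1 hp
      have := hb.2.2 p (by rw [hl]; rcases l with _ | _ | _ | (_ | _) <;> simp_all [Label.abs])
      simpa [mem_dom] using this
    | 1 :: p => simp at hp
    | 2 :: p => simp at hp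

theorem var_total (x : V) : (var x).Total := by
  rw [total_iff]
  refine ⟨by simp [mem_dom, var], fun p hp => ?_, fun p hp => ?_⟩ <;>
  · simp only [var] at hp
    split_ifs at hp
    simp at hp

theorem omega_total : (omega V).Total :=
  Total.app (((var_total _).app (var_total _)).abs) (((var_total _).app (var_total _)).abs)

theorem Total.subst {b : LamTree (Option V)} {s : LamTree V} (hb : b.Total) (hs : s.Total) :
    (subst b s).Total := by
  rw [total_iff] at *
  have hit : ∀ p r, b.lab p = some (.fvar none) →
      (p ++ r ∈ (LamTree.subst b s).dom ↔ r ∈ s.dom) := by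
    intro p r h
    change substLab b s _ ≠ none ↔ _
    rw [substLab_hit b s p r h]
    simp [mem_dom]
  have key : ∀ p, p ∈ b.dom → p ∈ (LamTree.subst b s).dom := by
    intro p hp
    obtain ⟨l, hl⟩ := exists_lab hp
    by_cases h : l = .fvar none
    · subst h
      have := (hit p [] hl).2 hs.1
      rwa [List.append_nil] at this
    · change substLab b s p ≠ none
      rw [substLab_miss b s p (b.not_hit_of_mem_dom p l hl h), hl]
      rcases l with _ | _ | _ | (_ | _) <;> simp_all [Label.keep]
  have cases : ∀ p (l : ∀ {W : Type u}, Label W), (∀ k (m : Label V), m.shift k = l → m = l) →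
      (∀ m : Label (Option V), m.keep = some l → m = l) →
      (LamTree.subst b s).lab p = some l →
      b.lab p = some l ∨ ∃ p₁ r, p = p₁ ++ r ∧ b.lab p₁ = some (.fvar none) ∧ s.lab r = some l := by
    intro p l hl1 hl2 h
    change substLab b s p = _ at h
    rcases b.hit_cases p with ⟨p₁, p₂, rfl, h1⟩ | hm
    · rw [substLab_hit b s p₁ p₂ h1, Option.map_eq_some_iff] at h
      obtain ⟨m, hm, e⟩ := h
      exact Or.inr ⟨p₁, p₂, rfl, h1, by rw [hm, hl1 _ _ e]⟩
    · rw [substLab_miss b s p hm, Option.bind_eq_some_iff] at h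
      obtain ⟨m, hm, e⟩ := h
      exact Or.inl (by rw [hm, hl2 _ e])
  refine ⟨key _ hb.1, fun p hp => ?_, fun p hp => ?_⟩
  · rcases cases p .lam (fun k m => by cases m <;> simp [Label.shift])
      (fun m => by rcases m with _ | _ | _ | (_ | _) <;> simp [Label.keep]) hp with
      h | ⟨p₁, r, rfl, h1, h2⟩
    · exact key _ (hb.2.1 p h)
    · rw [List.append_assoc, hit _ _ h1]
      exact hs.2.1 r h2
  · rcases cases p .app (fun k m => by cases m <;> simp [Label.shift])
      (fun m => by rcases m with _ | _ | _ | (_ | _) <;> simp [Label.keep]) hp with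
      h | ⟨p₁, r, rfl, h1, h2⟩
    · exact ⟨key _ (hb.2.2 p h).1, key _ (hb.2.2 p h).2⟩
    · rw [List.append_assoc, hit _ _ h1, List.append_assoc, hit _ _ h1]
      exact hs.2.2 r h2

/-! Filling the holes of a tree -/

theorem BotPos.concat_cases {t : LamTree V} {p : Pos} {i : Fin 3} (h : t.BotPos (p ++ [i])) :
    i = 0 ∧ t.lab p = some .lam ∨ i = 1 ∧ t.lab p = some .app ∨ i = 2 ∧ t.lab p = some .app := by
  generalize e : p ++ [i] = q at h
  cases h with
  | root => simp at e
  | body q hq _ =>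
    obtain ⟨rfl, h⟩ := List.append_inj' e rfl
    exact Or.inl ⟨by simpa using h, hq⟩
  | left q hq _ =>
    obtain ⟨rfl, h⟩ := List.append_inj' e rfl
    exact Or.inr (Or.inl ⟨by simpa using h, hq⟩)
  | right q hq _ =>
    obtain ⟨rfl, h⟩ := List.append_inj' e rfl
    exact Or.inr (Or.inr ⟨by simpa using h, hq⟩)

open Classical in
/-- The labels of `t` with the variable `none` at the holes. -/
noncomputable def holeLab (t : LamTree V) (p : Pos) : Option (Label (Option V)) :=
  if t.BotPos p then some (.fvar none) else (t.lab p).map (Label.map some)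

theorem holeLab_of_lab {t : LamTree V} {p : Pos} {l : Label V} (h : t.lab p = some l) :
    t.holeLab p = some (l.map some) := by
  rw [holeLab, if_neg fun hb => hb.not_mem (mem_dom_of_eq_some h), h]
  rfl

theorem holeLab_of_botPos {t : LamTree V} {p : Pos} (h : t.BotPos p) :
    t.holeLab p = some (.fvar none) := if_pos h

theorem botPos_or_mem_of_holeLab {t : LamTree V} {p : Pos} (h : t.holeLab p ≠ none) :
    t.BotPos p ∨ p ∈ t.dom := by
  by_contra hc
  push Not at hc
  rw [holeLab, if_neg hc.1] at h
  exact hc.2 (by simpa [mem_dom] using h)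

/-- The tree `t` with the variable `none` at the holes. -/
noncomputable def hole (t : LamTree V) : LamTree (Option V) where
  lab := t.holeLab
  lam_of_zero p h := by
    rcases botPos_or_mem_of_holeLab h with h | h
    · rcases h.concat_cases with ⟨-, h⟩ | ⟨h, -⟩ | ⟨h, -⟩
      · exact holeLab_of_lab h
      · simp at h
      · simp at h
    · exact holeLab_of_lab (t.lam_of_zero p h)
  app_of_one p h := by
    rcases botPos_or_mem_of_holeLab h with h | h
    · rcases h.concat_cases with ⟨h, -⟩ | ⟨-, h⟩ | ⟨h, -⟩
      · simp at h
      · exact holeLab_of_lab h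
      · simp at h
    · exact holeLab_of_lab (t.app_of_one p h)
  app_of_two p h := by
    rcases botPos_or_mem_of_holeLab h with h | h
    · rcases h.concat_cases with ⟨h, -⟩ | ⟨h, -⟩ | ⟨-, h⟩
      · simp at h
      · simp at h
      · exact holeLab_of_lab h
    · exact holeLab_of_lab (t.app_of_two p h)
  binder p q h := by
    rw [holeLab] at h
    split_ifs at h
    · simp at h
    · rw [Option.map_eq_some_iff] at h
      obtain ⟨l, hl, h⟩ := h
      match l, hl, h with
      | .bvar z, hl, h =>
        simp only [Label.map, Label.bvar.injEq] at h
        subst h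
        have := t.binder _ _ hl
        exact ⟨this.1, holeLab_of_lab this.2⟩

theorem hole_lab (t : LamTree V) (p : Pos) : t.hole.lab p = t.holeLab p := rfl

theorem hole_total (t : LamTree V) : t.hole.Total := by
  have key : ∀ p, t.BotPos p ∨ p ∈ t.dom → p ∈ t.hole.dom := by
    rintro p (h | h)
    · exact mem_dom_of_eq_some (holeLab_of_botPos h)
    · obtain ⟨l, hl⟩ := exists_lab h
      exact mem_dom_of_eq_some (holeLab_of_lab hl)
  have lab : ∀ p (l : ∀ {W : Type u}, Label W), l ≠ .fvar (none : Option V) →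
      (∀ m : Label V, m.map some = l → m = l) → t.hole.lab p = some l → t.lab p = some l := by
    intro p l h1 h2 h
    rw [hole_lab, holeLab] at h
    split_ifs at h
    · exact absurd (Option.some.inj h).symm h1
    · obtain ⟨m, hm, e⟩ := Option.map_eq_some_iff.1 h
      rw [hm, h2 m e]
  rw [total_iff]
  refine ⟨key _ ?_, fun p hp => key _ ?_, fun p hp => ⟨key _ ?_, key _ ?_⟩⟩
  · by_cases h : [] ∈ t.dom
    · exact Or.inr h
    · exact Or.inl (.root h)
  · have := lab p .lam (by simp) (fun m => by cases m <;> simp [Label.map]) hp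
    by_cases h : p ++ [0] ∈ t.dom
    · exact Or.inr h
    · exact Or.inl (.body p this h)
  · have := lab p .app (by simp) (fun m => by cases m <;> simp [Label.map]) hp
    by_cases h : p ++ [1] ∈ t.dom
    · exact Or.inr h
    · exact Or.inl (.left p this h)
  · have := lab p .app (by simp) (fun m => by cases m <;> simp [Label.map]) hp
    by_cases h : p ++ [2] ∈ t.dom
    · exact Or.inr h
    · exact Or.inl (.right p this h)

/-- The added variables are leaves, so an infinite branch never meets one and lies in `t`. -/
theorem hole_guarded {a : Sig} {t : LamTree V} (h : t.Guarded a) : t.hole.Guarded a := by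
  apply guarded_of_tails
  intro S hS
  refine ⟨0, _, t, h, fun n => ?_⟩
  simp only [Nat.zero_add]
  refine (botPos_or_mem_of_holeLab (hS n)).resolve_left fun hb => ?_
  have h1 := t.hole.lab_of_proper (pref S n) [S n] (by simp) (by rw [← pref_succ]; exact hS (n + 1))
  rw [hole_lab, holeLab_of_botPos hb] at h1
  simp at h1

end LamTree

open LamTree

variable {a : Sig} {V : Type u}

/-- The guarded tree `Ω`. -/
def GTree.omega (a : Sig) (V : Type u) : GTree a V where
  toLamTree := LamTree.omega V
  guarded := guarded_of_length 3 fun _ => length_le_of_mem_omega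

/-- The tree `t` with all holes filled by `Ω`. -/
noncomputable def GTree.fill (t : GTree a V) : GTree a V where
  toLamTree := t.hole.subst (LamTree.omega V)
  guarded := subst_guarded (hole_guarded t.guarded) (GTree.omega a V).guarded

theorem GTree.fill_total (t : GTree a V) : t.fill.Total := (hole_total _).subst omega_total

theorem GTree.extends_fill (t : GTree a V) : t.toLamTree.Extends t.fill.toLamTree := by
  intro p l h
  change substLab _ _ p = _
  have h1 : t.hole.lab p = some (l.map some) := holeLab_of_lab h
  rw [substLab_miss _ _ _ (t.hole.not_hit_of_mem_dom p _ h1 (by cases l <;> simp [Label.map])), h1]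
  cases l <;> rfl

/-- `Ω` is closed: moving it below `q` and cutting it out again amounts to a renaming, which leaves
it unchanged. -/
theorem GTree.subtree_fill (t : GTree a V) {q : Pos} (h : t.BotPos q) :
    t.fill.subtree q = GTree.omega a (V ⊕ Pos) := by
  apply GTree.ext_lab
  intro r
  rw [GTree.subtree_toLamTree, subtree_lab]
  change (substLab _ _ _).map _ = (LamTree.omega (V ⊕ Pos)).lab r
  rw [substLab_hit _ _ q r (holeLab_of_botPos h), ← map_omega Sum.inl, map_lab, Option.map_map]
  congr 1
  funext l
  cases l <;> simp [Label.sub, Label.shift, Label.map]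

theorem betaRed_omega : betaRed a V (GTree.omega a V) (GTree.omega a V) :=
  ⟨⟨selfBody V, guarded_of_length 1 fun _ => length_le_of_mem_selfBody⟩,
    ⟨abs (selfBody V), guarded_of_length 2 fun _ => length_le_of_mem_abs_selfBody⟩, rfl,
    (subst_selfBody _).symm⟩

/-- Contract the copy of `Ω` at `p` over and over for `ω` steps. The tree never changes, and every
step is root-active because all entries of `p` are strict. -/
theorem fragile_of_subtree_eq_omega {t : GTree a V} {p : Pos} (hp : cut a p = [])
    (h : t.subtree p = GTree.omega a (V ⊕ Pos)) : Fragile t := by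
  refine ⟨⟨Ordinal.omega0, fun _ => t, fun _ => p, fun ι _ => ⟨?_, fun _ _ => rfl⟩⟩, rfl, ?_, ?_, ?_⟩
  · rw [h]
    exact betaRed_omega
  -- There is no limit ordinal below `ω`, so `p`-continuity is vacuous.
  · intro γ hγ hl
    exact absurd (Ordinal.omega0_le_of_isSuccLimit hl) (not_le.2 hγ)
  · exact Ordinal.isSuccLimit_omega0
  · intro β hβ
    exact ⟨β, le_rfl, hβ, by simp [hp], List.nil_prefix⟩

end LamCalc

/-! ### Pointwise description of `p`-convergence. -/

namespace LamCalc
open LamTree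

variable {a : Sig} {V : Type u}

/-! Reductions with idle steps -/

/-- No step of `[β, γ)` affects the position `x`. -/
def Quiet (a : Sig) (pos : Ordinal.{0} → Option Pos) (β γ : Ordinal.{0}) (x : Pos) : Prop :=
  ∀ ι, β ≤ ι → ι < γ → ∀ p, pos ι = some p → ¬ cut a p <+: x

theorem Quiet.mono {pos : Ordinal.{0} → Option Pos} {β γ β' γ' : Ordinal.{0}} {x : Pos}
    (h : Quiet a pos β γ x) (h1 : β ≤ β') (h2 : γ' ≤ γ) : Quiet a pos β' γ' x :=
  fun ι hι hι' => h ι (h1.trans hι) (hι'.trans_le h2)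

theorem Quiet.of_prefix {pos : Ordinal.{0} → Option Pos} {β γ : Ordinal.{0}} {x y : Pos}
    (h : Quiet a pos β γ x) (hy : y <+: x) : Quiet a pos β γ y :=
  fun ι h1 h2 p hp hc => h ι h1 h2 p hp (hc.trans hy)

theorem Quiet.of_cut {pos : Ordinal.{0} → Option Pos} {β γ : Ordinal.{0}} {x y : Pos}
    (h : Quiet a pos β γ x) (hy : cut a y <+: x) : Quiet a pos β γ y :=
  fun ι h1 h2 p hp hc => h ι h1 h2 p hp ((cut_prefix_cut hc).trans hy)

/-- The unaffected positions are closed under strict children, as the order on trees demands of a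
lower bound. -/
theorem Quiet.concat_strict {pos : Ordinal.{0} → Option Pos} {β γ : Ordinal.{0}} {x : Pos}
    (h : Quiet a pos β γ x) {i : Fin 3} (hi : a i = false) : Quiet a pos β γ (x ++ [i]) :=
  h.of_cut (by rw [cut_concat_strict hi]; exact cut_prefix a x)

/-- `t` consists of the labels that are eventually unaffected by the steps of `[α₀, γ)`. -/
def IsPLim (α₀ γ : Ordinal.{0}) (tree : Ordinal.{0} → GTree a V) (pos : Ordinal.{0} → Option Pos)
    (t : GTree a V) : Prop :=
  ∀ x l, t.lab x = some l ↔
    ∃ β, α₀ ≤ β ∧ β < γ ∧ (tree β).lab x = some l ∧ Quiet a pos β γ x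

/-- A `p`-convergent reduction on the interval `[α₀, α₁]` of ordinals that may have idle steps. -/
structure Lazy (R : RewriteSystem.{u} a) (α₀ α₁ : Ordinal.{0}) (tree : Ordinal.{0} → GTree a V)
    (pos : Ordinal.{0} → Option Pos) : Prop where
  step : ∀ ι, α₀ ≤ ι → ι < α₁ → ∀ p, pos ι = some p → Step R p (tree ι) (tree (ι + 1))
  idle : ∀ ι, α₀ ≤ ι → ι < α₁ → pos ι = none → tree (ι + 1) = tree ι
  lim : ∀ γ, α₀ < γ → γ ≤ α₁ → Order.IsSuccLimit γ → IsPLim α₀ γ tree pos (tree γ)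

variable {R : RewriteSystem.{u} a} {α₀ α₁ : Ordinal.{0}} {tree : Ordinal.{0} → GTree a V}
  {pos : Ordinal.{0} → Option Pos}

/-- A step changes labels only at or below its position, hence below its cut. At a limit, a label of
the limit tree is witnessed at some quiet earlier index, which the induction hypothesis compares
with `β`. -/
theorem Lazy.lab_eq (h : Lazy R α₀ α₁ tree pos) {β β' : Ordinal.{0}} {x : Pos} (h0 : α₀ ≤ β)
    (h1 : β ≤ β') (h2 : β' ≤ α₁) (hq : Quiet a pos β β' x) :
    (tree β').lab x = (tree β).lab x := by
  induction β' using Ordinal.limitRecOn generalizing β with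
  | zero => rw [le_antisymm h1 (zero_le)]
  | add_one ι ih =>
    rcases h1.eq_or_lt with rfl | hlt
    · rfl
    · have hβ : β ≤ ι := Order.lt_add_one_iff.1 hlt
      have hι : ι < ι + 1 := Order.lt_add_one_iff.2 le_rfl
      rw [← ih h0 hβ (hι.le.trans h2) (hq.mono le_rfl hι.le)]
      rcases hp : pos ι with _ | p
      · rw [h.idle ι (h0.trans hβ) (hι.trans_le h2) hp]
      · refine ((h.step ι (h0.trans hβ) (hι.trans_le h2) p hp).2 x fun hx => ?_).symm
        exact hq ι hβ hι p hp ((cut_prefix a p).trans hx)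
  | limit γ hγ ih =>
    rcases h1.eq_or_lt with rfl | hlt
    · rfl
    · have hlim := h.lim γ (h0.trans_lt hlt) h2 hγ x
      apply Option.ext
      intro l
      rw [hlim]
      constructor
      · rintro ⟨κ, hκ0, hκ, hl, hκq⟩
        rcases le_total β κ with hβκ | hβκ
        · rw [← hl]
          exact (ih κ hκ h0 hβκ (hκ.le.trans h2) (hq.mono le_rfl hκ.le)).symm
        · rw [← hl]
          exact ih β hlt hκ0 hβκ (hlt.le.trans h2) (hκq.mono le_rfl hlt.le)
      · intro hl
        exact ⟨β, h0, hlt, hl, hq⟩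

theorem Lazy.mono (h : Lazy R α₀ α₁ tree pos) {β₁ : Ordinal.{0}} (h1 : β₁ ≤ α₁) :
    Lazy R α₀ β₁ tree pos :=
  ⟨fun ι h0 h2 => h.step ι h0 (h2.trans_le h1), fun ι h0 h2 => h.idle ι h0 (h2.trans_le h1),
    fun γ h0 h2 => h.lim γ h0 (h2.trans h1)⟩

/-- A witness for a limit label may be moved up past `β₀`, since a quiet label does not change. -/
theorem Lazy.tail (h : Lazy R α₀ α₁ tree pos) {β₀ : Ordinal.{0}} (h1 : α₀ ≤ β₀) :
    Lazy R β₀ α₁ tree pos := by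
  refine ⟨fun ι h0 h2 => h.step ι (h1.trans h0) h2, fun ι h0 h2 => h.idle ι (h1.trans h0) h2,
    fun γ h0 h2 hγ x l => ?_⟩
  rw [h.lim γ (h1.trans_lt h0) h2 hγ x l]
  constructor
  · rintro ⟨β, hβ0, hβ, hl, hq⟩
    refine ⟨max β β₀, le_max_right _ _, max_lt hβ h0, ?_, hq.mono (le_max_left _ _) le_rfl⟩
    rw [h.lab_eq hβ0 (le_max_left _ _) ((max_lt hβ h0).le.trans h2)
      (hq.mono le_rfl (max_lt hβ h0).le), hl]
  · rintro ⟨β, hβ0, h'⟩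
    exact ⟨β, h1.trans hβ0, h'⟩


/-! Reduction contexts and limits inferior -/

theorem GTree.mem_dom_restrict {t : GTree a V} {A : Set Pos}
    {hA : ∀ p q, p <+: q → q ∈ A → p ∈ A} {x : Pos} :
    x ∈ (t.restrict A hA).dom ↔ x ∈ A ∧ x ∈ t.dom :=
  LamTree.mem_dom_restrict (t := t.toLamTree) (hA := hA)

theorem GTree.restrict_lab {t : GTree a V} {A : Set Pos} {hA : ∀ p q, p <+: q → q ∈ A → p ∈ A}
    {x : Pos} (hx : x ∈ A) : (t.restrict A hA).lab x = t.lab x := if_pos hx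

theorem GTree.restrict_lab_of_mem {t : GTree a V} {A : Set Pos}
    {hA : ∀ p q, p <+: q → q ∈ A → p ∈ A} {x : Pos} (hx : x ∈ (t.restrict A hA).dom) :
    (t.restrict A hA).lab x = t.lab x :=
  GTree.restrict_lab (GTree.mem_dom_restrict.1 hx).1

/-- The restriction of `t` to the positions that are unaffected by a step at `p`. -/
noncomputable def GTree.context (t : GTree a V) (p : Pos) : GTree a V :=
  t.restrict {x | ¬ cut a p <+: x} fun _ _ h hq hp => hq (hp.trans h)

theorem GTree.mem_dom_context {t : GTree a V} {p x : Pos} :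
    x ∈ (t.context p).dom ↔ ¬ cut a p <+: x ∧ x ∈ t.dom := GTree.mem_dom_restrict

theorem GTree.context_le {s t : GTree a V} {p : Pos} (h : ∀ q, ¬ p <+: q → s.lab q = t.lab q) :
    s.context p ≤ t := by
  have key : ∀ x, ¬ cut a p <+: x → s.lab x = t.lab x := fun x hx =>
    h x fun h' => hx ((cut_prefix a p).trans h')
  refine ⟨fun x hx => ?_, fun x hx => ?_, fun x i hi hx hxs => ?_⟩
  · obtain ⟨h1, h2⟩ := GTree.mem_dom_context.1 hx
    exact (mem_dom_congr (key x h1)).1 h2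
  · rw [← key x (GTree.mem_dom_context.1 hx).1]
    exact GTree.restrict_lab_of_mem hx
  · have h1 : ¬ cut a p <+: x ++ [i] := fun h' =>
      (GTree.mem_dom_context.1 hxs).1 (cut_prefix_concat_strict hi h')
    exact GTree.mem_dom_context.2 ⟨h1, (mem_dom_congr (key _ h1)).2 hx⟩

/-- If `y` were in `c` and its strict child were in `s`, then the child would be in `c`. Absence of
`p` thus propagates upwards along its strict suffix. -/
theorem cut_not_mem_of_le {c s : GTree a V} {p : Pos} (h : c ≤ s) (hs : p ∈ s.dom)
    (hc : p ∉ c.dom) : cut a p ∉ c.dom := by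
  induction p using List.reverseRecOn with
  | nil => exact hc
  | append_singleton y i ih =>
    cases hi : a i with
    | true => rwa [cut_concat_nonstrict hi]
    | false =>
      rw [cut_concat_strict hi]
      exact ih (mem_dom_of_prefix (List.prefix_append _ _) hs)
        fun hy => hc (h.2.2 y i hi hs hy)

/-- By `cut_not_mem_of_le`, any competing context misses everything from `cut a p` downwards, so
cutting off exactly there gives the greatest one. -/
theorem isContext_context {s t : GTree a V} {p : Pos} (hp : p ∈ s.dom)
    (h : ∀ q, ¬ p <+: q → s.lab q = t.lab q) : IsContext s t p (s.context p) := by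
  refine ⟨⟨GTree.context_le fun _ _ => rfl, GTree.context_le h, fun h' =>
    (GTree.mem_dom_context.1 h').1 (cut_prefix a p)⟩, ?_⟩
  rintro c ⟨h1, -, h3⟩
  have h4 := cut_not_mem_of_le h1 hp h3
  refine ⟨fun x hx => ?_, fun x hx => ?_, fun x i hi hx hxc => ?_⟩
  · exact GTree.mem_dom_context.2 ⟨fun h' => h4 (mem_dom_of_prefix h' hx), h1.1 hx⟩
  · rw [h1.2.1 x hx]
    exact (GTree.restrict_lab (show x ∈ {x | ¬ cut a p <+: x} from
      fun h' => h4 (mem_dom_of_prefix h' hx))).symm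
  · exact h1.2.2 x i hi (GTree.mem_dom_context.1 hx).2 hxc

theorem IsContext.unique {s t : GTree a V} {p : Pos} {c c' : GTree a V} (h : IsContext s t p c)
    (h' : IsContext s t p c') : c = c' := IsGreatest.unique h h'

/-- The part of the tree at `β` that is unaffected by the steps of `[β, γ)`. -/
noncomputable def quietPart (tree : Ordinal.{0} → GTree a V) (pos : Ordinal.{0} → Option Pos)
    (γ β : Ordinal.{0}) : GTree a V :=
  (tree β).restrict {x | Quiet a pos β γ x} fun _ _ h hq => hq.of_prefix h

theorem mem_dom_quietPart {γ β : Ordinal.{0}} {x : Pos} :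
    x ∈ (quietPart tree pos γ β).dom ↔ Quiet a pos β γ x ∧ x ∈ (tree β).dom := GTree.mem_dom_restrict

variable {γ : Ordinal.{0}}

/-- A lower bound lies in each context, so its positions are unaffected by all steps of `[β, γ)`.
Conversely the unaffected labels are constant on this interval and occur in every context. -/
theorem isGLB_quietPart {p : Ordinal.{0} → Pos} (h : ∀ δ < γ, Lazy R α₀ δ tree fun ι => some (p ι))
    {β : Ordinal.{0}} (h0 : α₀ ≤ β) (hβ : β < γ) :
    IsGLB ((fun ι => (tree ι).context (p ι)) '' Set.Ico β γ)
      (quietPart tree (fun ι => some (p ι)) γ β) := by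
  have hq : ∀ {x}, Quiet a (fun ι => some (p ι)) β γ x ↔
      ∀ ι, β ≤ ι → ι < γ → ¬ cut a (p ι) <+: x := by
    intro x
    simp [Quiet]
  constructor
  · rintro _ ⟨ι, ⟨h1, h2⟩, rfl⟩
    have key : ∀ x, Quiet a (fun ι => some (p ι)) β γ x → (tree ι).lab x = (tree β).lab x :=
      fun x hx => (h ι h2).lab_eq h0 h1 le_rfl (hx.mono le_rfl h2.le)
    refine ⟨fun x hx => ?_, fun x hx => ?_, fun x i hi hx hxs => ?_⟩
    · obtain ⟨h3, h4⟩ := mem_dom_quietPart.1 hx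
      exact GTree.mem_dom_context.2 ⟨hq.1 h3 ι h1 h2, (mem_dom_congr (key x h3)).2 h4⟩
    · obtain ⟨h3, h4⟩ := mem_dom_quietPart.1 hx
      exact (GTree.restrict_lab_of_mem hx).trans
        ((key x h3).symm.trans (GTree.restrict_lab (hq.1 h3 ι h1 h2)).symm)
    · obtain ⟨h3, h4⟩ := mem_dom_quietPart.1 hxs
      have h5 := h3.concat_strict hi
      exact mem_dom_quietPart.2
        ⟨h5, (mem_dom_congr (key _ h5)).1 (GTree.mem_dom_context.1 hx).2⟩
  · intro c hc
    have hle : ∀ ι, β ≤ ι → ι < γ → c ≤ (tree ι).context (p ι) :=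
      fun ι h1 h2 => hc ⟨ι, ⟨h1, h2⟩, rfl⟩
    have hcβ := hle β le_rfl hβ
    have hcq : ∀ x ∈ c.dom, Quiet a (fun ι => some (p ι)) β γ x := fun x hx =>
      hq.2 fun ι h1 h2 => (GTree.mem_dom_context.1 ((hle ι h1 h2).1 hx)).1
    refine ⟨fun x hx => ?_, fun x hx => ?_, fun x i hi hx hxc => ?_⟩
    · exact mem_dom_quietPart.2 ⟨hcq x hx, (GTree.mem_dom_context.1 (hcβ.1 hx)).2⟩
    · rw [hcβ.2.1 x hx, GTree.context, GTree.restrict_lab_of_mem (hcβ.1 hx)]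
      exact (GTree.restrict_lab (hcq x hx)).symm
    · refine hcβ.2.2 x i hi (GTree.mem_dom_context.2 ⟨?_, (mem_dom_quietPart.1 hx).2⟩) hxc
      exact hq.1 (mem_dom_quietPart.1 hx).1 β le_rfl hβ

/-- Each label of `t` already occurs in one of the quiet parts, so an upper bound inherits both its
labels and the condition on strict holes from those parts. -/
theorem isLUB_quietPart (h : ∀ δ < γ, Lazy R 0 δ tree pos) {t : GTree a V}
    (ht : IsPLim 0 γ tree pos t) : IsLUB (quietPart tree pos γ '' Set.Iio γ) t := by
  have key : ∀ β < γ, ∀ x, Quiet a pos β γ x → (tree β).lab x = t.lab x := by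
    intro β hβ x hx
    apply Option.ext
    intro l
    constructor
    · intro hl
      exact (ht x l).2 ⟨β, zero_le, hβ, hl, hx⟩
    · intro hl
      obtain ⟨κ, -, hκ, hl, hκq⟩ := (ht x l).1 hl
      rw [← hl]
      rcases le_total β κ with hβκ | hβκ
      · exact ((h κ hκ).lab_eq zero_le hβκ le_rfl (hx.mono le_rfl hκ.le)).symm
      · exact (h β hβ).lab_eq zero_le hβκ le_rfl (hκq.mono le_rfl hβ.le)
  constructor
  · rintro _ ⟨β, hβ, rfl⟩
    refine ⟨fun x hx => ?_, fun x hx => ?_, fun x i hi hx hxs => ?_⟩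
    · obtain ⟨h3, h4⟩ := mem_dom_quietPart.1 hx
      exact (mem_dom_congr (key β hβ x h3)).1 h4
    · rw [← key β hβ x (mem_dom_quietPart.1 hx).1]
      exact GTree.restrict_lab_of_mem hx
    · have h5 := (mem_dom_quietPart.1 hxs).1.concat_strict hi
      exact mem_dom_quietPart.2 ⟨h5, (mem_dom_congr (key β hβ _ h5)).2 hx⟩
  · intro u hu
    have hle : ∀ β < γ, quietPart tree pos γ β ≤ u := fun β hβ => hu ⟨β, hβ, rfl⟩
    have hex : ∀ x ∈ t.dom, ∃ β < γ, x ∈ (quietPart tree pos γ β).dom := by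
      intro x hx
      obtain ⟨l, hl⟩ := exists_lab hx
      obtain ⟨β, -, hβ, hl', hq⟩ := (ht x l).1 hl
      exact ⟨β, hβ, mem_dom_quietPart.2 ⟨hq, mem_dom_of_eq_some hl'⟩⟩
    refine ⟨fun x hx => ?_, fun x hx => ?_, fun x i hi hx hxt => ?_⟩
    · obtain ⟨β, hβ, h1⟩ := hex x hx
      exact (hle β hβ).1 h1
    · obtain ⟨β, hβ, h1⟩ := hex x hx
      rw [← (hle β hβ).2.1 x h1, ← key β hβ x (mem_dom_quietPart.1 h1).1]
      exact (GTree.restrict_lab_of_mem h1).symm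
    · obtain ⟨β, hβ, h1⟩ := hex x hxt
      have h2 := mem_dom_quietPart.1 ((hle β hβ).2.2 x i hi hx h1)
      exact (mem_dom_congr (key β hβ _ h2.1)).1 h2.2

/-- The eventually unaffected labels form a tree. -/
theorem exists_isPLim (h : ∀ δ < γ, Lazy R α₀ δ tree pos) : ∃ t : GTree a V, IsPLim α₀ γ tree pos t := by
  classical
  have uniq : ∀ x l l', (∃ β, α₀ ≤ β ∧ β < γ ∧ (tree β).lab x = some l ∧ Quiet a pos β γ x) →
      (∃ β, α₀ ≤ β ∧ β < γ ∧ (tree β).lab x = some l' ∧ Quiet a pos β γ x) → l = l' := by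
    rintro x l l' ⟨β, h0, hβ, hl, hq⟩ ⟨κ, h0', hκ, hl', hq'⟩
    rcases le_total β κ with h1 | h1
    · have := (h κ hκ).lab_eq h0 h1 le_rfl (hq.mono le_rfl hκ.le)
      rw [hl, hl'] at this
      exact (Option.some.inj this).symm
    · have := (h β hβ).lab_eq h0' h1 le_rfl (hq'.mono le_rfl hβ.le)
      rw [hl, hl'] at this
      exact Option.some.inj this
  let lab : Pos → Option (Label V) := fun x =>
    if hx : ∃ l β, α₀ ≤ β ∧ β < γ ∧ (tree β).lab x = some l ∧ Quiet a pos β γ x then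
      some hx.choose else none
  have hlab : ∀ x l, lab x = some l ↔
      ∃ β, α₀ ≤ β ∧ β < γ ∧ (tree β).lab x = some l ∧ Quiet a pos β γ x := by
    intro x l
    constructor
    · intro hl
      by_cases hx : ∃ l β, α₀ ≤ β ∧ β < γ ∧ (tree β).lab x = some l ∧ Quiet a pos β γ x
      · simp only [lab, dif_pos hx, Option.some.injEq] at hl
        rw [← hl]
        exact hx.choose_spec
      · simp [lab, dif_neg hx] at hl
    · intro hl
      have hx : ∃ l β, α₀ ≤ β ∧ β < γ ∧ (tree β).lab x = some l ∧ Quiet a pos β γ x := ⟨l, hl⟩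
      simp only [lab, dif_pos hx, Option.some.injEq]
      exact uniq x _ _ hx.choose_spec hl
  have hdom : ∀ x, lab x ≠ none → ∃ β, α₀ ≤ β ∧ β < γ ∧ x ∈ (tree β).dom ∧ Quiet a pos β γ x := by
    intro x hx
    obtain ⟨l, hl⟩ := Option.ne_none_iff_exists'.1 hx
    obtain ⟨β, h0, hβ, hl, hq⟩ := (hlab x l).1 hl
    exact ⟨β, h0, hβ, mem_dom_of_eq_some hl, hq⟩
  have child : ∀ (i : Fin 3) (l : Label V),
      (∀ (t : GTree a V) q, t.lab (q ++ [i]) ≠ none → t.lab q = some l) →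
      ∀ q, lab (q ++ [i]) ≠ none → lab q = some l := by
    intro i l ht q hq
    obtain ⟨β, h0, hβ, h1, h2⟩ := hdom _ hq
    exact (hlab q l).2 ⟨β, h0, hβ, ht _ _ h1, h2.of_prefix (List.prefix_append _ _)⟩
  refine ⟨⟨⟨lab, child 0 _ fun t => t.lam_of_zero, child 1 _ fun t => t.app_of_one,
    child 2 _ fun t => t.app_of_two, fun p q hp => ?_⟩, ?_⟩, hlab⟩
  · obtain ⟨β, h0, hβ, h1, h2⟩ := (hlab _ _).1 hp
    have := (tree β).binder _ _ h1
    exact ⟨this.1, (hlab _ _).2 ⟨β, h0, hβ, this.2, h2.of_prefix this.1⟩⟩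
  · rintro ⟨S, hS, d, hd⟩
    -- beyond some length the branch is strict
    obtain ⟨n, hn⟩ : ∃ n, ∀ m, n ≤ m → cut a (pref S m) = cut a (pref S n) := by
      have hmono : Monotone fun n => depth a (pref S n) :=
        fun m n hmn => depth_mono a (pref_prefix S hmn)
      obtain ⟨n, hn⟩ : ∃ n, ∀ m, n ≤ m → depth a (pref S m) = depth a (pref S n) := by
        by_contra hc
        push Not at hc
        have : ∀ k, ∃ n, k ≤ depth a (pref S n) := by
          intro k
          induction k with
          | zero => exact ⟨0, Nat.zero_le _⟩
          | succ k ih =>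
            obtain ⟨n, hn⟩ := ih
            obtain ⟨m, hm, hne⟩ := hc n
            have : depth a (pref S n) ≤ depth a (pref S m) := hmono hm
            exact ⟨m, by omega⟩
        obtain ⟨n, hn⟩ := this d
        exact absurd (hd n) (not_lt.2 hn)
      refine ⟨n, fun m hm => ?_⟩
      induction m, hm using Nat.le_induction with
      | base => rfl
      | succ m hm ih =>
        have h1 := hn (m + 1) (hm.trans (Nat.le_succ m))
        rw [← hn m hm, pref_succ, depth_append] at h1
        have h2 : a (S m) = false := by
          cases h3 : a (S m) with
          | false => rfl
          | true => simp [depth, h3] at h1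
        rw [pref_succ, cut_concat_strict h2, ih]
    -- All longer prefixes have the same cut as the one of length `n`, so they are quiet from the
    -- same index `β` on. The whole branch therefore lies in the guarded tree at `β`.
    obtain ⟨β, h0, hβ, h1, h2⟩ := hdom _ (hS n)
    refine (tree β).guarded ⟨S, fun m => ?_, d, hd⟩
    rcases le_total m n with hm | hm
    · exact mem_dom_of_prefix (pref_prefix S hm) h1
    · have h3 : Quiet a pos β γ (pref S m) := h2.of_cut (by rw [hn m hm]; exact cut_prefix _ _)
      obtain ⟨l, hl⟩ := exists_lab (hS m : pref S m ∈ _)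
      obtain ⟨κ, h0', hκ, hl', hq'⟩ := (hlab _ _).1 hl
      apply mem_dom_of_eq_some (l := l)
      rw [← hl']
      rcases le_total β κ with h4 | h4
      · exact ((h κ hκ).lab_eq h0 h4 le_rfl (h3.mono le_rfl hκ.le)).symm
      · exact (h β hβ).lab_eq h0' h4 le_rfl (hq'.mono le_rfl hβ.le)

theorem isLiminf_of_isPLim {p : Ordinal.{0} → Pos} (h : ∀ δ < γ, Lazy R 0 δ tree fun ι => some (p ι))
    {t : GTree a V} (ht : IsPLim 0 γ tree (fun ι => some (p ι)) t) :
    IsLiminf γ (fun ι => (tree ι).context (p ι)) t :=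
  ⟨quietPart tree (fun ι => some (p ι)) γ, fun _ hβ => isGLB_quietPart h zero_le hβ,
    isLUB_quietPart h ht⟩

/-- Greatest lower and least upper bounds are unique, and the tree of eventually unaffected labels
exists and is the limit inferior. -/
theorem isPLim_of_isLiminf {p : Ordinal.{0} → Pos} (h : ∀ δ < γ, Lazy R 0 δ tree fun ι => some (p ι))
    {c : Ordinal.{0} → GTree a V} (hc : ∀ ι < γ, c ι = (tree ι).context (p ι)) {t : GTree a V}
    (ht : IsLiminf γ c t) : IsPLim 0 γ tree (fun ι => some (p ι)) t := by
  obtain ⟨g, hg, hl⟩ := ht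
  have hg' : ∀ β < γ, g β = quietPart tree (fun ι => some (p ι)) γ β := by
    intro β hβ
    have h1 := hg β hβ
    rw [Set.image_congr fun ι hι => hc ι hι.2] at h1
    exact h1.unique (isGLB_quietPart h zero_le hβ)
  rw [Set.image_congr (fun β (hβ : β ∈ Set.Iio γ) => hg' β hβ)] at hl
  obtain ⟨t', ht'⟩ := exists_isPLim h
  rw [hl.unique (isLUB_quietPart h ht')]
  exact ht'

/-- No rule has the left-hand side `⊥`. -/
def RewriteSystem.Proper (R : RewriteSystem.{u} a) : Prop :=
  ∀ (V : Type u) (l r : GTree a V), R V l r → [] ∈ l.dom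

theorem Step.mem_dom (hR : R.Proper) {p : Pos} {s t : GTree a V} (h : Step R p s t) :
    p ∈ s.dom := by
  have := hR _ _ _ h.1
  rw [GTree.subtree_toLamTree, mem_dom_subtree] at this
  simpa using this

/-- A `p`-convergent reduction is a reduction on an interval. -/
theorem Reduction.lazy (hR : R.Proper) (S : Reduction R V) (hS : S.PConvergent) :
    Lazy R 0 S.len S.tree fun ι => some (S.pos ι) := by
  -- The description of the limit at `γ` presupposes that all shorter pieces are already known to be
  -- `Lazy`.
  suffices ∀ α, α ≤ S.len → Lazy R 0 α S.tree fun ι => some (S.pos ι) from this _ le_rfl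
  intro α
  induction α using WellFoundedLT.induction with
  | _ α ih =>
    intro hα
    refine ⟨fun ι _ hι p hp => ?_, fun ι _ _ hp => by simp at hp, fun γ _ hγα hγ => ?_⟩
    · obtain rfl := Option.some.inj hp
      exact S.step ι (hι.trans_le hα)
    · obtain ⟨c, hc, hl⟩ := hS γ (hγα.trans hα) hγ
      refine isPLim_of_isLiminf (R := R)
        (fun δ hδ => ih δ (hδ.trans_le hγα) ((hδ.le.trans hγα).trans hα)) (c := c) (fun ι hι => ?_) hl
      have hstep := S.step ι (hι.trans_le (hγα.trans hα))
      exact (hc ι hι).unique (isContext_context (hstep.mem_dom hR) hstep.2)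

theorem Reduction.pLimitAt_of_isPLim (hR : R.Proper) (S : Reduction R V)
    (h : ∀ δ < γ, Lazy R 0 δ S.tree fun ι => some (S.pos ι)) (hγ : γ ≤ S.len)
    (ht : IsPLim 0 γ S.tree (fun ι => some (S.pos ι)) (S.tree γ)) : S.PLimitAt γ := by
  refine ⟨_, fun ι hι => ?_, isLiminf_of_isPLim h ht⟩
  have hstep := S.step ι (hι.trans_le hγ)
  exact isContext_context (hstep.mem_dom hR) hstep.2

end LamCalc

/-! ### Volatile positions yield fragile trees: removal of idle steps, restriction to subtrees,
simulation of `β`-steps. -/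

namespace LamCalc
open LamTree

variable {a : Sig} {V W : Type u} {R R' : RewriteSystem.{u} a} {α₀ α₁ : Ordinal.{0}}
  {tree : Ordinal.{0} → GTree a V} {pos : Ordinal.{0} → Option Pos}

theorem GTree.subtree_nil_omega : (GTree.omega a V).subtree [] = GTree.omega a (V ⊕ Pos) := by
  apply GTree.ext_lab
  intro r
  rw [GTree.subtree_toLamTree, subtree_lab]
  change _ = (LamTree.omega (V ⊕ Pos)).lab r
  rw [← map_omega (V := V) Sum.inl, map_lab, List.nil_append]
  change Option.map _ ((LamTree.omega V).lab r) = _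
  congr 1

/-! Removal of idle steps -/

theorem Lazy.eq_of_idle (h : Lazy R α₀ α₁ tree pos) {β β' : Ordinal.{0}} (h0 : α₀ ≤ β)
    (h1 : β ≤ β') (h2 : β' ≤ α₁) (hi : ∀ ι, β ≤ ι → ι < β' → pos ι = none) :
    tree β' = tree β :=
  GTree.ext_lab fun _ => h.lab_eq h0 h1 h2 fun ι h3 h4 p hp => by simp [hi ι h3 h4] at hp

/-- The non-idle indices are re-indexed in increasing order by an ordinal. Idle stretches leave the
tree unchanged, and cofinality of the root-active steps makes the new length a limit ordinal. -/
theorem Lazy.exists_reduction (h : Lazy R α₀ α₁ tree pos) (hR : R.Proper)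
    (hl : Order.IsSuccLimit α₁) (h0 : α₀ < α₁)
    (hroot : ∀ β, α₀ ≤ β → β < α₁ → ∃ γ p, β ≤ γ ∧ γ < α₁ ∧ pos γ = some p ∧ cut a p = []) :
    ∃ S : Reduction R V, S.tree 0 = tree α₀ ∧ S.Destructive := by
  -- All ordinals from `α₁` on are added: this makes `N` unbounded, as `Ordinal.enumOrd` requires,
  -- and `α₁` itself gets an index, the new length.
  let N : Set Ordinal.{0} := {ι | (α₀ ≤ ι ∧ ι < α₁ ∧ pos ι ≠ none) ∨ α₁ ≤ ι}
  have hN : ¬ BddAbove N := by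
    rintro ⟨b, hb⟩
    have : max α₁ (b + 1) ∈ N := Or.inr (le_max_left _ _)
    have := (le_max_right _ _).trans (hb this)
    exact absurd (Order.lt_add_one_iff.2 le_rfl) (not_lt.2 this)
  let e := Ordinal.enumOrd N
  have he : StrictMono e := Ordinal.enumOrd_strictMono hN
  have heN : ∀ ι, e ι ∈ N := Ordinal.enumOrd_mem hN
  have hsurj : ∀ b ∈ N, ∃ k, e k = b := fun b hb => Ordinal.enumOrd_surjective hN hb
  have hα₀ : ∀ ι, α₀ ≤ e ι := fun ι => by
    rcases heN ι with h | h
    · exact h.1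
    · exact h0.le.trans h
  obtain ⟨len, hlen⟩ := hsurj α₁ (Or.inr le_rfl)
  have hlt : ∀ {ι}, ι < len → e ι < α₁ := fun hι => hlen ▸ he hι
  have hle : ∀ {ι}, ι ≤ len → e ι ≤ α₁ := fun hι => hlen ▸ he.monotone hι
  have hpos : ∀ ι < len, ∃ p, pos (e ι) = some p := by
    intro ι hι
    rcases heN ι with h | h
    · exact Option.ne_none_iff_exists'.1 h.2.2
    · exact absurd h (not_le.2 (hlt hι))
  let pos' : Ordinal.{0} → Pos := fun ι => (pos (e ι)).getD []
  have hpos' : ∀ ι < len, pos (e ι) = some (pos' ι) := by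
    intro ι hι
    obtain ⟨p, hp⟩ := hpos ι hι
    simp [pos', hp]
  -- the trees at `β` and at the next element of `N` agree
  have skip : ∀ β κ, α₀ ≤ β → β ≤ e κ → κ ≤ len → (∀ k < κ, e k < β) → tree (e κ) = tree β := by
    intro β κ h1 h2 h3 h4
    refine h.eq_of_idle h1 h2 (hle h3) fun ι h5 h6 => ?_
    by_contra hne
    obtain ⟨k, rfl⟩ := hsurj ι (Or.inl ⟨h1.trans h5, h6.trans_le (hle h3), hne⟩)
    exact absurd (h4 k (he.lt_iff_lt.1 h6)) (not_lt.2 h5)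
  have hstep : ∀ ι < len, Step R (pos' ι) (tree (e ι)) (tree (e (ι + 1))) := by
    intro ι hι
    have h1 : ι < ι + 1 := Order.lt_add_one_iff.2 le_rfl
    rw [skip (e ι + 1) (ι + 1) ((hα₀ ι).trans (Order.lt_add_one_iff.2 le_rfl).le)
      (Order.add_one_le_of_lt (he h1)) (Order.add_one_le_of_lt hι) fun k hk =>
      Order.lt_add_one_iff.2 (he.monotone (Order.lt_add_one_iff.1 hk))]
    exact h.step _ (hα₀ ι) (hlt hι) _ (hpos' ι hι)
  have hlazy : Lazy R 0 len (fun ι => tree (e ι)) fun ι => some (pos' ι) := by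
    refine ⟨fun ι _ hι p hp => ?_, fun ι _ _ hp => by simp at hp, fun γ _ hγ hγl x l => ?_⟩
    · obtain rfl := Option.some.inj hp
      exact hstep ι hι
    -- `σ` is the supremum of the `e k` with `k < γ`. The enumeration may be discontinuous, as idle
    -- steps can separate `σ` from `e γ`; the limit condition holds at `σ` and the idle steps carry
    -- it to `e γ`.
    · obtain ⟨σ, hσ, hmin⟩ : ∃ σ, (∀ k < γ, e k < σ) ∧ ∀ b < σ, ∃ k < γ, b ≤ e k := by
        have hne : {σ | ∀ k < γ, e k < σ}.Nonempty := ⟨e γ, fun k hk => he hk⟩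
        refine ⟨sInf {σ | ∀ k < γ, e k < σ}, csInf_mem hne, fun b hb => ?_⟩
        by_contra hc
        push Not at hc
        exact notMem_of_lt_csInf hb (OrderBot.bddBelow _) hc
      have hσe : σ ≤ e γ := by
        by_contra hc
        obtain ⟨k, hk, hk'⟩ := hmin _ (not_le.1 hc)
        exact absurd (he hk) (not_lt.2 hk')
      have hγ0 : 0 < γ := pos_iff_ne_zero.2 fun h0 => hγl.1 (h0 ▸ isMin_bot)
      have h1 : α₀ < σ := (hα₀ 0).trans_lt (hσ 0 hγ0)
      have hσl : Order.IsSuccLimit σ := by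
        refine ⟨fun hm => absurd h1 (not_lt.2 ((hm (zero_le : 0 ≤ σ)).trans zero_le)), ?_⟩
        refine Order.isSuccPrelimit_of_succ_lt fun b hb => ?_
        obtain ⟨k, hk, hk'⟩ := hmin b hb
        refine lt_of_le_of_lt ?_ (hσ (Order.succ k) (hγl.succ_lt hk))
        exact Order.succ_le_of_lt (hk'.trans_lt (he (Order.lt_succ k)))
      rw [skip σ γ h1.le hσe hγ hσ, h.lim σ h1 (hσe.trans (hle hγ)) hσl x l]
      constructor
      · rintro ⟨β, hβ0, hβ, hlab, hq⟩
        obtain ⟨k, hk, hk'⟩ := hmin β hβ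
        refine ⟨k, zero_le, hk, ?_, fun ι h2 h3 p hp => ?_⟩
        · rw [← hlab]
          exact h.lab_eq hβ0 hk' (hle (hk.le.trans hγ)) (hq.mono le_rfl (hσ k hk).le)
        · exact hq (e ι) (hk'.trans (he.monotone h2)) (hσ ι h3) p
            ((hpos' ι (h3.trans_le hγ)).trans hp)
      · rintro ⟨k, -, hk, hlab, hq⟩
        refine ⟨e k, hα₀ k, hσ k hk, hlab, fun ι h2 h3 p hp => ?_⟩
        have h4 : ι < e γ := h3.trans_le hσe
        obtain ⟨m, rfl⟩ := hsurj ι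
          (Or.inl ⟨(hα₀ k).trans h2, h4.trans_le (hle hγ), by simp [hp]⟩)
        have hm := he.lt_iff_lt.1 h4
        exact hq m (he.le_iff_le.1 h2) hm p ((hpos' m (hm.trans_le hγ)).symm.trans hp)
  let S : Reduction R V := ⟨len, fun ι => tree (e ι), pos', hstep⟩
  refine ⟨S, ?_, ?_, ?_, ?_⟩
  · exact skip α₀ 0 le_rfl (hα₀ 0) zero_le fun k hk => absurd hk not_lt_zero
  · intro γ hγ hγl
    refine S.pLimitAt_of_isPLim hR (fun δ hδ => hlazy.mono (hδ.trans hγ).le) hγ.le ?_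
    exact hlazy.lim γ (pos_iff_ne_zero.2 fun h0 => hγl.1 (h0 ▸ isMin_bot)) hγ.le hγl
  · have hex : ∀ β, α₀ ≤ β → β < α₁ → ∃ m < len, β ≤ e m := by
      intro β h1 h2
      obtain ⟨γ, p, h3, h4, h5, -⟩ := hroot β h1 h2
      obtain ⟨m, rfl⟩ := hsurj γ (Or.inl ⟨h1.trans h3, h4, by simp [h5]⟩)
      exact ⟨m, he.lt_iff_lt.1 (hlen ▸ h4), h3⟩
    refine ⟨fun hm => ?_, Order.isSuccPrelimit_of_succ_lt fun k hk => ?_⟩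
    · obtain ⟨m, hm', -⟩ := hex α₀ le_rfl h0
      exact absurd hm' (not_lt.2 ((hm (zero_le : 0 ≤ len)).trans zero_le))
    · obtain ⟨m, hm, hm'⟩ := hex (Order.succ (e k))
        ((hα₀ k).trans (Order.le_succ _)) (hl.succ_lt (hlt hk))
      exact (Order.succ_le_of_lt (he.lt_iff_lt.1 (Order.succ_le_iff.1 hm'))).trans_lt hm
  · intro β hβ
    obtain ⟨γ, p, h3, h4, h5, h6⟩ := hroot (e β) (hα₀ β) (hlt hβ)
    obtain ⟨m, rfl⟩ := hsurj γ (Or.inl ⟨(hα₀ β).trans h3, h4, by simp [h5]⟩)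
    have hm : m < len := he.lt_iff_lt.1 (hlen ▸ h4)
    refine ⟨m, he.le_iff_le.1 h3, hm, ?_, List.nil_prefix⟩
    have : pos' m = p := Option.some.inj ((hpos' m hm).symm.trans h5)
    change cut a (pos' m) <+: []
    rw [this, h6]

/-! The `β`-rule together with the erasure of arbitrary subtrees -/

/-- The rules `l → ⊥` for `l ≠ ⊥`. -/
def eraseRed (a : Sig) : RewriteSystem.{u} a := fun _ l r => [] ∈ l.dom ∧ r = GTree.bot

theorem GTree.eq_bot_of_nil_not_mem {t : GTree a V} (h : [] ∉ t.dom) : t = GTree.bot := by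
  apply GTree.ext_lab
  intro p
  by_contra hp
  exact h (t.mem_dom_of_append [] p hp)

theorem betaRed_proper : (betaRed.{u} a).Proper := by
  rintro V l r ⟨b, s, h, -⟩
  rw [h]
  simp [LamTree.mem_dom]

theorem union_eraseRed_proper : ((betaRed.{u} a).union (eraseRed a)).Proper := by
  rintro V l r (h | h)
  · exact betaRed_proper V l r h
  · exact h.1

theorem Step.imp (h : ∀ (V : Type u) (l r : GTree a V), R V l r → R' V l r) {p : Pos}
    {s t : GTree a V} (hs : Step R p s t) : Step R' p s t := ⟨h _ _ _ hs.1, hs.2⟩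

theorem Lazy.imp (h : ∀ (V : Type u) (l r : GTree a V), R V l r → R' V l r)
    (hl : Lazy R α₀ α₁ tree pos) : Lazy R' α₀ α₁ tree pos :=
  ⟨fun ι h0 h1 p hp => (hl.step ι h0 h1 p hp).imp h, hl.idle, hl.lim⟩

theorem Step.not_mem_of_eraseRed {p : Pos} {s t : GTree a V} (h : Step (eraseRed a) p s t) :
    p ∉ t.dom := by
  have h1 : [] ∉ (t.subtree p).dom := by rw [h.1.2]; simp [GTree.bot, LamTree.bot, LamTree.mem_dom]
  rw [GTree.subtree_toLamTree, mem_dom_subtree] at h1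
  simpa using h1

theorem Step.extends_of_eraseRed {p : Pos} {s t : GTree a V} (h : Step (eraseRed a) p s t) :
    t.toLamTree.Extends s.toLamTree := by
  intro x l hl
  rw [h.2 x fun hx => h.not_mem_of_eraseRed (mem_dom_of_prefix hx (mem_dom_of_eq_some hl)), hl]

theorem step_union_iff {p : Pos} {s t : GTree a V} :
    Step (R.union R') p s t ↔ Step R p s t ∨ Step R' p s t := by
  simp only [Step, RewriteSystem.union]
  tauto

theorem union_eraseRed_map (f : V → W) {l r : GTree a V}
    (h : (betaRed a).union (eraseRed a) V l r) :
    (betaRed a).union (eraseRed a) W (l.map f) (r.map f) := by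
  rcases h with h | ⟨h1, rfl⟩
  · exact Or.inl (betaRed_map f h)
  · exact Or.inr ⟨mem_dom_map.2 h1, GTree.ext_lab fun _ => rfl⟩

theorem step_subtree
    (hR : ∀ (V W : Type u) (f : V → W) (l r : GTree a V), R V l r → R W (l.map f) (r.map f))
    {q r : Pos} {s t : GTree a V} (h : Step R (q ++ r) s t) :
    Step R r (s.subtree q) (t.subtree q) := by
  refine ⟨?_, fun y hy => ?_⟩
  · rw [GTree.subtree_subtree, GTree.subtree_subtree]
    exact hR _ _ _ _ _ h.1
  · have := h.2 (q ++ y) (by rwa [List.prefix_append_right_inj])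
    simp only [GTree.subtree_toLamTree, subtree_lab, this]

open Classical in
/-- The positions relative to `q` of the steps below `q`. -/
noncomputable def subPos (q : Pos) (pos : Ordinal.{0} → Option Pos) (ι : Ordinal.{0}) :
    Option Pos :=
  (pos ι).bind fun p => if q <+: p then some (p.drop q.length) else none

theorem subPos_eq_some {q r : Pos} {ι : Ordinal.{0}} :
    subPos q pos ι = some r ↔ pos ι = some (q ++ r) := by
  simp only [subPos, Option.bind_eq_some_iff]
  constructor
  · rintro ⟨p, hp, h⟩
    split_ifs at h with h1
    obtain ⟨y, rfl⟩ := h1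
    rw [List.drop_left] at h
    rw [hp, Option.some.inj h]
  · intro h
    exact ⟨_, h, by simp⟩

/-- By `hqs`, a step that affects a position at or below `q` takes place at or below `q`. It is a
step of the subtree, and all other steps become idle. -/
theorem Lazy.subtree
    (hR : ∀ (V W : Type u) (f : V → W) (l r : GTree a V), R V l r → R W (l.map f) (r.map f))
    (h : Lazy R α₀ α₁ tree pos) {q : Pos} (hq : cut a q = q)
    (hqs : ∀ ι, α₀ ≤ ι → ι < α₁ → ∀ p, pos ι = some p → cut a p <+: q → cut a p = q) :
    Lazy R α₀ α₁ (fun ι => (tree ι).subtree q) (subPos q pos) := by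
  have hrel : ∀ ι, α₀ ≤ ι → ι < α₁ → ∀ p, pos ι = some p → ∀ y, cut a p <+: q ++ y →
      ∃ r, p = q ++ r ∧ cut a r <+: y := by
    intro ι h0 h1 p hp y hy
    have hqp : q <+: p := by
      rcases prefix_total hy (List.prefix_append q y) with h2 | h2
      · exact hqs ι h0 h1 p hp h2 ▸ cut_prefix a p
      · exact h2.trans (cut_prefix a p)
    obtain ⟨r, rfl⟩ := hqp
    refine ⟨r, rfl, ?_⟩
    rwa [cut_append hq, List.prefix_append_right_inj] at hy
  have hquiet : ∀ β γ y, α₀ ≤ β → γ ≤ α₁ →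
      (Quiet a (subPos q pos) β γ y ↔ Quiet a pos β γ (q ++ y)) := by
    intro β γ y h0 h1
    constructor
    · intro hy ι h2 h3 p hp hc
      obtain ⟨r, rfl, hr⟩ := hrel ι (h0.trans h2) (h3.trans_le h1) p hp y hc
      exact hy ι h2 h3 r (subPos_eq_some.2 hp) hr
    · intro hy ι h2 h3 r hr hc
      refine hy ι h2 h3 _ (subPos_eq_some.1 hr) ?_
      rwa [cut_append hq, List.prefix_append_right_inj]
  refine ⟨fun ι h0 h1 r hr => ?_, fun ι h0 h1 hr => ?_, fun γ h0 h1 hγ y l => ?_⟩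
  · exact step_subtree hR (h.step ι h0 h1 _ (subPos_eq_some.1 hr))
  · apply GTree.ext_lab
    intro y
    simp only [GTree.subtree_toLamTree, subtree_lab]
    rcases hp : pos ι with _ | p
    · rw [h.idle ι h0 h1 hp]
    · rw [(h.step ι h0 h1 p hp).2 (q ++ y) fun hc => ?_]
      obtain ⟨r, rfl, -⟩ := hrel ι h0 h1 p hp y ((cut_prefix a p).trans hc)
      rw [subPos_eq_some.2 hp] at hr
      simp at hr
  · simp only [GTree.subtree_toLamTree, subtree_lab, Option.map_eq_some_iff]
    constructor
    · rintro ⟨m, hm, rfl⟩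
      obtain ⟨β, h2, h3, h4, h5⟩ := (h.lim γ h0 h1 hγ _ _).1 hm
      exact ⟨β, h2, h3, ⟨m, h4, rfl⟩, (hquiet β γ y h2 h1).2 h5⟩
    · rintro ⟨β, h2, h3, ⟨m, hm, rfl⟩, h5⟩
      exact ⟨m, (h.lim γ h0 h1 hγ _ _).2 ⟨β, h2, h3, hm, (hquiet β γ y h2 h1).1 h5⟩, rfl⟩

/-! Simulation of the `β`-steps on a filled tree -/

open Classical in
/-- The positions of the `β`-steps. -/
noncomputable def betaPos (tree : Ordinal.{0} → GTree a V) (pos : Ordinal.{0} → Option Pos)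
    (ι : Ordinal.{0}) : Option Pos :=
  (pos ι).filter fun p => Step (betaRed a) p (tree ι) (tree (ι + 1))

theorem betaPos_eq_some {ι : Ordinal.{0}} {p : Pos} : betaPos tree pos ι = some p ↔
    pos ι = some p ∧ Step (betaRed a) p (tree ι) (tree (ι + 1)) := by
  simp [betaPos, Option.filter_eq_some_iff]

open Classical in
/-- The reduction from `w₀` that performs `β`-steps at given positions after `α₀`. -/
noncomputable def simulate (α₀ : Ordinal.{0}) (w₀ : GTree a V) (pos : Ordinal.{0} → Option Pos)
    (ι : Ordinal.{0}) : GTree a V :=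
  Ordinal.limitRecOn (motive := fun _ => GTree a V) ι w₀
    (fun κ w =>
      if h : α₀ ≤ κ ∧ ∃ w' p, pos κ = some p ∧ Step (betaRed a) p w w' then h.2.choose else w)
    (fun γ _ f =>
      if h : α₀ < γ ∧ ∃ t, IsPLim α₀ γ (fun δ => if hδ : δ < γ then f δ hδ else w₀) pos t then
        h.2.choose else w₀)

theorem simulate_of_le {w₀ : GTree a V} {ι : Ordinal.{0}} (h : ι ≤ α₀) :
    simulate α₀ w₀ pos ι = w₀ := by
  induction ι using Ordinal.limitRecOn with
  | zero => simp [simulate]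
  | add_one κ ih =>
    have hκ : κ < α₀ := Order.add_one_le_iff.1 h
    rw [simulate, Ordinal.limitRecOn_add_one, dif_neg fun h' => absurd h'.1 (not_le.2 hκ)]
    exact ih hκ.le
  | limit γ hγ ih =>
    rw [simulate, Ordinal.limitRecOn_limit _ _ _ _ hγ, dif_neg fun h' => absurd h'.1 (not_lt.2 h)]

theorem simulate_step {w₀ : GTree a V} {κ : Ordinal.{0}} (h : α₀ ≤ κ) {p : Pos}
    (hp : pos κ = some p) (hex : ∃ w', Step (betaRed a) p (simulate α₀ w₀ pos κ) w') :
    Step (betaRed a) p (simulate α₀ w₀ pos κ) (simulate α₀ w₀ pos (κ + 1)) := by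
  have h1 : α₀ ≤ κ ∧ ∃ w' p, pos κ = some p ∧ Step (betaRed a) p (simulate α₀ w₀ pos κ) w' := by
    obtain ⟨w', hw⟩ := hex
    exact ⟨h, w', p, hp, hw⟩
  obtain ⟨p', hp', hs⟩ := h1.2.choose_spec
  obtain rfl : p' = p := Option.some.inj (hp'.symm.trans hp)
  have e : simulate α₀ w₀ pos (κ + 1) = h1.2.choose := by
    conv_lhs => rw [simulate, Ordinal.limitRecOn_add_one]
    exact dif_pos h1
  rw [e]
  exact hs

theorem simulate_idle {w₀ : GTree a V} {κ : Ordinal.{0}} (hp : pos κ = none) :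
    simulate α₀ w₀ pos (κ + 1) = simulate α₀ w₀ pos κ := by
  conv_lhs => rw [simulate, Ordinal.limitRecOn_add_one]
  exact dif_neg (by simp [hp])

theorem IsPLim.congr {γ : Ordinal.{0}} {tree' : Ordinal.{0} → GTree a V} {t : GTree a V}
    (h : IsPLim α₀ γ tree pos t) (e : ∀ δ < γ, tree δ = tree' δ) : IsPLim α₀ γ tree' pos t := by
  intro x l
  rw [h x l]
  constructor
  · rintro ⟨β, h0, h1, h2, h3⟩
    exact ⟨β, h0, h1, e β h1 ▸ h2, h3⟩
  · rintro ⟨β, h0, h1, h2, h3⟩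
    exact ⟨β, h0, h1, e β h1 ▸ h2, h3⟩

theorem simulate_limit {w₀ : GTree a V} {γ : Ordinal.{0}} (h : α₀ < γ)
    (hγ : Order.IsSuccLimit γ) (hex : ∃ t, IsPLim α₀ γ (simulate α₀ w₀ pos) pos t) :
    IsPLim α₀ γ (simulate α₀ w₀ pos) pos (simulate α₀ w₀ pos γ) := by
  -- The recursion only sees values below `γ`, padded by `w₀`; `IsPLim` at `γ` does not depend on
  -- the padding.
  let f : Ordinal.{0} → GTree a V := fun δ => if _ : δ < γ then simulate α₀ w₀ pos δ else w₀
  have hf : ∀ δ < γ, f δ = simulate α₀ w₀ pos δ := fun δ hδ => dif_pos hδ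
  have h1 : α₀ < γ ∧ ∃ t, IsPLim α₀ γ f pos t := by
    obtain ⟨t, ht⟩ := hex
    exact ⟨h, t, ht.congr fun δ hδ => (hf δ hδ).symm⟩
  have e : simulate α₀ w₀ pos γ = h1.2.choose := by
    conv_lhs => rw [simulate, Ordinal.limitRecOn_limit _ _ _ _ hγ]
    exact dif_pos h1
  rw [e]
  exact h1.2.choose_spec.congr hf

/-- The two claims need each other: extension ensures that each redex of the original is a redex of
the simulation. It survives `β`-steps by monotonicity and erasures because these only shrink the
original. It survives limits because the simulation performs fewer steps, so every position that is
quiet in the original is quiet there. -/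
theorem Lazy.simulate (h : Lazy ((betaRed a).union (eraseRed a)) α₀ α₁ tree pos) {w₀ : GTree a V}
    (hw : (tree α₀).toLamTree.Extends w₀.toLamTree) {α : Ordinal.{0}} (h0 : α₀ ≤ α) (h1 : α ≤ α₁) :
    Lazy (betaRed a) α₀ α (simulate α₀ w₀ (betaPos tree pos)) (betaPos tree pos) ∧
      (tree α).toLamTree.Extends (LamCalc.simulate α₀ w₀ (betaPos tree pos) α).toLamTree := by
  induction α using WellFoundedLT.induction with
  | _ α ih =>
  have hstep : ∀ ι, α₀ ≤ ι → ι < α → ∀ p, betaPos tree pos ι = some p →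
      Step (betaRed a) p (LamCalc.simulate α₀ w₀ (betaPos tree pos) ι)
        (LamCalc.simulate α₀ w₀ (betaPos tree pos) (ι + 1)) := by
    intro ι h2 h3 p hp
    refine simulate_step h2 hp (exists_step_betaRed ?_ ?_)
    · exact (ih ι h3 h2 (h3.le.trans h1)).2 _ _ (step_betaRed_lab (betaPos_eq_some.1 hp).2).1
    · exact (ih ι h3 h2 (h3.le.trans h1)).2 _ _ (step_betaRed_lab (betaPos_eq_some.1 hp).2).2
  have hlazy : Lazy (betaRed a) α₀ α (LamCalc.simulate α₀ w₀ (betaPos tree pos))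
      (betaPos tree pos) := by
    refine ⟨hstep, fun ι _ _ hp => simulate_idle hp, fun γ h2 h3 hγ => simulate_limit h2 hγ ?_⟩
    refine exists_isPLim (R := betaRed a) fun δ hδ => ?_
    rcases le_total α₀ δ with h4 | h4
    · exact (ih δ (hδ.trans_le h3) h4 ((hδ.le.trans h3).trans h1)).1
    · exact ⟨fun ι h5 h6 => absurd (h5.trans_lt h6) (not_lt.2 h4),
        fun ι h5 h6 => absurd (h5.trans_lt h6) (not_lt.2 h4),
        fun ι h5 h6 => absurd (h5.trans_le h6) (not_lt.2 h4)⟩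
  refine ⟨hlazy, ?_⟩
  rcases h0.eq_or_lt with rfl | h0
  · rwa [simulate_of_le le_rfl]
  rcases Ordinal.zero_or_succ_or_isSuccLimit α with rfl | ⟨ι, rfl⟩ | hl
  · exact absurd h0 not_lt_zero
  · have h2 : α₀ ≤ ι := Order.lt_succ_iff.1 h0
    have h3 : ι < Order.succ ι := Order.lt_succ ι
    have hι := (ih ι h3 h2 (h3.le.trans h1)).2
    simp only [Order.succ_eq_add_one] at *
    rcases hb : betaPos tree pos ι with _ | p
    · have e := simulate_idle (α₀ := α₀) (w₀ := w₀) hb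
      rw [e]
      rcases hp : pos ι with _ | p
      · rwa [h.idle ι h2 (h3.trans_le h1) hp]
      · rcases step_union_iff.1 (h.step ι h2 (h3.trans_le h1) p hp) with hs | hs
        · rw [betaPos_eq_some.2 ⟨hp, hs⟩] at hb
          simp at hb
        · exact fun x l hx => hι x l (hs.extends_of_eraseRed x l hx)
    · exact (betaPos_eq_some.1 hb).2.extends (hstep ι h2 h3 p hb) hι
  · intro x l hx
    obtain ⟨β, h2, h3, h4, h5⟩ := (h.lim α h0 h1 hl x l).1 hx
    refine (hlazy.lim α h0 le_rfl hl x l).2 ⟨β, h2, h3, ?_, fun ι h6 h7 p hp => ?_⟩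
    · exact (ih β h3 h2 (h3.le.trans h1)).2 x l h4
    · exact h5 ι h6 h7 p (betaPos_eq_some.1 hp).1

/-- If root-active steps are cofinal, so are root-active `β`-steps: there are only finitely many
positions that erasing steps can remove from the strict part of the tree. -/
theorem Lazy.exists_betaPos (h : Lazy ((betaRed a).union (eraseRed a)) α₀ α₁ tree pos)
    (hl : Order.IsSuccLimit α₁)
    (hroot : ∀ β, α₀ ≤ β → β < α₁ → ∃ γ p, β ≤ γ ∧ γ < α₁ ∧ pos γ = some p ∧ cut a p = [])
    {β : Ordinal.{0}} (h0 : α₀ ≤ β) (h1 : β < α₁) :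
    ∃ γ p, β ≤ γ ∧ γ < α₁ ∧ betaPos tree pos γ = some p ∧ cut a p = [] := by
  by_contra hc
  push Not at hc
  have herase : ∀ ι, β ≤ ι → ι < α₁ → ∀ p, pos ι = some p → cut a p = [] →
      Step (eraseRed a) p (tree ι) (tree (ι + 1)) := by
    intro ι h2 h3 p hp hcut
    refine (step_union_iff.1 (h.step ι (h0.trans h2) h3 p hp)).resolve_left fun hs => ?_
    exact hc ι p h2 h3 (betaPos_eq_some.2 ⟨hp, hs⟩) hcut
  -- The positions of depth `0`, finitely many by guardedness. Without root-active `β`-steps this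
  -- set can only shrink, also at limits.
  let D : Ordinal.{0} → Set Pos := fun ι => {x | x ∈ (tree ι).dom ∧ cut a x = []}
  have hfin : ∀ ι, (D ι).Finite := fun ι =>
    (finite_depth_lt (tree ι).guarded 1).subset fun x hx => ⟨hx.1, by
      rw [← depth_cut, hx.2]; simp [depth]⟩
  have hanti : ∀ ι κ, β ≤ ι → ι ≤ κ → κ < α₁ → D κ ⊆ D ι := by
    intro ι κ hι hικ hκ
    induction κ using WellFoundedLT.induction with
    | _ κ ih =>
    rcases hικ.eq_or_lt with rfl | hικ
    · exact subset_rfl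
    rcases Ordinal.zero_or_succ_or_isSuccLimit κ with rfl | ⟨δ, rfl⟩ | hκl
    · exact absurd hικ not_lt_zero
    · have h2 : ι ≤ δ := Order.lt_succ_iff.1 hικ
      have h3 : δ < Order.succ δ := Order.lt_succ δ
      refine subset_trans ?_ (ih δ h3 h2 (h3.trans hκ))
      rintro x ⟨hx, hxc⟩
      refine ⟨?_, hxc⟩
      simp only [Order.succ_eq_add_one] at *
      rcases hp : pos δ with _ | p
      · rw [← h.idle δ (h0.trans (hι.trans h2)) (h3.trans hκ) hp]
        exact hx
      · by_cases hpc : cut a p = []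
        · exact (herase δ (hι.trans h2) (h3.trans hκ) p hp hpc).extends_of_eraseRed.mem hx
        · refine (mem_dom_congr
            ((h.step δ (h0.trans (hι.trans h2)) (h3.trans hκ) p hp).2 x fun hpx => hpc ?_)).2 hx
          have := cut_prefix_cut ((cut_prefix a p).trans hpx)
          rw [hxc] at this
          simpa using this
    · rintro x ⟨hx, hxc⟩
      obtain ⟨l, hl'⟩ := exists_lab hx
      obtain ⟨δ, h2, h3, h4, h5⟩ :=
        (h.lim κ ((h0.trans hι).trans_lt hικ) hκ.le hκl x l).1 hl'
      rcases le_total ι δ with h6 | h6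
      · exact ih δ h3 h6 (h3.trans hκ) ⟨mem_dom_of_eq_some h4, hxc⟩
      · refine ⟨mem_dom_of_eq_some (l := l) ?_, hxc⟩
        rw [← h4]
        exact h.lab_eq h2 h6 (hικ.le.trans hκ.le) (h5.mono le_rfl hικ.le)
  -- From an index where the cardinality is least, the next root-active erasure still removes its
  -- own position from the set.
  obtain ⟨n, ⟨ι, h2, h3, rfl⟩, hmin⟩ : ∃ n, (∃ ι, β ≤ ι ∧ ι < α₁ ∧ (D ι).ncard = n) ∧
      ∀ ι, β ≤ ι → ι < α₁ → n ≤ (D ι).ncard := by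
    classical
    have hex : ∃ n, ∃ ι, β ≤ ι ∧ ι < α₁ ∧ (D ι).ncard = n := ⟨_, β, le_rfl, h1, rfl⟩
    exact ⟨Nat.find hex, Nat.find_spec hex, fun ι h2 h3 => Nat.find_min' hex ⟨ι, h2, h3, rfl⟩⟩
  obtain ⟨κ, p, h4, h5, hp, hpc⟩ := hroot ι (h0.trans h2) h3
  have hs := herase κ (h2.trans h4) h5 p hp hpc
  have hκ : κ < Order.succ κ := Order.lt_succ κ
  have h6 := hmin (Order.succ κ) (h2.trans (h4.trans hκ.le)) (hl.succ_lt h5)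
  have h7 : D (Order.succ κ) ⊂ D κ := by
    refine ⟨hanti κ _ (h2.trans h4) hκ.le (hl.succ_lt h5), fun hsub => ?_⟩
    have hpm : p ∈ (tree κ).dom :=
      (h.step κ (h0.trans (h2.trans h4)) h5 p hp).mem_dom union_eraseRed_proper
    exact hs.not_mem_of_eraseRed (hsub ⟨hpm, hpc⟩).1
  have h8 := Set.ncard_lt_ncard h7 (hfin κ)
  have h9 := Set.ncard_le_ncard (hanti ι κ h2 h4 h5) (hfin ι)
  omega

/-- Filling by `Ω` is a `⊥`-instance, since `Ω` is itself total and fragile. -/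
theorem mem_botClosure_of_fragile_fill {t : GTree a V} (h : Fragile t.fill) :
    t ∈ botClosure (fragileTotal a) V := by
  refine ⟨t.fill, ⟨h, t.fill_total⟩, t.fill_total, fun p hp => ?_, fun p hp => ?_⟩
  · obtain ⟨l, hl⟩ := exists_lab hp
    rw [hl, t.extends_fill p l hl]
  · rw [GTree.subtree_fill _ hp]
    exact ⟨fragile_of_subtree_eq_omega (p := []) rfl GTree.subtree_nil_omega, omega_total⟩

/-- The simulation starting from the filled tree has cofinal root-active steps; without its idle
steps it is destructive. -/
theorem Lazy.mem_botClosure (h : Lazy ((betaRed a).union (eraseRed a)) α₀ α₁ tree pos)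
    (hl : Order.IsSuccLimit α₁) (h0 : α₀ < α₁)
    (hroot : ∀ β, α₀ ≤ β → β < α₁ → ∃ γ p, β ≤ γ ∧ γ < α₁ ∧ pos γ = some p ∧ cut a p = []) :
    tree α₀ ∈ botClosure (fragileTotal a) V := by
  obtain ⟨S, hS, hd⟩ := (h.simulate (tree α₀).extends_fill h0.le le_rfl).1.exists_reduction
    betaRed_proper hl h0 fun β h1 h2 => h.exists_betaPos hl hroot h1 h2
  rw [simulate_of_le le_rfl] at hS
  exact mem_botClosure_of_fragile_fill ⟨S, hS, hd⟩

theorem Lazy.subtree_mem_botClosure (h : Lazy ((betaRed a).union (eraseRed a)) α₀ α₁ tree pos)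
    (hl : Order.IsSuccLimit α₁) (h0 : α₀ < α₁) {q : Pos}
    (hqs : ∀ ι, α₀ ≤ ι → ι < α₁ → ∀ p, pos ι = some p → cut a p <+: q → cut a p = q)
    (hq : ∀ β, α₀ ≤ β → β < α₁ → ∃ γ p, β ≤ γ ∧ γ < α₁ ∧ pos γ = some p ∧ cut a p = q) :
    (tree α₀).subtree q ∈ botClosure (fragileTotal a) (V ⊕ Pos) := by
  have hcq : cut a q = q := by
    obtain ⟨γ, p, -, -, -, rfl⟩ := hq α₀ le_rfl h0
    exact cut_cut a p
  refine (h.subtree (fun _ _ f _ _ => union_eraseRed_map f) hcq hqs).mem_botClosure hl h0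
    fun β h1 h2 => ?_
  obtain ⟨γ, p, h3, h4, h5, h6⟩ := hq β h1 h2
  obtain ⟨r, rfl⟩ : q <+: p := h6 ▸ cut_prefix a p
  refine ⟨γ, r, h3, h4, subPos_eq_some.2 h5, ?_⟩
  rw [cut_append hcq] at h6
  simpa using h6

end LamCalc

/-! ### Metric convergence and concatenation of `m`-convergent reductions. -/

namespace LamCalc
open LamTree

variable {a : Sig} {V : Type u} {R : RewriteSystem.{u} a}

/-! Metric convergence -/

/-- `s` and `t` agree at all positions of depth less than `d`. -/
def AgreeBelow (d : ℕ) (s t : GTree a V) : Prop := ∀ x, depth a x < d → s.lab x = t.lab x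

theorem AgreeBelow.symm {d : ℕ} {s t : GTree a V} (h : AgreeBelow d s t) : AgreeBelow d t s :=
  fun x hx => (h x hx).symm

theorem AgreeBelow.trans {d : ℕ} {s t r : GTree a V} (h : AgreeBelow d s t)
    (h' : AgreeBelow d t r) : AgreeBelow d s r := fun x hx => (h x hx).trans (h' x hx)

theorem AgreeBelow.mono {d e : ℕ} {s t : GTree a V} (h : AgreeBelow d s t) (he : e ≤ d) :
    AgreeBelow e s t := fun x hx => h x (hx.trans_le he)

theorem AgreeBelow.mdist_le {d : ℕ} {s t : GTree a V} (h : AgreeBelow d s t) :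
    s.mdist t ≤ (1 / 2 : ℝ) ^ d := by
  rw [GTree.mdist]
  split_ifs with hst
  · positivity
  · have hne : {e | ∃ p, s.lab p ≠ t.lab p ∧ e = depth a p}.Nonempty := by
      by_contra hc
      refine hst (GTree.ext_lab fun p => ?_)
      by_contra hp
      exact hc ⟨_, p, hp, rfl⟩
    obtain ⟨p, hp, he⟩ := Nat.sInf_mem hne
    refine pow_le_pow_of_le_one (by norm_num) (by norm_num) ?_
    rw [he]
    by_contra hc
    exact hp (h p (not_le.1 hc))

theorem agreeBelow_of_mdist_lt {d : ℕ} {s t : GTree a V} (h : s.mdist t < (1 / 2 : ℝ) ^ d) :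
    AgreeBelow d s t := by
  intro x hx
  by_contra hne
  have hst : s ≠ t := fun e => hne (e ▸ rfl)
  rw [GTree.mdist, if_neg hst] at h
  have h1 : sInf {e | ∃ p, s.lab p ≠ t.lab p ∧ e = depth a p} ≤ depth a x :=
    Nat.sInf_le ⟨x, hne, rfl⟩
  have h2 : (1 / 2 : ℝ) ^ d ≤ (1 / 2 : ℝ) ^ sInf {e | ∃ p, s.lab p ≠ t.lab p ∧ e = depth a p} :=
    pow_le_pow_of_le_one (by norm_num) (by norm_num) (h1.trans hx.le)
  exact absurd h (not_lt.2 h2)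

/-- Distances are powers of `1/2`, so both requirements of `m`-convergence become one statement
about natural numbers. -/
theorem Reduction.mLimitAt_iff (S : Reduction R V) (γ : Ordinal.{0}) : S.MLimitAt γ ↔
    ∀ d : ℕ, ∃ β < γ, ∀ ι, β ≤ ι → ι < γ →
      AgreeBelow d (S.tree ι) (S.tree γ) ∧ d ≤ depth a (S.pos ι) := by
  constructor
  · rintro ⟨h1, h2⟩ d
    obtain ⟨β, hβ, h3⟩ := h1 ((1 / 2) ^ d) (by positivity)
    obtain ⟨β', hβ', h4⟩ := h2 d
    exact ⟨max β β', max_lt hβ hβ', fun ι hι hι' =>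
      ⟨agreeBelow_of_mdist_lt (h3 ι ((le_max_left _ _).trans hι) hι'),
        h4 ι ((le_max_right _ _).trans hι) hι'⟩⟩
  · intro h
    refine ⟨fun ε hε => ?_, fun d => ?_⟩
    · obtain ⟨d, hd⟩ := exists_pow_lt_of_lt_one hε (by norm_num : (1 / 2 : ℝ) < 1)
      obtain ⟨β, hβ, h1⟩ := h d
      exact ⟨β, hβ, fun ι h2 h3 => (h1 ι h2 h3).1.mdist_le.trans_lt hd⟩
    · obtain ⟨β, hβ, h1⟩ := h d
      exact ⟨β, hβ, fun ι h2 h3 => (h1 ι h2 h3).2⟩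

/-- `s` `m`-converges to `t` by a reduction whose steps have depth at least `d`. -/
def MRed (R : RewriteSystem.{u} a) (d : ℕ) (s t : GTree a V) : Prop :=
  ∃ S : Reduction R V, S.tree 0 = s ∧ S.tree S.len = t ∧ S.MConvergent ∧
    ∀ ι < S.len, d ≤ depth a (S.pos ι)

theorem MRed.mConvergesTo {d : ℕ} {s t : GTree a V} (h : MRed R d s t) : MConvergesTo R s t := by
  obtain ⟨S, h1, h2, h3, -⟩ := h
  exact ⟨S, h1, h2, h3⟩

theorem MRed.refl (d : ℕ) (t : GTree a V) : MRed R d t t :=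
  ⟨⟨0, fun _ => t, fun _ => [], fun _ h => absurd h not_lt_zero⟩, rfl, rfl,
    fun _ hγ hl => absurd (le_antisymm hγ zero_le ▸ isMin_bot) hl.1,
    fun _ h => absurd h not_lt_zero⟩

theorem MRed.single {d : ℕ} {p : Pos} {s t : GTree a V} (h : Step R p s t) (hd : d ≤ depth a p) :
    MRed R d s t := by
  classical
  refine ⟨⟨1, fun ι => if ι = 0 then s else t, fun _ => p, fun ι hι => ?_⟩, by simp, by simp,
    fun γ hγ hl => ?_, fun _ _ => hd⟩
  · obtain rfl := Order.lt_one_iff.1 hι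
    simpa using h
  · exact absurd (Ordinal.one_lt_of_isSuccLimit hl) (not_lt.2 hγ)

/-- All trees of an `m`-convergent reduction with steps of depth at least `d` agree below `d`. -/
theorem Reduction.agreeBelow {d : ℕ} (S : Reduction R V) (hS : S.MConvergent)
    (hd : ∀ ι < S.len, d ≤ depth a (S.pos ι)) (ι : Ordinal.{0}) (hι : ι ≤ S.len) :
    AgreeBelow d (S.tree 0) (S.tree ι) := by
  induction ι using Ordinal.limitRecOn with
  | zero => exact fun _ _ => rfl
  | add_one κ ih =>
    have hκ : κ < S.len := Order.add_one_le_iff.1 hι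
    refine (ih hκ.le).trans fun x hx => (S.step κ hκ).2 x fun hp => ?_
    exact absurd ((hd κ hκ).trans (depth_mono a hp)) (not_le.2 hx)
  | limit γ hγ ih =>
    obtain ⟨β, hβ, h⟩ := (S.mLimitAt_iff γ).1 (hS γ hι hγ) d
    exact (ih β hβ (hβ.le.trans hι)).trans (h β le_rfl hβ).1

/-- Concatenation of a sequence of `m`-convergent reductions. -/
theorem MRed.sequence {d₀ : ℕ} {u : ℕ → GTree a V} {t : GTree a V} {d : ℕ → ℕ}
    (h : ∀ n, MRed R (d n) (u n) (u (n + 1))) (hd₀ : ∀ n, d₀ ≤ d n)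
    (hd : ∀ e, ∃ N, ∀ n, N ≤ n → e ≤ d n)
    (ht : ∀ e, ∃ N, ∀ n, N ≤ n → AgreeBelow e (u n) t) : MRed R d₀ (u 0) t := by
  classical
  choose S hS0 hS1 hSm hSd using h
  obtain ⟨A, hA0, hA⟩ : ∃ A : ℕ → Ordinal.{0}, A 0 = 0 ∧ ∀ n, A (n + 1) = A n + (S n).len :=
    ⟨fun n => Nat.rec 0 (fun n α => α + (S n).len) n, rfl, fun _ => rfl⟩
  have hmono : Monotone A := monotone_nat_of_le_succ fun n => by rw [hA]; exact le_self_add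
  let Λ : Ordinal.{0} := ⨆ n, A n
  have hAΛ : ∀ n, A n ≤ Λ := Ordinal.le_iSup A
  have hlt : ∀ {ι}, ι < Λ → ∃ n, ι < A (n + 1) := by
    intro ι hι
    obtain ⟨n, hn⟩ := Ordinal.lt_iSup_iff.1 hι
    exact ⟨n, hn.trans_le (hmono (Nat.le_succ n))⟩
  -- Every `ι < Λ` lies in exactly one block `[A n, A (n + 1))`, found by `Nat.find`. From `Λ` on,
  -- the value is the limit `t`.
  let T : Ordinal.{0} → GTree a V := fun ι =>
    if h : ∃ n, ι < A (n + 1) then (S (Nat.find h)).tree (ι - A (Nat.find h)) else t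
  let P : Ordinal.{0} → Pos := fun ι =>
    if h : ∃ n, ι < A (n + 1) then (S (Nat.find h)).pos (ι - A (Nat.find h)) else []
  have hfind : ∀ {ι n}, A n ≤ ι → ∀ hι : ι < A (n + 1),
      Nat.find (⟨n, hι⟩ : ∃ n, ι < A (n + 1)) = n := by
    intro ι n h1 h2
    rw [Nat.find_eq_iff]
    exact ⟨h2, fun m hm h3 => absurd (h1.trans_lt h3) (not_lt.2 (hmono hm))⟩
  have hT : ∀ {ι n}, A n ≤ ι → ι < A (n + 1) → T ι = (S n).tree (ι - A n) := by
    intro ι n h1 h2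
    have hex : ∃ n, ι < A (n + 1) := ⟨n, h2⟩
    simp only [T, dif_pos hex]
    rw [hfind h1 h2]
  have hP : ∀ {ι n}, A n ≤ ι → ι < A (n + 1) → P ι = (S n).pos (ι - A n) := by
    intro ι n h1 h2
    have hex : ∃ n, ι < A (n + 1) := ⟨n, h2⟩
    simp only [P, dif_pos hex]
    rw [hfind h1 h2]
  have hex : ∀ {ι}, ι < Λ → ∃ n, A n ≤ ι ∧ ι < A (n + 1) := by
    intro ι hι
    refine ⟨Nat.find (hlt hι), ?_, Nat.find_spec (hlt hι)⟩
    rcases hn : Nat.find (hlt hι) with _ | n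
    · rw [hA0]; exact zero_le
    · exact not_lt.1 (Nat.find_min (hlt hι) (m := n) (by omega))
  -- Blocks may be empty, so different `n` can share the same starting point; the trees there then
  -- coincide.
  have hsame : ∀ {m n}, m ≤ n → A m = A n → u m = u n := by
    intro m n hmn
    induction n, hmn using Nat.le_induction with
    | base => exact fun _ => rfl
    | succ n hmn ih =>
      intro e
      have h1 : A m = A n := le_antisymm (hmono hmn) (e ▸ hmono (Nat.le_succ n))
      have h2 : (S n).len = 0 := by
        have : A n + (S n).len = A n + 0 := by rw [← hA, ← e, h1, add_zero]
        exact add_left_cancel this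
      rw [ih h1, ← hS0 n, ← hS1 n, h2]
  have hTA : ∀ n, T (A n) = u n := by
    intro n
    by_cases hn : A n < Λ
    · obtain ⟨m, h1, h2⟩ := hex hn
      have hnm : n ≤ m := by
        by_contra hc
        exact absurd h2 (not_lt.2 (hmono (by omega)))
      rw [hT h1 h2, le_antisymm h1 (hmono hnm), Ordinal.sub_self, hS0]
      exact (hsame hnm (le_antisymm (hmono hnm) h1)).symm
    -- All blocks from `n` on are empty, so `u` is constant from there on and equals its limit `t`.
    · have h1 : A n = Λ := le_antisymm (hAΛ n) (not_lt.1 hn)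
      have h2 : ¬ ∃ m, A n < A (m + 1) := by
        rintro ⟨m, hm⟩
        exact absurd (hm.trans_le (hAΛ _)) hn
      simp only [T, dif_neg h2]
      apply GTree.ext_lab
      intro x
      obtain ⟨N, hN⟩ := ht (depth a x + 1)
      rw [hsame (le_max_left n N) (le_antisymm (hmono (le_max_left n N)) (h1 ▸ hAΛ _))]
      exact (hN _ (le_max_right n N) x (Nat.lt_succ_self _)).symm
  have hT' : ∀ {ι n}, A n ≤ ι → ι ≤ A (n + 1) → T ι = (S n).tree (ι - A n) := by
    intro ι n h1 h2
    rcases h2.eq_or_lt with rfl | h2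
    · rw [hTA, hA, Ordinal.add_sub_cancel, hS1]
    · exact hT h1 h2
  have hsub : ∀ {ι n}, A n ≤ ι → ι < A (n + 1) → ι - A n < (S n).len := by
    intro ι n h1 h2
    rwa [Ordinal.sub_lt_of_le h1, ← hA]
  have hstep : ∀ ι < Λ, Step R (P ι) (T ι) (T (ι + 1)) := by
    intro ι hι
    obtain ⟨n, h1, h2⟩ := hex hι
    have h3 : A n ≤ ι + 1 := h1.trans (Order.lt_add_one_iff.2 le_rfl).le
    have h4 : ι + 1 - A n = ι - A n + 1 := by
      conv_lhs => rw [← Ordinal.add_sub_cancel_of_le h1, add_assoc, Ordinal.add_sub_cancel]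
    rw [hP h1 h2, hT h1 h2, hT' h3 (Order.add_one_le_of_lt h2), h4]
    exact (S n).step _ (hsub h1 h2)
  have hagree : ∀ {ι n}, A n ≤ ι → ι < A (n + 1) → AgreeBelow (d n) (u n) (T ι) := by
    intro ι n h1 h2
    rw [hT h1 h2, ← hS0 n]
    exact (S n).agreeBelow (hSm n) (hSd n) _ (hsub h1 h2).le
  refine ⟨⟨Λ, T, P, hstep⟩, ?_, ?_, fun γ hγ hl => ?_, fun ι hι => ?_⟩
  · rw [← hTA 0, hA0]
  · have h2 : ¬ ∃ m, Λ < A (m + 1) := by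
      rintro ⟨m, hm⟩
      exact absurd hm (not_lt.2 (hAΛ _))
    simp only [T, dif_neg h2]
  · rw [Reduction.mLimitAt_iff]
    intro e
    change ∃ β < γ, ∀ ι, β ≤ ι → ι < γ → AgreeBelow e (T ι) (T γ) ∧ e ≤ depth a (P ι)
    by_cases hc : ∃ n, γ ≤ A n
    · obtain ⟨n, h1, h2⟩ : ∃ n, A n < γ ∧ γ ≤ A (n + 1) := by
        rcases hn : Nat.find hc with _ | n
        · have := Nat.find_spec hc
          rw [hn, hA0] at this
          exact absurd (le_antisymm this zero_le ▸ isMin_bot) hl.1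
        · refine ⟨n, not_le.1 (Nat.find_min hc (m := n) (by omega)), ?_⟩
          have := Nat.find_spec hc
          rwa [hn] at this
      have h3 : γ - A n ≤ (S n).len := by
        rw [Ordinal.sub_le, ← hA]
        exact h2
      obtain ⟨β, hβ, h4⟩ := ((S n).mLimitAt_iff _).1
        (hSm n _ h3 (Ordinal.isSuccLimit_sub hl.isSuccPrelimit h1)) e
      refine ⟨A n + β, Ordinal.lt_sub.1 hβ, fun ι h5 h6 => ?_⟩
      have h7 : A n ≤ ι := le_self_add.trans h5
      have h8 : ι - A n < γ - A n := by
        rw [Ordinal.lt_sub, Ordinal.add_sub_cancel_of_le h7]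
        exact h6
      have h9 : β ≤ ι - A n := (Ordinal.le_sub_of_le h7).2 h5
      rw [hT h7 (h6.trans_le h2), hP h7 (h6.trans_le h2), hT' h1.le h2]
      exact h4 _ h9 h8
    · push Not at hc
      have h1 : γ = Λ := le_antisymm hγ (Ordinal.iSup_le fun n => (hc n).le)
      have h2 : T γ = t := by
        have : ¬ ∃ m, γ < A (m + 1) := by
          rintro ⟨m, hm⟩
          exact absurd hm (not_lt.2 (hc _).le)
        simp only [T, dif_neg this]
      obtain ⟨N, hN⟩ := hd e
      obtain ⟨M, hM⟩ := ht e
      refine ⟨A (max N M), hc _, fun ι h3 h4 => ?_⟩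
      obtain ⟨n, h5, h6⟩ := hex (h4.trans_le hγ)
      have hn : max N M ≤ n := by
        by_contra hc'
        exact absurd (h6.trans_le (hmono (by omega : n + 1 ≤ max N M))) (not_lt.2 h3)
      have h7 := hN n ((le_max_left _ _).trans hn)
      rw [h2]
      refine ⟨((hagree h5 h6).mono h7).symm.trans (hM n ((le_max_right _ _).trans hn)), ?_⟩
      rw [hP h5 h6]
      exact h7.trans (hSd n _ (hsub h5 h6))
  · obtain ⟨n, h1, h2⟩ := hex hι
    change d₀ ≤ depth a (P ι)
    rw [hP h1 h2]
    exact (hd₀ n).trans (hSd n _ (hsub h1 h2))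

theorem MRed.trans {d : ℕ} {s t r : GTree a V} (h : MRed R d s t) (h' : MRed R d t r) :
    MRed R d s r := by
  let u : ℕ → GTree a V := fun n => if n = 0 then s else if n = 1 then t else r
  -- The sequence is continued by `r` forever. The reductions after the second are empty, so their
  -- depth bounds can be chosen to grow.
  have := MRed.sequence (R := R) (d₀ := d) (u := u) (t := r)
    (d := fun n => if n < 2 then d else max d n) (fun n => ?_) (fun n => ?_) (fun e => ?_)
    fun e => ?_
  · simpa [u] using this
  · match n with
    | 0 => simpa [u] using h
    | 1 => simpa [u] using h'
    | n + 2 => simpa [u] using MRed.refl _ r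
  · split_ifs
    · exact le_rfl
    · exact le_max_left _ _
  · refine ⟨e + 2, fun n hn => ?_⟩
    rw [if_neg (by omega)]
    exact (by omega : e ≤ n).trans (le_max_right _ _)
  · refine ⟨2, fun n hn => ?_⟩
    have : u n = r := by simp [u, show n ≠ 0 by omega, show n ≠ 1 by omega]
    rw [this]
    exact fun _ _ => rfl

end LamCalc

/-! ### Inclusion of the strictness rules, truncation at volatile positions, and the main induction.
-/

namespace LamCalc
open LamTree

variable {a : Sig} {V : Type u}

/-! Comparison of the rewrite systems -/

/-- Once the holes are filled, `Ω` sits at the strict position `[i]`, whose cut is the root. -/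
theorem mem_botClosure_of_strict {t : GTree a V} {i : Fin 3} (hi : a i = false)
    (h : t.BotPos [i]) : t ∈ botClosure (fragileTotal a) V :=
  mem_botClosure_of_fragile_fill
    (fragile_of_subtree_eq_omega (cut_concat_strict hi []) (GTree.subtree_fill _ h))

/-- The left-hand side of a strictness rule is not `⊥` but has a hole at a strict child of the root.
-/
theorem bohmRed_of_betaStrictRed (V : Type u) (l r : GTree a V) (h : betaStrictRed a V l r) :
    bohmRed (fragileTotal a) V l r := by
  rcases h with h | ⟨hr, h⟩
  · exact Or.inl h
  right
  rcases h with ⟨t₁, t₂, hl, h⟩ | ⟨hl, ha⟩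
  · have hne : l ≠ GTree.bot := by
      rintro rfl
      have := congrArg (fun t : LamTree V => t.lab []) hl
      simp [GTree.bot, LamTree.bot] at this
    refine ⟨⟨?_, hne⟩, hr⟩
    rcases h with ⟨rfl, ha⟩ | ⟨rfl, ha⟩
    · refine mem_botClosure_of_strict ha ?_
      rw [hl]
      exact .left [] rfl (by simp [LamTree.mem_dom, GTree.bot, LamTree.bot])
    · refine mem_botClosure_of_strict ha ?_
      rw [hl]
      exact .right [] rfl (by simp [LamTree.mem_dom, GTree.bot, LamTree.bot])
  · have hne : l ≠ GTree.bot := by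
      rintro rfl
      have := congrArg (fun t : LamTree V => t.lab []) hl
      simp [GTree.bot, LamTree.bot] at this
    refine ⟨⟨mem_botClosure_of_strict ha ?_, hne⟩, hr⟩
    rw [hl]
    exact .body [] rfl (by simp [LamTree.mem_dom, LamTree.bot])

theorem union_eraseRed_of_bohmRed (V : Type u) (l r : GTree a V)
    (h : bohmRed (fragileTotal a) V l r) : (betaRed a).union (eraseRed a) V l r := by
  rcases h with h | ⟨⟨-, h1⟩, h2⟩
  · exact Or.inl h
  · exact Or.inr ⟨by_contra fun h3 => h1 (GTree.eq_bot_of_nil_not_mem h3), h2⟩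

theorem betaStrictRed_proper : (betaStrictRed.{u} a).Proper := fun V l r h =>
  union_eraseRed_proper V l r (union_eraseRed_of_bohmRed V l r (bohmRed_of_betaStrictRed V l r h))

theorem bohmRed_proper : (bohmRed.{u} (fragileTotal a)).Proper := fun V l r h =>
  union_eraseRed_proper V l r (union_eraseRed_of_bohmRed V l r h)

/-! Truncation of trees -/

/-- The tree `t` with the subtrees at the positions in `Q` erased. -/
noncomputable def GTree.trunc (Q : Set Pos) (t : GTree a V) : GTree a V :=
  t.restrict {x | ∀ q ∈ Q, ¬ q <+: x} fun _ _ h hy q hq hqx => hy q hq (hqx.trans h)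

theorem GTree.mem_dom_trunc {Q : Set Pos} {t : GTree a V} {x : Pos} :
    x ∈ (t.trunc Q).dom ↔ (∀ q ∈ Q, ¬ q <+: x) ∧ x ∈ t.dom := GTree.mem_dom_restrict

theorem GTree.trunc_lab {Q : Set Pos} {t : GTree a V} {x : Pos} (h : ∀ q ∈ Q, ¬ q <+: x) :
    (t.trunc Q).lab x = t.lab x := GTree.restrict_lab (A := {x | ∀ q ∈ Q, ¬ q <+: x}) h

theorem GTree.trunc_lab_of_prefix {Q : Set Pos} {t : GTree a V} {x q : Pos} (hq : q ∈ Q)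
    (h : q <+: x) : (t.trunc Q).lab x = none := by
  by_contra hc
  exact (GTree.mem_dom_trunc.1 hc).1 q hq h

theorem GTree.trunc_lab_eq_some {Q : Set Pos} {t : GTree a V} {x : Pos} {l : Label V} :
    (t.trunc Q).lab x = some l ↔ (∀ q ∈ Q, ¬ q <+: x) ∧ t.lab x = some l := by
  by_cases h : ∀ q ∈ Q, ¬ q <+: x
  · rw [GTree.trunc_lab h]
    exact (and_iff_right h).symm
  · refine iff_of_false (fun hc => ?_) fun hc => h hc.1
    exact h (GTree.mem_dom_trunc.1 (mem_dom_of_eq_some hc)).1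

open Classical in
/-- The steps that are not below a position in `Q`. -/
noncomputable def truncPos (Q : Set Pos) (pos : Ordinal.{0} → Option Pos) (ι : Ordinal.{0}) :
    Option Pos :=
  (pos ι).filter fun p => ∀ q ∈ Q, ¬ q <+: p

theorem truncPos_eq_some {Q : Set Pos} {pos : Ordinal.{0} → Option Pos} {ι : Ordinal.{0}}
    {p : Pos} : truncPos Q pos ι = some p ↔ pos ι = some p ∧ ∀ q ∈ Q, ¬ q <+: p := by
  simp [truncPos, Option.filter_eq_some_iff]

/-- By `hpos` no step is properly above a truncated position, so a step is either lost entirely or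
leaves its redex intact. A lost step lies below some `q` in `Q`; as `q` is non-strict, so does its
cut, and it affects no surviving position. -/
theorem Lazy.trunc {R : RewriteSystem.{u} a} {α₀ α₁ : Ordinal.{0}}
    {tree : Ordinal.{0} → GTree a V} {pos : Ordinal.{0} → Option Pos}
    (h : Lazy R α₀ α₁ tree pos) {Q : Set Pos} (hQ : ∀ q ∈ Q, cut a q = q)
    (hpos : ∀ ι, α₀ ≤ ι → ι < α₁ → ∀ p, pos ι = some p → ∀ q ∈ Q, p <+: q → q <+: p) :
    Lazy R α₀ α₁ (fun ι => (tree ι).trunc Q) (truncPos Q pos) := by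
  refine ⟨fun ι h0 h1 p hp => ?_, fun ι h0 h1 hp => ?_, fun γ h0 h1 hγ x l => ?_⟩
  · obtain ⟨hp, hpQ⟩ := truncPos_eq_some.1 hp
    have hs := h.step ι h0 h1 p hp
    have e : ∀ t : GTree a V, (t.trunc Q).subtree p = t.subtree p := by
      intro t
      apply GTree.ext_lab
      intro y
      rw [GTree.subtree_toLamTree, GTree.subtree_toLamTree, subtree_lab, subtree_lab,
        GTree.trunc_lab]
      intro q hq hqy
      rcases prefix_total hqy (List.prefix_append p y) with h2 | h2
      · exact hpQ q hq h2
      · exact hpQ q hq (hpos ι h0 h1 p hp q hq h2)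
    refine ⟨by rw [e, e]; exact hs.1, fun x hx => ?_⟩
    by_cases hxQ : ∀ q ∈ Q, ¬ q <+: x
    · rw [GTree.trunc_lab hxQ, GTree.trunc_lab hxQ]
      exact hs.2 x hx
    · push Not at hxQ
      obtain ⟨q, hq, hqx⟩ := hxQ
      rw [GTree.trunc_lab_of_prefix hq hqx, GTree.trunc_lab_of_prefix hq hqx]
  · apply GTree.ext_lab
    intro x
    by_cases hxQ : ∀ q ∈ Q, ¬ q <+: x
    · rw [GTree.trunc_lab hxQ, GTree.trunc_lab hxQ]
      rcases hp' : pos ι with _ | p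
      · rw [h.idle ι h0 h1 hp']
      · refine ((h.step ι h0 h1 p hp').2 x fun hpx => ?_).symm
        rw [truncPos_eq_some.2 ⟨hp', fun q hq hqp => hxQ q hq (hqp.trans hpx)⟩] at hp
        simp at hp
    · push Not at hxQ
      obtain ⟨q, hq, hqx⟩ := hxQ
      rw [GTree.trunc_lab_of_prefix hq hqx, GTree.trunc_lab_of_prefix hq hqx]
  · simp only [GTree.trunc_lab_eq_some]
    rw [h.lim γ h0 h1 hγ x l]
    constructor
    · rintro ⟨hx, β, h2, h3, h4, h5⟩
      exact ⟨β, h2, h3, ⟨hx, h4⟩, fun ι h6 h7 p hp => h5 ι h6 h7 p (truncPos_eq_some.1 hp).1⟩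
    · rintro ⟨β, h2, h3, ⟨hx, h4⟩, h5⟩
      refine ⟨hx, β, h2, h3, h4, fun ι h6 h7 p hp hpx => ?_⟩
      refine h5 ι h6 h7 p (truncPos_eq_some.2 ⟨hp, fun q hq hqp => hx q hq ?_⟩) hpx
      have := cut_prefix_cut (p := q) (x := p) (by rw [hQ q hq]; exact hqp)
      rw [hQ q hq] at this
      exact this.trans hpx

/-- Erasing finitely many subtrees by steps to `⊥`. -/
theorem mRed_trunc_union {d : ℕ} {t : GTree a V} {Q F : Set Pos} (hF : F.Finite)
    (hd : ∀ q ∈ F, d ≤ depth a q)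
    (hclosure : ∀ q ∈ F, t.subtree q ∈ botClosure (fragileTotal a) (V ⊕ Pos))
    (hinc : ∀ q ∈ Q ∪ F, ∀ q' ∈ Q ∪ F, q <+: q' → q = q') :
    MRed (bohmRed (fragileTotal a)) d (t.trunc Q) (t.trunc (Q ∪ F)) := by
  induction F, hF using Set.Finite.induction_on with
  | empty => rw [Set.union_empty]; exact MRed.refl _ _
  | @insert q F hq _ ih =>
    have hsub : Q ∪ F ⊆ Q ∪ insert q F := Set.union_subset_union_right Q (Set.subset_insert q F)
    have hqm : q ∈ Q ∪ insert q F := Or.inr (Set.mem_insert q F)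
    refine (ih (fun x hx => hd x (Or.inr hx)) (fun x hx => hclosure x (Or.inr hx))
      fun x hx y hy => hinc x (hsub hx) y (hsub hy)).trans ?_
    have hsame : ∀ x, ¬ q <+: x → (t.trunc (Q ∪ F)).lab x = (t.trunc (Q ∪ insert q F)).lab x := by
      intro x hx
      by_cases hxQ : ∀ y ∈ Q ∪ F, ¬ y <+: x
      · rw [GTree.trunc_lab hxQ, GTree.trunc_lab]
        rintro y (hy | rfl | hy)
        · exact hxQ y (Or.inl hy)
        · exact hx
        · exact hxQ y (Or.inr hy)
      · push Not at hxQ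
        obtain ⟨y, hy, hyx⟩ := hxQ
        rw [GTree.trunc_lab_of_prefix hy hyx, GTree.trunc_lab_of_prefix (hsub hy) hyx]
    by_cases hqd : q ∈ (t.trunc (Q ∪ F)).dom
    · refine MRed.single (p := q) ⟨Or.inr ⟨⟨?_, ?_⟩, ?_⟩, hsame⟩ (hd q (Set.mem_insert q F))
      · have : (t.trunc (Q ∪ F)).subtree q = t.subtree q := by
          apply GTree.ext_lab
          intro y
          rw [GTree.subtree_toLamTree, GTree.subtree_toLamTree, subtree_lab, subtree_lab,
            GTree.trunc_lab]
          intro z hz hzy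
          have hzq : z = q := by
            rcases prefix_total hzy (List.prefix_append q y) with h2 | h2
            · exact hinc z (hsub hz) q hqm h2
            · exact (hinc q hqm z (hsub hz) h2).symm
          exact (GTree.mem_dom_trunc.1 hqd).1 z hz (hzq ▸ List.prefix_rfl)
        rw [this]
        exact hclosure q (Set.mem_insert q F)
      · intro e
        have h1 : [] ∈ ((t.trunc (Q ∪ F)).subtree q).dom := by
          rw [GTree.subtree_toLamTree, mem_dom_subtree, List.append_nil]
          exact hqd
        rw [Set.mem_singleton_iff.1 e] at h1
        simp [GTree.bot, LamTree.bot, LamTree.mem_dom] at h1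
      · apply GTree.eq_bot_of_nil_not_mem
        rw [GTree.subtree_toLamTree, mem_dom_subtree, List.append_nil]
        exact fun hc => (GTree.mem_dom_trunc.1 hc).1 q hqm List.prefix_rfl
    -- If nothing is left at `q`, no step is needed; the rules to `⊥` exclude the left-hand side
    -- `⊥`.
    · have e : t.trunc (Q ∪ F) = t.trunc (Q ∪ insert q F) := by
        apply GTree.ext_lab
        intro x
        by_cases hx : q <+: x
        · rw [GTree.trunc_lab_of_prefix hqm hx]
          by_contra hc
          exact hqd (mem_dom_of_prefix hx hc)
        · exact hsame x hx
      rw [e]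
      exact MRed.refl _ _

/-! From `p`-convergence to `m`-convergence -/

/-- Finitely many properties that hold eventually below `γ` hold eventually simultaneously. -/
theorem exists_forall_of_finite {γ : Ordinal.{0}} (hγ : 0 < γ) {F : Set Pos} (hF : F.Finite)
    {P : Pos → Ordinal.{0} → Prop}
    (h : ∀ x ∈ F, ∃ β < γ, ∀ ι, β ≤ ι → ι < γ → P x ι) :
    ∃ β < γ, ∀ x ∈ F, ∀ ι, β ≤ ι → ι < γ → P x ι := by
  induction F, hF using Set.Finite.induction_on with
  | empty => exact ⟨0, hγ, by simp⟩
  | @insert q F hq _ ih =>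
    obtain ⟨β, hβ, h1⟩ := ih fun x hx => h x (Or.inr hx)
    obtain ⟨β', hβ', h2⟩ := h q (Set.mem_insert q F)
    refine ⟨max β β', max_lt hβ hβ', ?_⟩
    rintro x (rfl | hx) ι h3 h4
    · exact h2 ι ((le_max_right _ _).trans h3) h4
    · exact h1 x hx ι ((le_max_left _ _).trans h3) h4

variable {α₀ γ : Ordinal.{0}} {tree : Ordinal.{0} → GTree a V} {pos : Ordinal.{0} → Option Pos}

/-- Steps with the non-strict part `q` occur cofinally below `γ`. -/
def CofinalAt (a : Sig) (pos : Ordinal.{0} → Option Pos) (γ : Ordinal.{0}) (q : Pos) : Prop :=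
  ∀ β < γ, ∃ ι p, β ≤ ι ∧ ι < γ ∧ pos ι = some p ∧ cut a p = q

/-- The positions of depth less than `n` that are in the domain of `t` or are minimal outside. -/
def frontier (n : ℕ) (t : GTree a V) : Set Pos :=
  {x | depth a x < n ∧ (x ∈ t.dom ∨ x = [] ∨ ∃ y i, x = y ++ [i] ∧ y ∈ t.dom)}

theorem frontier_finite (n : ℕ) (t : GTree a V) : (frontier n t).Finite := by
  have h := finite_depth_lt t.guarded n
  refine ((h.union (Set.finite_singleton [])).union
    (Set.finite_iUnion fun i : Fin 3 => h.image fun y => y ++ [i])).subset ?_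
  rintro x ⟨hd, hx | hx | ⟨y, i, rfl, hy⟩⟩
  · exact Or.inl (Or.inl ⟨hx, hd⟩)
  · exact Or.inl (Or.inr hx)
  · refine Or.inr (Set.mem_iUnion.2 ⟨i, y, ⟨hy, ?_⟩, rfl⟩)
    exact (depth_mono a (List.prefix_append y [i])).trans_lt hd

/-- The minimal positions outside the domain of the tree at `γ` with depth less than `n` at which
steps occur cofinally. -/
def volatileSet (n : ℕ) (γ : Ordinal.{0}) (tree : Ordinal.{0} → GTree a V)
    (pos : Ordinal.{0} → Option Pos) : Set Pos :=
  {q | q ∈ frontier n (tree γ) ∧ q ∉ (tree γ).dom ∧ CofinalAt a pos γ q}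

/-- The reduction is stable from the index `ι` on at the position `x`. -/
def StableAt (tree : Ordinal.{0} → GTree a V) (pos : Ordinal.{0} → Option Pos) (γ : Ordinal.{0})
    (x : Pos) (ι : Ordinal.{0}) : Prop :=
  (x ∈ (tree γ).dom → (tree ι).lab x = (tree γ).lab x ∧ ∀ p, pos ι = some p → ¬ cut a p <+: x) ∧
  (¬ CofinalAt a pos γ x → ∀ p, pos ι = some p → cut a p ≠ x)

variable {R : RewriteSystem.{u} a}

/-- At each single position stability holds eventually, and the frontier is finite. -/
theorem Lazy.exists_stable (h : Lazy R α₀ γ tree pos) (h0 : α₀ < γ) (hγ : Order.IsSuccLimit γ)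
    (n : ℕ) : ∃ β < γ, ∀ x ∈ frontier n (tree γ), ∀ ι, β ≤ ι → ι < γ →
      StableAt tree pos γ x ι := by
  refine exists_forall_of_finite (zero_le.trans_lt h0) (frontier_finite n _) fun x _ => ?_
  obtain ⟨β₁, hβ₁, h1⟩ : ∃ β < γ, ∀ ι, β ≤ ι → ι < γ → (x ∈ (tree γ).dom →
      (tree ι).lab x = (tree γ).lab x ∧ ∀ p, pos ι = some p → ¬ cut a p <+: x) := by
    by_cases hx : x ∈ (tree γ).dom
    · obtain ⟨l, hl⟩ := exists_lab hx
      obtain ⟨β, h2, h3, h4, h5⟩ := (h.lim γ h0 le_rfl hγ x l).1 hl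
      refine ⟨β, h3, fun ι h6 h7 _ => ⟨?_, h5 ι h6 h7⟩⟩
      rw [h.lab_eq h2 h6 h7.le (h5.mono le_rfl h7.le), h4, hl]
    · exact ⟨α₀, h0, fun _ _ _ hc => absurd hc hx⟩
  obtain ⟨β₂, hβ₂, h2⟩ : ∃ β < γ, ∀ ι, β ≤ ι → ι < γ → (¬ CofinalAt a pos γ x →
      ∀ p, pos ι = some p → cut a p ≠ x) := by
    by_cases hx : CofinalAt a pos γ x
    · exact ⟨α₀, h0, fun _ _ _ hc => absurd hx hc⟩
    · simp only [CofinalAt] at hx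
      push Not at hx
      obtain ⟨β, hβ, h3⟩ := hx
      exact ⟨β, hβ, fun ι h4 h5 _ p hp => h3 ι p h4 h5 hp⟩
  exact ⟨max β₁ β₂, max_lt hβ₁ hβ₂, fun ι h3 h4 =>
    ⟨h1 ι ((le_max_left _ _).trans h3) h4, h2 ι ((le_max_right _ _).trans h3) h4⟩⟩

theorem mem_frontier_of_prefix {n : ℕ} {t : GTree a V} {x y : Pos} (h : y <+: x)
    (hx : x ∈ frontier n t) (hy : y ∈ t.dom) : y ∈ frontier n t :=
  ⟨(depth_mono a h).trans_lt hx.1, Or.inl hy⟩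

/-- From a stable index on, low positions outside the domain of the limit are below a volatile
position. -/
theorem Lazy.exists_volatile_prefix (h : Lazy R α₀ γ tree pos) (h0 : α₀ < γ)
    (hγ : Order.IsSuccLimit γ) {n : ℕ} {β : Ordinal.{0}} (hβ0 : α₀ ≤ β)
    (hst : ∀ x ∈ frontier n (tree γ), ∀ ι, β ≤ ι → ι < γ → StableAt tree pos γ x ι)
    {ι : Ordinal.{0}} (h1 : β ≤ ι) (h2 : ι < γ) {x : Pos} (hx : x ∈ (tree ι).dom)
    (hxd : depth a x < n) (hxγ : x ∉ (tree γ).dom) : ∃ q ∈ volatileSet n γ tree pos, q <+: x := by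
  obtain ⟨q, hqx, hq, hq'⟩ := (tree γ).exists_minimal_not_mem_dom hxγ
  have hqF : q ∈ frontier n (tree γ) := ⟨(depth_mono a hqx).trans_lt hxd, Or.inr hq'⟩
  refine ⟨q, ⟨hqF, hq, ?_⟩, hqx⟩
  by_contra hc
  obtain ⟨l, hl⟩ := exists_lab (mem_dom_of_prefix hqx hx)
  refine hq (mem_dom_of_eq_some (l := l) ?_)
  -- If steps at `q` are not cofinal, stability at `q` and at its parent, which is in the limit,
  -- makes `q` quiet from `ι` on. Its label would then survive into the limit.
  refine (h.lim γ h0 le_rfl hγ q l).2 ⟨ι, hβ0.trans h1, h2, hl, fun κ h3 h4 p hp hpq => ?_⟩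
  have hne := (hst q hqF κ (h1.trans h3) h4).2 hc p hp
  rcases hq' with rfl | ⟨y, i, rfl, hy⟩
  · exact hne (List.prefix_nil.1 hpq)
  · rcases List.prefix_concat_iff.1 hpq with e | hpy
    · exact hne e
    · exact ((hst y (mem_frontier_of_prefix (List.prefix_append _ _) hqF hy) κ
        (h1.trans h3) h4).1 hy).2 p hp hpy

/-- Volatile positions are minimal outside the domain of the limit, hence pairwise incomparable. -/
theorem prefix_eq_of_volatile {n : ℕ} {q q' : Pos} (hq : q ∈ volatileSet n γ tree pos)
    (hq' : q' ∈ volatileSet n γ tree pos) (h : q <+: q') : q = q' := by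
  rcases hq'.1.2 with h1 | rfl | ⟨y, i, rfl, hy⟩
  · exact absurd h1 hq'.2.1
  · exact List.prefix_nil.1 h
  · rcases List.prefix_concat_iff.1 h with e | h2
    · exact e
    · exact absurd (mem_dom_of_prefix h2 hy) hq.2.1

/-- From a stable index on, no step is properly above a volatile position. -/
theorem cut_eq_of_volatile {n : ℕ} {β : Ordinal.{0}}
    (hst : ∀ x ∈ frontier n (tree γ), ∀ ι, β ≤ ι → ι < γ → StableAt tree pos γ x ι)
    {ι : Ordinal.{0}} (h1 : β ≤ ι) (h2 : ι < γ) {p q : Pos} (hp : pos ι = some p)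
    (hq : q ∈ volatileSet n γ tree pos) (h : cut a p <+: q) : cut a p = q := by
  rcases hq.1.2 with h3 | rfl | ⟨y, i, rfl, hy⟩
  · exact absurd h3 hq.2.1
  · exact List.prefix_nil.1 h
  · rcases List.prefix_concat_iff.1 h with e | h3
    · exact e
    · exact absurd h3 (((hst y (mem_frontier_of_prefix (List.prefix_append _ _) hq.1 hy) ι
        h1 h2).1 hy).2 p hp)

/-- A `p`-convergent reduction with idle steps can be turned into an `m`-convergent one. -/
theorem Lazy.mRed {α₁ : Ordinal.{0}}
    (h : Lazy (bohmRed (fragileTotal a)) α₀ α₁ tree pos) (h01 : α₀ ≤ α₁) {d : ℕ}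
    (hd : ∀ ι, α₀ ≤ ι → ι < α₁ → ∀ p, pos ι = some p → d ≤ depth a p) :
    MRed (bohmRed (fragileTotal a)) d (tree α₀) (tree α₁) := by
  -- The induction hypothesis is applied to truncated reductions with a later start and a larger
  -- depth bound.
  induction α₁ using WellFoundedLT.induction generalizing α₀ tree pos d with
  | _ γ ih =>
  rcases h01.eq_or_lt with rfl | h0
  · exact MRed.refl _ _
  rcases Ordinal.zero_or_succ_or_isSuccLimit γ with rfl | ⟨ι, rfl⟩ | hγ
  · exact absurd h0 not_lt_zero
  · have h1 : α₀ ≤ ι := Order.lt_succ_iff.1 h0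
    have h2 : ι < Order.succ ι := Order.lt_succ ι
    have h3 := ih ι h2 (h.mono h2.le) h1 fun κ h4 h5 => hd κ h4 (h5.trans h2)
    simp only [Order.succ_eq_add_one] at *
    rcases hp : pos ι with _ | p
    · rwa [h.idle ι h1 h2 hp]
    · exact h3.trans (MRed.single (h.step ι h1 h2 p hp) (hd ι h1 h2 p hp))
  -- The `b n` are made nondecreasing. The resulting indices need not be cofinal in `γ`: it suffices
  -- that the truncated tree at `B n` agrees with the limit below depth `n`.
  choose b hb hstab using h.exists_stable h0 hγ
  obtain ⟨B, hB0, hB⟩ : ∃ B : ℕ → Ordinal.{0}, B 0 = α₀ ∧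
      ∀ n, B (n + 1) = max (B n) (b (n + 1)) :=
    ⟨fun n => Nat.rec α₀ (fun n β => max β (b (n + 1))) n, rfl, fun _ => rfl⟩
  have hBm : ∀ n, B n ≤ B (n + 1) := fun n => by rw [hB]; exact le_max_left _ _
  have hBα : ∀ n, α₀ ≤ B n := fun n => by
    induction n with
    | zero => exact hB0.ge
    | succ n ih => exact ih.trans (hBm n)
  have hBγ : ∀ n, B n < γ := fun n => by
    induction n with
    | zero => rwa [hB0]
    | succ n ih => rw [hB]; exact max_lt ih (hb _)
  have hst : ∀ n, ∀ x ∈ frontier n (tree γ), ∀ ι, B n ≤ ι → ι < γ →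
      StableAt tree pos γ x ι := by
    intro n x hx ι h1 h2
    match n with
    | 0 => exact absurd hx.1 (Nat.not_lt_zero _)
    | n + 1 =>
      refine hstab (n + 1) x hx ι ?_ h2
      rw [hB] at h1
      exact (le_max_right _ _).trans h1
  let Q : ℕ → Set Pos := fun n => volatileSet n γ tree pos
  have hQcut : ∀ n, ∀ q ∈ Q n, cut a q = q ∧ d ≤ depth a q := by
    intro n q hq
    obtain ⟨ι, p, h1, h2, h3, rfl⟩ := hq.2.2 α₀ h0
    exact ⟨cut_cut a p, by rw [depth_cut]; exact hd ι h1 h2 p h3⟩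
  have hQsub : ∀ n, Q n ⊆ Q (n + 1) := fun n q hq =>
    ⟨⟨hq.1.1.trans (Nat.lt_succ_self n), hq.1.2⟩, hq.2⟩
  have hQnew : ∀ n, ∀ q ∈ Q (n + 1) \ Q n, n ≤ depth a q := by
    intro n q hq
    by_contra hc
    exact hq.2 ⟨⟨not_le.1 hc, hq.1.1.2⟩, hq.1.2⟩
  -- From `B n` on, steps with cut `q` are cofinal and no step has a cut properly above `q`, so the
  -- subtree at `q` undergoes a reduction with cofinal root-active steps.
  have hfrag : ∀ n, ∀ q ∈ Q n,
      (tree (B n)).subtree q ∈ botClosure (fragileTotal a) (V ⊕ Pos) := by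
    intro n q hq
    refine ((h.tail (hBα n)).imp union_eraseRed_of_bohmRed).subtree_mem_botClosure hγ (hBγ n)
      (fun ι h1 h2 p hp hc => cut_eq_of_volatile (hst n) h1 h2 hp hq hc) fun β _ hβ => ?_
    exact hq.2.2 β hβ
  have hstep : ∀ n, MRed (bohmRed (fragileTotal a)) (max d n) ((tree (B n)).trunc (Q n))
      ((tree (B (n + 1))).trunc (Q (n + 1))) := by
    intro n
    have hlazy := ((h.tail (hBα n)).mono (hBγ (n + 1)).le).trunc (Q := Q n)
      (fun q hq => (hQcut n q hq).1) fun ι h1 h2 p hp q hq hpq => by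
        have := cut_eq_of_volatile (hst n) h1 (h2.trans (hBγ _)) hp hq ((cut_prefix a p).trans hpq)
        exact this ▸ cut_prefix a p
    have h1 := ih (B (n + 1)) (hBγ (n + 1)) hlazy (hBm n) (d := max d n)
      fun ι h1 h2 p hp => by
        obtain ⟨hp, hpQ⟩ := truncPos_eq_some.1 hp
        -- A remaining step of depth less than `n` would either affect a settled position of the
        -- limit or lie below a volatile position, where it was truncated.
        refine max_le (hd ι ((hBα n).trans h1) (h2.trans (hBγ _)) p hp) ?_
        by_contra hc
        have hpd : p ∈ (tree ι).dom :=
          (h.step ι ((hBα n).trans h1) (h2.trans (hBγ _)) p hp).mem_dom bohmRed_proper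
        by_cases hpγ : p ∈ (tree γ).dom
        · exact ((hst n p ⟨not_le.1 hc, Or.inl hpγ⟩ ι h1 (h2.trans (hBγ _))).1 hpγ).2 p hp
            (cut_prefix a p)
        · obtain ⟨q, hq, hqp⟩ := h.exists_volatile_prefix h0 hγ (hBα n) (hst n) h1
            (h2.trans (hBγ _)) hpd (not_le.1 hc) hpγ
          exact hpQ q hq hqp
    -- It remains to erase the newly volatile subtrees. They have depth at least `n`, since
    -- otherwise they would already be in `Q n`.
    have e : Q (n + 1) = Q n ∪ Q (n + 1) \ Q n := (Set.union_sdiff_cancel (hQsub n)).symm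
    refine h1.trans ?_
    conv_rhs => rw [e]
    refine mRed_trunc_union (((frontier_finite (n + 1) _).subset fun q hq => hq.1).sdiff)
      (fun q hq => max_le (hQcut _ q hq.1).2 (hQnew n q hq)) (fun q hq => hfrag _ q hq.1) ?_
    rw [← e]
    exact fun q hq q' hq' hqq => prefix_eq_of_volatile hq hq' hqq
  have hagree : ∀ n, AgreeBelow n ((tree (B n)).trunc (Q n)) (tree γ) := by
    intro n x hx
    by_cases hxγ : x ∈ (tree γ).dom
    · rw [GTree.trunc_lab fun q hq hqx => hq.2.1 (mem_dom_of_prefix hqx hxγ)]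
      exact ((hst n x ⟨hx, Or.inl hxγ⟩ _ le_rfl (hBγ n)).1 hxγ).1
    · have h1 : (tree γ).lab x = none := not_not.1 hxγ
      rw [h1]
      by_contra hc
      obtain ⟨h2, h3⟩ := GTree.mem_dom_trunc.1 hc
      obtain ⟨q, hq, hqx⟩ := h.exists_volatile_prefix h0 hγ (hBα n) (hst n) le_rfl (hBγ n) h3
        hx hxγ
      exact h2 q hq hqx
  have hstart : (tree (B 0)).trunc (Q 0) = tree α₀ := by
    rw [hB0]
    exact GTree.ext_lab fun x => GTree.trunc_lab fun q hq => absurd hq.1.1 (Nat.not_lt_zero _)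
  rw [← hstart]
  exact MRed.sequence (u := fun n => (tree (B n)).trunc (Q n)) (d := fun n => max d n) hstep
    (fun n => le_max_left _ _) (fun e => ⟨e, fun n hn => hn.trans (le_max_right _ _)⟩)
    fun e => ⟨e, fun n hn => (hagree n).mono hn⟩

end LamCalc

theorem mainTheorem7 (a : LamCalc.Sig) {V : Type u} [Countable V] [Infinite V]
    (s t : LamCalc.GTree a V)
    (h : LamCalc.PConvergesTo (LamCalc.betaStrictRed.{u} a) s t) :
    LamCalc.MConvergesTo (LamCalc.bohmRed.{u} (LamCalc.fragileTotal a)) s t := by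
  obtain ⟨S, rfl, rfl, hS⟩ := h
  exact (((S.lazy LamCalc.betaStrictRed_proper hS).imp LamCalc.bohmRed_of_betaStrictRed).mRed
    zero_le (d := 0) fun _ _ _ _ _ => Nat.zero_le _).mConvergesTo
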